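/- Let $(\mathcal X,(\cdot,\cdot)_{\mathcal X})$ be a complex Hilbert space and let $A$ and $\Lambda$ be linear operators on $\mathcal X$ with domains $D(A)$, $D(\Lambda)$. Write $\mathcal Y=N(\Lambda)^\perp$ for the orthogonal complement of the kernel of $\Lambda$, and $\mathbb Q$ for the orthogonal projection from $\mathcal X$ onto $\mathcal Y$. Assume the following. 1. $A$ is self-adjoint and there is $C_A>0$ with $(-Au,u)_{\mathcal X}\ge C_A\|u\|_{\mathcal X}^2$ for all $u\in D(A)$. 2. $\Lambda$ is densely defined, closed and $A$-compact (i.e. $D(A)\subset D(\Lambda)$, and $(\Lambda u_n)$ has a convergent subsequence whenever $u_n\in D(A)$ and $(u_n)$, $(Au_n)$ are bounded), and $\mathbb Q A\subset A\mathbb Q$. 3. There are a Hilbert space $\mathcal H\supset\mathcal X$ with $(u,v)_{\mathcal X}=(u,v)_{\mathcal H}$ for $u,v\in\mathcal X$, a closed symmetric operator $B_1$ on $\mathcal H$ and a bounded self-adjoint operator $B_2$ on $\mathcal X$ such that $N(\Lambda)=N(B_2)$, such that $B_2u\in D(B_1)$ and $B_1B_2u=\Lambda u$ for all $u\in D(\Lambda)$,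 and, for a constant $c>0$, $$(u,B_2u)_{\mathcal X}\ge c\|u\|_{\mathcal X}^2\quad(u\in\mathcal Y),\qquad \mathrm{Re}(-Au,B_2u)_{\mathcal X}\ge c\|(-A)^{1/2}u\|_{\mathcal X}^2\quad(u\in D(A)\cap\mathcal Y).$$ 4. There are bounded functions $h_1,h_2\colon(0,\infty)\times\mathbb R\to[0,\infty)$ with $\lim_{\xi\to\infty}\sup_{\mu\in\mathbb R}h_j(\xi,\mu)=0$ for $j=1,2$, a Banach space $\mathcal B\supset\mathcal X$, a closed operator $B_3$ on $\mathcal B$ with $D((-A)^{1/2})\subset D(B_3)$, and a constant $c'>0$ such that, for all $u\in D(A)\cap\mathcal Y$, $\xi>0$ and $\mu\in\mathbb R$, $$\|u\|_{\mathcal X}^2\le c'\bigl(\xi^2\|\mathbb Q(\mu-\Lambda)u\|_{\mathcal X}^2+h_1(\xi,\mu)^2\|(-A)^{1/2}u\|_{\mathcal X}^2\bigr),$$ $$|\mathrm{Im}(Au,\Lambda u)_{\mathcal X}|\le c'\|(-A)^{1/2}u\|_{\mathcal X}\|B_3u\|_{\mathcal B},$$ $$\|B_3u\|_{\mathcal B}^2\le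 c'\bigl(\xi^2\|\mathbb Q(\mu-\Lambda)u\|_{\mathcal X}^2+h_2(\xi,\mu)^2\|(-A)^{1/2}u\|_{\mathcal X}^2\bigr).$$ For $\alpha\in\mathbb R$ let $L_\alpha=A-i\alpha\Lambda$ with $D(L_\alpha)=D(A)$. Then, for every $\alpha\in\mathbb R$, $L_\alpha$ generates an analytic semigroup $\{e^{tL_\alpha}\}_{t\ge0}$ in $\mathcal X$. Moreover, there are constants $C_1,C_2>0$ depending only on $\|B_2\|_{\mathcal X\to\mathcal X}$, $c$ and $c'$ (in particular not on $C_A$) such that, for all $\alpha\in\mathbb R\setminus\{0\}$, $t\ge0$ and $f\in\mathcal X$, $$\|\mathbb Qe^{tL_\alpha}f\|_{\mathcal X}\le C_1e^{-C_2t/F(\alpha)}\|\mathbb Qf\|_{\mathcal X},$$ where $F(\alpha)=\sup_{\mu\in\mathbb R}F(\alpha,\mu)$ and $$F(\alpha,\mu)=\inf_{\xi_1,\xi_2>0}\left(\frac{\xi_1}{|\alpha|}+\frac{\xi_1^2\xi_2^2}{\alpha^2}+\frac{\xi_1^2h_2(\xi_2,\mu)}{|\alpha|}+h_1(\xi_1,\mu)^2\right).$$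 (If $F(\alpha)=0$, which forces $\mathcal Y=\{0\}$, the exponential factor is read as $1$; both sides then vanish.) -/

import Mathlib

open Filter Topology

noncomputable section

namespace AbstractDecay

/-! ### Unbounded operators: evaluation, kernel, square root, relative compactness -/

section Operators

variable {X : Type*} [NormedAddCommGroup X] [InnerProductSpace ℂ X]

open Classical in
/-- The value `T u` of an unbounded operator for `u ∈ D(T)` (and `0` outside the domain). -/
def ev {E F : Type*} [AddCommGroup E] [Module ℂ E] [AddCommGroup F] [Module ℂ F]
    (T : E →ₗ.[ℂ] F) (u : E) : F :=
  if h : u ∈ T.domain then T ⟨u, h⟩ else 0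

/-- The kernel `N(T) = {u ∈ D(T) | T u = 0}`, as a subspace of the whole space. -/
def kernel (T : X →ₗ.[ℂ] X) : Submodule ℂ X :=
  (LinearMap.ker T.toFun).map T.domain.subtype

/-- `S` is a nonnegative self-adjoint operator with `S ∘ S = T` (including equality of the
domains). -/
structure IsPosSqrt [CompleteSpace X] (S T : X →ₗ.[ℂ] X) : Prop where
  selfAdjoint : IsSelfAdjoint S
  nonneg : ∀ u : S.domain, 0 ≤ (inner ℂ (S u) (u : X)).re
  sq : ∀ u v : X, (u, v) ∈ T.graph ↔ ∃ w : X, (u, w) ∈ S.graph ∧ (w, v) ∈ S.graph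

/-- The square root exists for self-adjoint operators that are bounded below by a positive
constant. -/
theorem exists_isPosSqrt [CompleteSpace X] (T : X →ₗ.[ℂ] X) (hT : IsSelfAdjoint T) (a : ℝ)
    (ha : 0 < a) (hco : ∀ u : T.domain, a * ‖(u : X)‖ ^ 2 ≤ (inner ℂ (T u) (u : X)).re) :
    ∃ S, IsPosSqrt S T := by
  have hd := hT.dense_domain
  have hadj : T.adjoint = T := hT
  have hsym : ∀ u v : T.domain, inner ℂ (T u) (v : X) = inner ℂ (u : X) (T v) := by
    have h := LinearPMap.adjoint_isFormalAdjoint hd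
    rw [hadj] at h
    exact fun u v => h u v
  have hlow : ∀ u : T.domain, a * ‖(u : X)‖ ≤ ‖T u‖ := by
    intro u
    rcases eq_or_ne ‖(u : X)‖ 0 with h0 | h0
    · simp [h0]
    · have h1 := (hco u).trans ((Complex.re_le_norm _).trans (norm_inner_le_norm _ _))
      have hpos : 0 < ‖(u : X)‖ := lt_of_le_of_ne (norm_nonneg _) (Ne.symm h0)
      nlinarith
  have hcl : IsClosed ((LinearMap.range T.toFun : Submodule ℂ X) : Set X) := by
    have hg : IsClosed (T.graph : Set (X × X)) := hT.isClosed
    rw [← isSeqClosed_iff_isClosed]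
    intro x p hx hp
    choose u hu using hx
    have hc : CauchySeq (fun n => ((u n : X))) := by
      have hxc := hp.cauchySeq
      rw [Metric.cauchySeq_iff] at hxc ⊢
      intro ε hε
      obtain ⟨N, hN⟩ := hxc (a * ε) (by positivity)
      refine ⟨N, fun m hm n hn => ?_⟩
      have h1 := hN m hm n hn
      have h2 := hlow (u m - u n)
      rw [← hu m, ← hu n, dist_eq_norm, ← map_sub] at h1
      rw [dist_eq_norm]
      have h3 : a * ‖(u m : X) - u n‖ < a * ε := lt_of_le_of_lt h2 h1
      exact lt_of_mul_lt_mul_left h3 ha.le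
    obtain ⟨w, hw⟩ := cauchySeq_tendsto_of_complete hc
    have hmem : (w, p) ∈ T.graph := by
      refine hg.mem_of_tendsto (hw.prodMk_nhds hp) (Eventually.of_forall fun n => ?_)
      exact (LinearPMap.mem_graph_iff T).2 ⟨u n, rfl, hu n⟩
    obtain ⟨y, -, hy⟩ := (LinearPMap.mem_graph_iff T).1 hmem
    exact ⟨y, hy⟩
  have hsurj : LinearMap.range T.toFun = ⊤ := by
    have : CompleteSpace (LinearMap.range T.toFun) := hcl.completeSpace_coe
    rw [← Submodule.orthogonal_eq_bot_iff, Submodule.eq_bot_iff]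
    intro y hy
    have hy' : ∀ x : T.domain, inner ℂ (0 : X) (x : X) = inner ℂ y (T x) := by
      intro x
      rw [inner_zero_left]
      exact ((Submodule.mem_orthogonal' _ _).1 hy _ ⟨x, rfl⟩).symm
    have hm : y ∈ T.adjoint.domain := LinearPMap.mem_adjoint_domain_of_exists y ⟨0, hy'⟩
    have h0 := LinearPMap.adjoint_apply_eq hd ⟨y, hm⟩ hy'
    have hm2 : y ∈ T.domain := by rw [← hadj]; exact hm
    have h1 : T ⟨y, hm2⟩ = 0 := by
      rw [← h0]
      have h5 : T.adjoint ⟨y, hm⟩ = T ⟨y, hm2⟩ := by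
        apply (LinearPMap.ext_iff.1 hadj).2
      exact h5.symm
    have h2 := hlow ⟨y, hm2⟩
    rw [h1, norm_zero] at h2
    have : ‖y‖ ≤ 0 := by
      by_contra h
      push Not at h
      nlinarith [mul_pos ha h]
    exact norm_le_zero_iff.1 this
  have hinv : ∀ f : X, ∃ u : T.domain, T u = f := fun f => by
    have : f ∈ LinearMap.range T.toFun := by rw [hsurj]; trivial
    exact this
  have hinj : ∀ u v : T.domain, T u = T v → u = v := by
    intro u v h
    have h2 := hlow (u - v)
    rw [LinearPMap.map_sub, h, sub_self, norm_zero] at h2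
    have h3 : ‖((u - v : T.domain) : X)‖ ≤ 0 := by
      by_contra h
      push Not at h
      nlinarith [mul_pos ha h]
    exact sub_eq_zero.1 (Subtype.ext (norm_le_zero_iff.1 h3))
  choose g hg using hinv
  let G₀ : X →ₗ[ℂ] X :=
    { toFun := fun f => (g f : X)
      map_add' := fun x y => by
        rw [← Submodule.coe_add]
        congr 1
        exact hinj _ _ (by rw [LinearPMap.map_add, hg, hg, hg])
      map_smul' := fun r x => by
        rw [RingHom.id_apply, ← Submodule.coe_smul]
        congr 1
        exact hinj _ _ (by rw [LinearPMap.map_smul, hg, hg]) }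
  let G : X →L[ℂ] X := G₀.mkContinuous a⁻¹ (fun f => by
    have h := hlow (g f)
    rw [hg] at h
    rw [inv_mul_eq_div, le_div_iff₀ ha, mul_comm]
    exact h)
  have hGg : ∀ f, G f = (g f : X) := fun f => rfl
  have hGpos : 0 ≤ G := by
    rw [ContinuousLinearMap.nonneg_iff_isPositive, ContinuousLinearMap.isPositive_iff_complex]
    intro x
    have h1 : inner ℂ (G x) x = inner ℂ x (G x) := by
      have := hsym (g x) (g x)
      rw [hg] at this
      exact this.symm
    have h2 : (starRingEnd ℂ) (inner ℂ (G x) x) = inner ℂ (G x) x := by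
      rw [inner_conj_symm]; exact h1.symm
    refine ⟨Complex.conj_eq_iff_re.1 h2, ?_⟩
    have h3 := hco (g x)
    rw [hg] at h3
    change 0 ≤ (inner ℂ (G x) x).re
    rw [h1]
    exact le_trans (by positivity) h3
  obtain ⟨R, hRpos, hRR⟩ : ∃ R : X →L[ℂ] X, 0 ≤ R ∧ R * R = G :=
    ⟨CFC.sqrt G, CFC.sqrt_nonneg G, CFC.sqrt_mul_sqrt_self G hGpos⟩
  have hRsa : ∀ x y, inner ℂ (R x) y = inner ℂ x (R y) := by
    have h := (ContinuousLinearMap.nonneg_iff_isPositive R).1 hRpos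
    exact h.isSymmetric
  have hRRx : ∀ x, R (R x) = (g x : X) := fun x => by
    rw [← hGg, ← hRR]; rfl
  have hRinj : ∀ x, R x = 0 → x = 0 := by
    intro x hx
    have : (g x : X) = 0 := by rw [← hRRx, hx, map_zero]
    have h2 : g x = 0 := Subtype.ext this
    rw [← hg x, h2, LinearPMap.map_zero]
  let e : X ≃ₗ[ℂ] LinearMap.range (R : X →ₗ[ℂ] X) :=
    LinearEquiv.ofInjective (R : X →ₗ[ℂ] X)
      ((injective_iff_map_eq_zero (R : X →ₗ[ℂ] X)).2 hRinj)
  let S : X →ₗ.[ℂ] X := ⟨LinearMap.range (R : X →ₗ[ℂ] X), e.symm.toLinearMap⟩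
  have hSgraph : ∀ u v, (u, v) ∈ S.graph ↔ R v = u := by
    intro u v
    rw [LinearPMap.mem_graph_iff]
    constructor
    · rintro ⟨y, hy1, hy2⟩
      change (y : X) = u at hy1
      change S y = v at hy2
      have h1 : e v = y := by
        rw [← hy2]; exact e.apply_symm_apply y
      rw [← hy1, ← h1]; rfl
    · intro h
      refine ⟨e v, h, e.symm_apply_apply v⟩
  have hSR : ∀ u : S.domain, R (S u) = u := fun u =>
    (hSgraph _ _).1 (LinearPMap.mem_graph S u)
  have hSd : Dense (S.domain : Set X) := by
    refine hd.mono ?_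
    intro u hu
    refine ⟨R (T ⟨u, hu⟩), ?_⟩
    change R (R _) = u
    rw [hRRx, hinj _ _ (hg (T ⟨u, hu⟩))]
  refine ⟨S, ?_, ?_, ?_⟩
  · rw [LinearPMap.isSelfAdjoint_def]
    have hform : S.IsFormalAdjoint S := by
      intro x y
      have := hRsa (S x) (S y)
      rw [hSR, hSR] at this
      exact this.symm
    refine le_antisymm ?_ (LinearPMap.IsFormalAdjoint.le_adjoint hSd hform)
    have hA := LinearPMap.adjoint_isFormalAdjoint hSd
    apply LinearPMap.le_of_le_graph
    rintro ⟨y, z⟩ hyz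
    rw [hSgraph]
    obtain ⟨y', rfl, rfl⟩ := (LinearPMap.mem_graph_iff _).1 hyz
    refine ext_inner_right ℂ fun v => ?_
    have h1 := hA y' (e v)
    have h2 : S (e v) = v := e.symm_apply_apply v
    have h3 : ((e v : S.domain) : X) = R v := rfl
    rw [h2, h3] at h1
    rw [hRsa]
    exact h1
  · intro u
    have h := (ContinuousLinearMap.nonneg_iff_isPositive R).1 hRpos
    have h1 := h.re_inner_nonneg_right (S u)
    rw [hSR] at h1
    exact h1
  · intro u v
    constructor
    · intro h
      refine ⟨R v, (hSgraph _ _).2 ?_, (hSgraph _ _).2 rfl⟩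
      obtain ⟨y, rfl, rfl⟩ := (LinearPMap.mem_graph_iff _).1 h
      rw [hRRx, hinj _ _ (hg (T y))]
    · rintro ⟨w, h1, h2⟩
      rw [hSgraph] at h1 h2
      refine (LinearPMap.mem_graph_iff _).2 ⟨g v, ?_, hg v⟩
      rw [← hRRx, h2, h1]

open Classical in
/-- The square root `T ^ (1/2)`: the nonnegative self-adjoint operator with square `T`. -/
def posSqrt [CompleteSpace X] (T : X →ₗ.[ℂ] X) : X →ₗ.[ℂ] X :=
  if h : ∃ S, IsPosSqrt S T then h.choose else ⊥

/-- `Λ` is `A`-compact: `D(A) ⊆ D(Λ)`, and whenever `(u n)` and `(A (u n))` are bounded,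
`(Λ (u n))` has a convergent subsequence. -/
def RelativelyCompact (A Λ : X →ₗ.[ℂ] X) : Prop :=
  A.domain ≤ Λ.domain ∧
    ∀ u : ℕ → X, (∀ n, u n ∈ A.domain) →
      (∃ M : ℝ, ∀ n, ‖u n‖ ≤ M ∧ ‖ev A (u n)‖ ≤ M) →
      ∃ (v : X) (k : ℕ → ℕ), StrictMono k ∧ Tendsto (fun n => ev Λ (u (k n))) atTop (𝓝 v)

end Operators

/-! ### Semigroups -/

section Semigroups

variable {X : Type*} [NormedAddCommGroup X] [NormedSpace ℂ X]

/-- The open sector `{z ≠ 0 | |arg z| < δ}`. -/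
def sector (δ : ℝ) : Set ℂ := {z | z ≠ 0 ∧ |z.arg| < δ}

/-- `(T t)`, `t ≥ 0`, is a strongly continuous semigroup of bounded operators
(values at `t < 0` are irrelevant). -/
structure IsC0Semigroup (T : ℝ → X →L[ℂ] X) : Prop where
  zero : T 0 = ContinuousLinearMap.id ℂ X
  add : ∀ s t : ℝ, 0 ≤ s → 0 ≤ t → T (s + t) = (T s).comp (T t)
  continuous : ∀ f : X, ContinuousOn (fun t => T t f) (Set.Ici 0)

/-- A strongly continuous semigroup is analytic if it extends to a holomorphic semigroup on some
sector, strongly continuous at the origin in every smaller sector. -/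
structure IsAnalyticSemigroup (T : ℝ → X →L[ℂ] X) : Prop extends IsC0Semigroup T where
  analytic : ∃ δ : ℝ, 0 < δ ∧ δ ≤ Real.pi / 2 ∧ ∃ Z : ℂ → X →L[ℂ] X,
    (∀ t : ℝ, 0 < t → Z (t : ℂ) = T t) ∧
    DifferentiableOn ℂ Z (sector δ) ∧
    (∀ z ∈ sector δ, ∀ w ∈ sector δ, Z (z + w) = (Z z).comp (Z w)) ∧
    ∀ δ' : ℝ, 0 < δ' → δ' < δ → ∀ f : X,
      Tendsto (fun z => Z z f) (𝓝[sector δ'] 0) (𝓝 f)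

/-- `L` is the infinitesimal generator of `T`: `u ∈ D(L)` and `L u = v` if and only if
`(T t u - u) / t → v` as `t → 0+`. -/
def IsGenerator (L : X →ₗ.[ℂ] X) (T : ℝ → X →L[ℂ] X) : Prop :=
  ∀ u v : X, (u, v) ∈ L.graph ↔
    Tendsto (fun t : ℝ => t⁻¹ • (T t u - u)) (𝓝[>] 0) (𝓝 v)

end Semigroups

/-! ### The perturbed operator and the assumptions on it -/

section Assumptions

variable {X : Type*} [NormedAddCommGroup X] [InnerProductSpace ℂ X] [CompleteSpace X]

/-- `𝒴 = N(Λ)ᗮ`. -/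
def Y (Λ : X →ₗ.[ℂ] X) : Submodule ℂ X := (kernel Λ)ᗮ

instance (Λ : X →ₗ.[ℂ] X) : (Y Λ).HasOrthogonalProjection :=
  inferInstanceAs ((kernel Λ)ᗮ).HasOrthogonalProjection

/-- The orthogonal projection `ℚ` from `𝒳` onto `𝒴`. -/
def Q (Λ : X →ₗ.[ℂ] X) : X →L[ℂ] X := (Y Λ).starProjection

/-- `L_α = A - iαΛ`. The domain of this difference is `D(A) ∩ D(Λ)`, which is `D(A)` when `Λ` is
`A`-compact. -/
def L (A Λ : X →ₗ.[ℂ] X) (α : ℝ) : X →ₗ.[ℂ] X := A - (Complex.I * (α : ℂ)) • Λ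

/-- `A` is self-adjoint and `-A` is bounded below by a positive constant. -/
structure AssumptionA (A : X →ₗ.[ℂ] X) : Prop where
  selfAdjoint : IsSelfAdjoint A
  coercive : ∃ C_A : ℝ, 0 < C_A ∧
    ∀ u ∈ A.domain, C_A * ‖u‖ ^ 2 ≤ (inner ℂ (-ev A u) u).re

/-- `Λ` is densely defined, closed and `A`-compact, and `ℚ A ⊆ A ℚ`. -/
structure AssumptionLambda (A Λ : X →ₗ.[ℂ] X) : Prop where
  dense : Dense (Λ.domain : Set X)
  closed : Λ.IsClosed
  compact : RelativelyCompact A Λ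
  comm : ∀ u ∈ A.domain, Q Λ u ∈ A.domain ∧ ev A (Q Λ u) = Q Λ (ev A u)

/-- The factorization `Λ = B₁ B₂` with a closed symmetric operator `B₁` on a Hilbert space `H` that
contains `𝒳` with the same inner product (the inclusion is the linear isometry `J`) and a bounded
self-adjoint operator `B₂` on `𝒳`; `c` is the constant in the two coercivity inequalities. -/
structure AssumptionFactor (A Λ : X →ₗ.[ℂ] X)
    {H : Type*} [NormedAddCommGroup H] [InnerProductSpace ℂ H]
    (J : X →ₗᵢ[ℂ] H) (B₁ : H →ₗ.[ℂ] H) (B₂ : X →L[ℂ] X) (c : ℝ) : Prop where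
  closed : B₁.IsClosed
  symmetric : B₁.IsFormalAdjoint B₁
  selfAdjoint : IsSelfAdjoint B₂
  ker_eq : kernel Λ = LinearMap.ker (B₂ : X →ₗ[ℂ] X)
  factor : ∀ u ∈ Λ.domain, J (B₂ u) ∈ B₁.domain ∧ ev B₁ (J (B₂ u)) = J (ev Λ u)
  coercive : ∀ u ∈ Y Λ, c * ‖u‖ ^ 2 ≤ (inner ℂ u (B₂ u)).re
  coercive_A : ∀ u ∈ A.domain, u ∈ Y Λ →
    c * ‖ev (posSqrt (-A)) u‖ ^ 2 ≤ (inner ℂ (-ev A u) (B₂ u)).re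

/-- `h : (0, ∞) × ℝ → [0, ∞)` is bounded and `sup_μ h(ξ, μ) → 0` as `ξ → ∞`. -/
structure AdmissibleFunction (h : ℝ → ℝ → ℝ) : Prop where
  nonneg : ∀ ξ > 0, ∀ μ, 0 ≤ h ξ μ
  bounded : ∃ M : ℝ, ∀ ξ > 0, ∀ μ, h ξ μ ≤ M
  tendsto : Tendsto (fun ξ => ⨆ μ : ℝ, h ξ μ) atTop (𝓝 0)

/-- The coercive estimates for `ℚ(μ - Λ)`, where `B₃` is a closed operator on a Banach space `B`
that contains `𝒳` as a linear subspace (the inclusion is the injective linear map `ι`). -/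
structure AssumptionEstimate (A Λ : X →ₗ.[ℂ] X) (h₁ h₂ : ℝ → ℝ → ℝ)
    {B : Type*} [NormedAddCommGroup B] [NormedSpace ℂ B]
    (ι : X →ₗ[ℂ] B) (B₃ : B →ₗ.[ℂ] B) (c : ℝ) : Prop where
  h₁_adm : AdmissibleFunction h₁
  h₂_adm : AdmissibleFunction h₂
  inj : Function.Injective ι
  closed : B₃.IsClosed
  est_u : ∀ ξ > 0, ∀ μ : ℝ, ∀ u ∈ A.domain, u ∈ Y Λ →
    ‖u‖ ^ 2 ≤ c * (ξ ^ 2 * ‖Q Λ ((μ : ℂ) • u - ev Λ u)‖ ^ 2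
      + h₁ ξ μ ^ 2 * ‖ev (posSqrt (-A)) u‖ ^ 2)
  domain : ∀ u ∈ (posSqrt (-A)).domain, ι u ∈ B₃.domain
  est_im : ∀ u ∈ A.domain, u ∈ Y Λ →
    |(inner ℂ (ev A u) (ev Λ u)).im| ≤ c * ‖ev (posSqrt (-A)) u‖ * ‖ev B₃ (ι u)‖
  est_B₃ : ∀ ξ > 0, ∀ μ : ℝ, ∀ u ∈ A.domain, u ∈ Y Λ →
    ‖ev B₃ (ι u)‖ ^ 2 ≤ c * (ξ ^ 2 * ‖Q Λ ((μ : ℂ) • u - ev Λ u)‖ ^ 2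
      + h₂ ξ μ ^ 2 * ‖ev (posSqrt (-A)) u‖ ^ 2)

/-- `F(α, μ)`, an infimum over `ξ₁, ξ₂ > 0`. -/
def rateAt (h₁ h₂ : ℝ → ℝ → ℝ) (α μ : ℝ) : ℝ :=
  ⨅ ξ : Set.Ioi (0 : ℝ) × Set.Ioi (0 : ℝ),
    ((ξ.1 : ℝ) / |α| + (ξ.1 : ℝ) ^ 2 * (ξ.2 : ℝ) ^ 2 / α ^ 2
      + (ξ.1 : ℝ) ^ 2 * h₂ ξ.2 μ / |α| + h₁ ξ.1 μ ^ 2)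

/-- `F(α) = sup_μ F(α, μ)`. -/
def rate (h₁ h₂ : ℝ → ℝ → ℝ) (α : ℝ) : ℝ := ⨆ μ : ℝ, rateAt h₁ h₂ α μ

end Assumptions

end AbstractDecay

end

open Filter Topology

noncomputable section

namespace AbstractDecay

open MeasureTheory Complex

/-! ### Integrals over a wedge-shaped contour -/

section Contour

variable {E : Type*} [NormedAddCommGroup E] [NormedSpace ℂ E]

/-! Generation. Since `A` is self-adjoint and negative, `l - A` is bounded below by `‖l‖ / 2` for
`|arg l| < 3π/4`. A closed `A`-compact `Λ` has `A`-bound zero, so for large `l` a Neumann series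
inverts `l - L_α` with the same kind of bound (`exists_sectorial_resolvent`). The semigroup is then
the Dunford integral of `exp (z l) (l - L_α)⁻¹` over a wedge contour
(`IsSectorialResolvent.exists_semigroup`).

Resolvent bound on the imaginary axis. The form `(u, B₂ u)` is equivalent to `‖ℚ u‖²`. Because `Λ =
B₁ B₂` with `B₁` symmetric, `(Λ u, B₂ u)` is real, so `-iαΛ` does not contribute to the real part:
the energy never increases, and `g = (il - ℚ L_α) w` satisfies `c ‖(-A)^(1/2) w‖² ≤ ‖B₂‖ ‖g‖ ‖w‖`.
The imaginary part of `(g, ℚ(μ - Λ) w)` with `μ = -l/α` controls `ℚ(μ - Λ) w`. Inserting both into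
the two coercive estimates and optimizing over `ξ₁, ξ₂` gives `‖w‖ ≤ const · F(α) ‖g‖` uniformly in
`l` (`pseudospectral_bound`).

Decay. This is a quantitative Gearhart–Prüss argument. Cut a solution `u` off in time by `χ`; then
`χ u` solves the equation with forcing `χ' u`, and Plancherel turns the resolvent bound into `∫ ‖ℚ χ
u‖² ≤ M² ∫ ‖ℚ χ' u‖²` with `M ~ F(α)` (`integral_cutoff_le`). Together with monotonicity of the
energy, this divides the energy by four over a time proportional to `F(α)` (`energy_le_quarter`);
iteration gives the exponential rate. No step uses the size of `C_A`, so the constants depend only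
on `‖B₂‖`, `c`, `c'`. -/

/-- The wedge contour with vertex `γ`, opening to the left at the angles `± 3π/4`. -/
def contour (γ s : ℝ) : ℂ := ⟨γ - |s|, s⟩

/-- The derivative of `s ↦ contour γ s` away from `s = 0`. -/
def contourWeight (s : ℝ) : ℂ := if 0 < s then I - 1 else I + 1

/-- The integral of `G` along the wedge contour with vertex `γ`. -/
def contourIntegral (γ : ℝ) (G : ℂ → E) : E := ∫ s : ℝ, contourWeight s • G (contour γ s)

@[simp] lemma contour_re (γ s : ℝ) : (contour γ s).re = γ - |s| := rfl

@[simp] lemma contour_im (γ s : ℝ) : (contour γ s).im = s := rfl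

lemma contour_eq (γ s : ℝ) : contour γ s = ((γ - |s| : ℝ) : ℂ) + s * I := by
  apply Complex.ext <;> simp

lemma continuous_contour (γ : ℝ) : Continuous (contour γ) := by
  simp only [funext (contour_eq γ)]
  fun_prop

lemma norm_contourWeight_le (s : ℝ) : ‖contourWeight s‖ ≤ 2 := by
  unfold contourWeight
  split_ifs
  · exact (norm_sub_le _ _).trans (by simp; norm_num)
  · exact (norm_add_le _ _).trans (by simp; norm_num)

lemma measurable_contourWeight : Measurable contourWeight :=
  Measurable.ite measurableSet_Ioi measurable_const measurable_const

lemma sq_add_sq_le_contour (γ s : ℝ) : γ ^ 2 + s ^ 2 ≤ 3 * ‖contour γ s‖ ^ 2 := by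
  rw [← normSq_eq_norm_sq, normSq_apply, contour_re, contour_im]
  nlinarith [sq_abs s, sq_nonneg (2 * γ - 3 * |s|), sq_nonneg s]

lemma le_norm_contour (γ s : ℝ) : |γ| / 2 ≤ ‖contour γ s‖ := by
  refine abs_le_of_sq_le_sq' ?_ (norm_nonneg _) |>.2
  have := sq_add_sq_le_contour γ s
  rw [div_pow, sq_abs]
  nlinarith [sq_nonneg s]

lemma integrable_inv_one_add_mul_sq (C : ℝ) {a : ℝ} (ha : 0 < a) :
    Integrable (fun s : ℝ => C * (1 + (a * s) ^ 2)⁻¹) :=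
  (integrable_inv_one_add_sq.comp_mul_left' ha.ne').const_mul C

lemma integrable_bound (C : ℝ) : Integrable (fun s : ℝ => C * (1 + s ^ 2)⁻¹) :=
  integrable_inv_one_add_sq.const_mul C

lemma aestronglyMeasurable_contour {γ : ℝ} {G : ℂ → E}
    (hc : Continuous fun s => G (contour γ s)) :
    AEStronglyMeasurable (fun s => contourWeight s • G (contour γ s)) :=
  measurable_contourWeight.aestronglyMeasurable.smul hc.aestronglyMeasurable

lemma norm_contourWeight_smul_le {s C : ℝ} {x : E} (h : ‖x‖ ≤ C) :
    ‖contourWeight s • x‖ ≤ 2 * C := by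
  rw [norm_smul]
  exact mul_le_mul (norm_contourWeight_le s) h (norm_nonneg _) zero_le_two

lemma integrable_contour {γ C : ℝ} {G : ℂ → E} (hc : Continuous fun s => G (contour γ s))
    (hb : ∀ s, ‖G (contour γ s)‖ ≤ C * (1 + s ^ 2)⁻¹) :
    Integrable (fun s => contourWeight s • G (contour γ s)) := by
  refine (integrable_bound (2 * C)).mono' (aestronglyMeasurable_contour hc)
    (Eventually.of_forall fun s => ?_)
  rw [mul_assoc]
  exact norm_contourWeight_smul_le (hb s)

lemma norm_contourIntegral_le {γ C a : ℝ} (ha : 0 < a) {G : ℂ → E}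
    (hb : ∀ s, ‖G (contour γ s)‖ ≤ C * (1 + (a * s) ^ 2)⁻¹) :
    ‖contourIntegral γ G‖ ≤ 2 * C * (a⁻¹ * Real.pi) := by
  refine (norm_integral_le_of_norm_le (integrable_inv_one_add_mul_sq (2 * C) ha)
    (Eventually.of_forall fun s => ?_)).trans_eq ?_
  · rw [mul_assoc]
    exact norm_contourWeight_smul_le (hb s)
  · rw [integral_const_mul, Measure.integral_comp_mul_left (fun x : ℝ => (1 + x ^ 2)⁻¹),
      integral_univ_inv_one_add_sq, smul_eq_mul, abs_of_pos (inv_pos.2 ha)]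

/-- Lets all dominated-convergence arguments share the single majorant `(1 + s²)⁻¹`. -/
lemma exp_neg_mul_abs_le {κ : ℝ} (hκ : 0 < κ) :
    ∃ C : ℝ, 0 < C ∧ ∀ s : ℝ, Real.exp (-(κ * |s|)) ≤ C * (1 + s ^ 2)⁻¹ := by
  refine ⟨max 1 (2 / κ ^ 2), by positivity, fun s => ?_⟩
  have h1 := Real.quadratic_le_exp_of_nonneg (x := κ * |s|) (by positivity)
  have hM1 : 1 ≤ max 1 (2 / κ ^ 2) := le_max_left _ _
  have hM2 : 2 ≤ max 1 (2 / κ ^ 2) * κ ^ 2 := by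
    rw [← div_le_iff₀ (by positivity)]; exact le_max_right _ _
  set m := max 1 (2 / κ ^ 2)
  rw [Real.exp_neg, ← div_eq_mul_inv, inv_eq_one_div, div_le_div_iff₀ (Real.exp_pos _)
    (by positivity), one_mul]
  have h2 : m * (1 + κ * |s| + (κ * |s|) ^ 2 / 2) ≤ m * Real.exp (κ * |s|) :=
    mul_le_mul_of_nonneg_left h1 (by positivity)
  have h3 : 0 ≤ m * (κ * |s|) := by positivity
  rw [mul_pow, sq_abs] at h2
  nlinarith [mul_le_mul_of_nonneg_right hM2 (sq_nonneg s)]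

lemma hasDerivAt_contour {γ s : ℝ} (hs : s ≠ 0) :
    HasDerivAt (contour γ) (contourWeight s) s := by
  rw [funext (contour_eq γ)]
  rcases lt_or_gt_of_ne hs with h | h
  · have h1 : HasDerivAt (fun s : ℝ => ((γ + s : ℝ) : ℂ) + s * I) (1 + 1 * I) s :=
      ((hasDerivAt_id s).const_add γ).ofReal_comp.add ((hasDerivAt_id s).ofReal_comp.mul_const I)
    have h2 : contourWeight s = 1 + 1 * I := by
      simp [contourWeight, not_lt.2 h.le, add_comm]
    rw [h2]
    refine h1.congr_of_eventuallyEq ?_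
    filter_upwards [Iio_mem_nhds h] with x hx
    rw [abs_of_neg hx, sub_neg_eq_add]
  · have h1 : HasDerivAt (fun s : ℝ => ((γ - s : ℝ) : ℂ) + s * I) ((-1 : ℝ) + 1 * I) s := by
      exact ((hasDerivAt_id s).const_sub γ).ofReal_comp.add
        ((hasDerivAt_id s).ofReal_comp.mul_const I)
    have h2 : contourWeight s = (-1 : ℝ) + 1 * I := by
      simp [contourWeight, h]; ring
    rw [h2]
    refine h1.congr_of_eventuallyEq ?_
    filter_upwards [Ioi_mem_nhds h] with x hx
    rw [abs_of_pos hx]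

lemma tendsto_inv_one_add_sq_cocompact (C : ℝ) :
    Tendsto (fun s : ℝ => C * (1 + s ^ 2)⁻¹) atTop (𝓝 0) ∧
      Tendsto (fun s : ℝ => C * (1 + s ^ 2)⁻¹) atBot (𝓝 0) := by
  have h : Tendsto (fun s : ℝ => C * (1 + s ^ 2)⁻¹) atTop (𝓝 0) := by
    have h1 : Tendsto (fun s : ℝ => 1 + s ^ 2) atTop atTop :=
      tendsto_atTop_add_const_left _ _ (tendsto_pow_atTop two_ne_zero)
    simpa using h1.inv_tendsto_atTop.const_mul C
  refine ⟨h, ?_⟩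
  have := h.comp tendsto_neg_atBot_atTop
  refine this.congr fun s => ?_
  simp

variable [CompleteSpace E]

/-- The contour integral of a derivative vanishes. -/
lemma contourIntegral_deriv_eq_zero {γ C : ℝ} {G G' : ℂ → E}
    (hG : ∀ s, HasDerivAt G (G' (contour γ s)) (contour γ s))
    (hb : ∀ s, ‖G (contour γ s)‖ ≤ C * (1 + s ^ 2)⁻¹)
    (hGint : Integrable (fun s => contourWeight s • G' (contour γ s))) :
    contourIntegral γ G' = 0 := by
  have hcont : Continuous fun s => G (contour γ s) := by
    rw [continuous_iff_continuousAt]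
    exact fun s => (hG s).continuousAt.comp (continuous_contour γ).continuousAt
  have hd : ∀ s ≠ 0, HasDerivAt (fun s => G (contour γ s))
      (contourWeight s • G' (contour γ s)) s := fun s hs =>
    (hG s).scomp s (hasDerivAt_contour hs)
  have ht := squeeze_zero_norm hb (tendsto_inv_one_add_sq_cocompact C).1
  have hB := squeeze_zero_norm hb (tendsto_inv_one_add_sq_cocompact C).2
  -- The contour has a corner at `s = 0`, so the fundamental theorem is applied on each half; the
  -- two values at the corner cancel and those at infinity vanish.
  have h1 := integral_Ioi_of_hasDerivAt_of_tendsto (a := 0) hcont.continuousWithinAt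
    (fun s hs => hd s (ne_of_gt hs)) hGint.integrableOn ht
  have h2 := integral_Iic_of_hasDerivAt_of_tendsto (a := 0) hcont.continuousWithinAt
    (fun s hs => hd s (ne_of_lt hs)) hGint.integrableOn hB
  have h3 := integral_add_compl (measurableSet_Iic (a := (0 : ℝ))) hGint
  rw [Set.compl_Iic, h1, h2] at h3
  rw [contourIntegral, ← h3]
  simp

/-- The open region between the wedge contours with vertices `a` and `b`. -/
def wedgeStrip (a b : ℝ) : Set ℂ := {z | a < z.re + |z.im| ∧ z.re + |z.im| < b}

lemma isOpen_wedgeStrip (a b : ℝ) : IsOpen (wedgeStrip a b) := by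
  have h : Continuous fun z : ℂ => z.re + |z.im| := by fun_prop
  exact (isOpen_lt continuous_const h).inter (isOpen_lt h continuous_const)

/-- Moving the vertex of the contour does not change the integral of a holomorphic function. -/
lemma contourIntegral_eq_of_differentiableOn {a b C : ℝ} {G : ℂ → E}
    (hG : DifferentiableOn ℂ G (wedgeStrip a b))
    (hb : ∀ z ∈ wedgeStrip a b, ‖G z‖ ≤ C * (1 + z.im ^ 2)⁻¹) {x y : ℝ}
    (hx : x ∈ Set.Ioo a b) (hy : y ∈ Set.Ioo a b) :
    contourIntegral x G = contourIntegral y G := by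
  have hmem : ∀ x ∈ Set.Ioo a b, ∀ s, contour x s ∈ wedgeStrip a b := fun x hx s => by
    simpa [wedgeStrip] using hx
  have hU := isOpen_wedgeStrip a b
  have hcont : ∀ x ∈ Set.Ioo a b, Continuous fun s => G (contour x s) := fun x hx =>
    hG.continuousOn.comp_continuous (continuous_contour x) (hmem x hx)
  have hdG : DifferentiableOn ℂ (deriv G) (wedgeStrip a b) := hG.deriv hU
  have hcont' : ∀ x ∈ Set.Ioo a b, Continuous fun s => deriv G (contour x s) := fun x hx =>
    hdG.continuousOn.comp_continuous (continuous_contour x) (hmem x hx)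
  -- In place of Cauchy's theorem: the derivative in the vertex is the contour integral of `deriv
  -- G`, which vanishes.
  have key : ∀ x ∈ Set.Ioo a b, HasDerivAt (fun x => contourIntegral x G) 0 x := by
    intro x hx
    -- Moving the vertex by `ρ` and then the point by `ρ` changes `re + |im|` by at most `3ρ`, so a
    -- margin of `4ρ` keeps Cauchy's estimate discs in the strip. The bound `ρ ≤ 1` keeps `1 + im²`
    -- comparable on each disc.
    obtain ⟨ρ, hρ, hρ1, hρa, hρb⟩ : ∃ ρ : ℝ, 0 < ρ ∧ ρ ≤ 1 ∧ a < x - 4 * ρ ∧ x + 4 * ρ < b := by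
      refine ⟨min 1 (min ((x - a) / 8) ((b - x) / 8)), ?_, min_le_left _ _, ?_, ?_⟩
      · have h1 := hx.1; have h2 := hx.2
        refine lt_min one_pos (lt_min ?_ ?_) <;> linarith
      · have := (min_le_right 1 (min ((x - a) / 8) ((b - x) / 8))).trans (min_le_left _ _)
        linarith [hx.1]
      · have := (min_le_right 1 (min ((x - a) / 8) ((b - x) / 8))).trans (min_le_right _ _)
        linarith [hx.2]
    have hball : ∀ y ∈ Metric.ball x ρ, ∀ s, ∀ z ∈ Metric.closedBall (contour y s) ρ,
        z ∈ wedgeStrip a b ∧ 1 + s ^ 2 ≤ 3 * (1 + z.im ^ 2) := by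
      intro y hy s z hz
      rw [Metric.mem_ball, Real.dist_eq, abs_lt] at hy
      rw [Metric.mem_closedBall, dist_eq_norm] at hz
      have h1 := abs_le.1 ((abs_re_le_norm _).trans hz)
      have h2 := abs_le.1 ((abs_im_le_norm _).trans hz)
      simp only [sub_re, sub_im, contour_re, contour_im] at h1 h2
      have h3 := abs_le.1 ((abs_abs_sub_abs_le_abs_sub z.im s).trans (abs_le.2 h2))
      refine ⟨⟨by linarith, by linarith⟩, ?_⟩
      nlinarith [sq_nonneg (2 * z.im - s)]
    have hbd : ∀ s, ∀ y ∈ Metric.ball x ρ,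
        ‖deriv G (contour y s)‖ ≤ 3 * C / ρ * (1 + s ^ 2)⁻¹ := by
      intro s y hy
      have h0 : 0 ≤ C := by
        have := (norm_nonneg _).trans (hb _ (hmem x hx 0))
        simpa using this
      have hs1 : 0 < 1 + s ^ 2 := by positivity
      have := norm_deriv_le_of_forall_mem_sphere_norm_le (C := 3 * C * (1 + s ^ 2)⁻¹)
        (f := G) (c := contour y s) hρ ?_ ?_
      · refine this.trans_eq ?_
        ring
      · refine DifferentiableOn.diffContOnCl ?_
        rw [closure_ball _ hρ.ne']
        exact hG.mono fun z hz => (hball y hy s z hz).1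
      · intro z hz
        obtain ⟨h1, h2⟩ := hball y hy s z (Metric.sphere_subset_closedBall hz)
        refine (hb z h1).trans ?_
        rw [← div_eq_mul_inv, ← div_eq_mul_inv, div_le_div_iff₀ (by positivity) hs1]
        nlinarith
    have hsub : Metric.ball x ρ ⊆ Set.Ioo a b := by
      intro y hy
      rw [Metric.mem_ball, Real.dist_eq, abs_lt] at hy
      exact ⟨by linarith, by linarith⟩
    have hcx : ∀ s, ∀ y : ℝ, HasDerivAt (fun y : ℝ => contour y s) 1 y := by
      intro s y
      have : (fun y : ℝ => contour y s) = fun y : ℝ => (y : ℂ) + ((-|s| : ℝ) + s * I) := by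
        ext y
        rw [contour_eq]
        push_cast
        ring
      rw [this]
      exact (hasDerivAt_id y).ofReal_comp.add_const _
    have hGint' := integrable_contour (hcont' x hx) fun s => hbd s x (Metric.mem_ball_self hρ)
    have h := hasDerivAt_integral_of_dominated_loc_of_deriv_le (μ := volume)
      (F := fun y s => contourWeight s • G (contour y s))
      (F' := fun y s => contourWeight s • deriv G (contour y s))
      (bound := fun s => 2 * (3 * C / ρ) * (1 + s ^ 2)⁻¹) (Metric.ball_mem_nhds x hρ)
      (by
        filter_upwards [Metric.ball_mem_nhds x hρ] with y hy
        exact aestronglyMeasurable_contour (hcont y (hsub hy)))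
      (integrable_contour (hcont x hx) fun s => by
        simpa using hb _ (hmem x hx s))
      (aestronglyMeasurable_contour (hcont' x hx))
      (Eventually.of_forall fun s y hy => by
        rw [mul_assoc]
        exact norm_contourWeight_smul_le (hbd s y hy))
      (integrable_bound _)
      (Eventually.of_forall fun s y hy => by
        have h1 := (hG.differentiableAt (hU.mem_nhds (hmem y (hsub hy) s))).hasDerivAt
        have h2 := (h1.scomp y (hcx s y)).const_smul (contourWeight s)
        rw [one_smul] at h2
        exact h2)
    have h0 : contourIntegral x (deriv G) = 0 :=
      contourIntegral_deriv_eq_zero (C := C)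
        (fun s => (hG.differentiableAt (hU.mem_nhds (hmem x hx s))).hasDerivAt)
        (fun s => by simpa using hb _ (hmem x hx s)) hGint'
    have h3 := h.2
    change HasDerivAt (fun x => contourIntegral x G) (contourIntegral x (deriv G)) x at h3
    rwa [h0] at h3
  exact isOpen_Ioo.is_const_of_deriv_eq_zero (f := fun x => contourIntegral x G)
    isPreconnected_Ioo (fun x hx => (key x hx).differentiableAt.differentiableWithinAt)
    (fun x hx => (key x hx).deriv) hx hy

end Contour

end AbstractDecay

end

open Filter Topology

noncomputable section

namespace AbstractDecay

open MeasureTheory Complex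

/-! ### Laplace-type contour integrals with an exponential factor. -/

section ExpContour

variable {E : Type*} [NormedAddCommGroup E] [NormedSpace ℂ E]

/-- The open quarter plane `{z | |arg z| < π/4}`. -/
def cone : Set ℂ := {z | |z.im| < z.re}

lemma isOpen_cone : IsOpen cone :=
  isOpen_lt (by fun_prop) (by fun_prop)

lemma convex_cone : Convex ℝ cone := by
  intro x hx y hy a b ha hb hab
  simp only [cone, Set.mem_ofPred_eq, add_re, add_im, real_smul, mul_re, mul_im, ofReal_re,
    ofReal_im, zero_mul, sub_zero, add_zero] at *
  have h1 : |a * x.im + b * y.im| ≤ a * |x.im| + b * |y.im| := by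
    refine (abs_add_le _ _).trans_eq ?_
    rw [abs_mul, abs_mul, abs_of_nonneg ha, abs_of_nonneg hb]
  refine h1.trans_lt ?_
  rcases ha.eq_or_lt with rfl | ha
  · have : b = 1 := by linarith
    subst this
    linarith
  · nlinarith [mul_lt_mul_of_pos_left hx ha, mul_le_mul_of_nonneg_left hy.le hb]

lemma ofReal_mem_cone {t : ℝ} (ht : 0 < t) : (t : ℂ) ∈ cone := by
  simpa [cone] using ht

lemma add_mem_cone {z w : ℂ} (hz : z ∈ cone) (hw : w ∈ cone) : z + w ∈ cone := by
  simp only [cone, Set.mem_ofPred_eq, add_re, add_im] at *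
  exact (abs_add_le _ _).trans_lt (add_lt_add hz hw)

lemma smul_mem_cone {z : ℂ} (hz : z ∈ cone) {t : ℝ} (ht : 0 < t) : (t : ℂ) * z ∈ cone := by
  simp only [cone, Set.mem_ofPred_eq, mul_re, mul_im, ofReal_re, ofReal_im, zero_mul, sub_zero,
    add_zero] at *
  rw [abs_mul, abs_of_pos ht]
  exact mul_lt_mul_of_pos_left hz ht

lemma re_pos_of_mem_cone {z : ℂ} (hz : z ∈ cone) : 0 < z.re := (abs_nonneg _).trans_lt hz

lemma ne_zero_of_mem_cone {z : ℂ} (hz : z ∈ cone) : z ≠ 0 := by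
  rintro rfl
  simp [cone] at hz

instance neBot_nhdsWithin_cone : (𝓝[cone] (0 : ℂ)).NeBot := by
  have h : Tendsto (fun t : ℝ => (t : ℂ)) (𝓝[>] 0) (𝓝[cone] 0) := by
    refine tendsto_nhdsWithin_iff.2 ⟨?_, ?_⟩
    · exact (continuous_ofReal.tendsto' 0 0 ofReal_zero).mono_left nhdsWithin_le_nhds
    · filter_upwards [self_mem_nhdsWithin] with t ht using ofReal_mem_cone ht
  exact h.neBot

/-- The quantity `z.re - |z.im|`, positive exactly on `cone`, is the rate of decay along both arms
of the contour. -/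
lemma norm_exp_mul_contour_le (z : ℂ) (γ s : ℝ) :
    ‖exp (z * contour γ s)‖ ≤ Real.exp (γ * z.re) * Real.exp (-((z.re - |z.im|) * |s|)) := by
  rw [norm_exp, ← Real.exp_add, Real.exp_le_exp, mul_re, contour_re, contour_im]
  have h : -(z.im * s) ≤ |z.im| * |s| := by
    rw [← abs_mul]
    exact neg_le_abs _
  nlinarith

lemma norm_exp_mul_contour_le_exp {z : ℂ} (hz : z ∈ cone) (γ s : ℝ) :
    ‖exp (z * contour γ s)‖ ≤ Real.exp (γ * z.re) := by
  refine (norm_exp_mul_contour_le z γ s).trans (mul_le_of_le_one_right (Real.exp_pos _).le ?_)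
  rw [Real.exp_le_one_iff, neg_nonpos]
  exact mul_nonneg (sub_nonneg.2 (le_of_lt hz)) (abs_nonneg _)

lemma exists_norm_exp_mul_contour_le {z : ℂ} (hz : z ∈ cone) :
    ∃ C : ℝ, 0 < C ∧ ∀ γ s : ℝ,
      ‖exp (z * contour γ s)‖ ≤ Real.exp (γ * z.re) * (C * (1 + s ^ 2)⁻¹) := by
  obtain ⟨C, hC, h⟩ := exp_neg_mul_abs_le (sub_pos.2 hz)
  exact ⟨C, hC, fun γ s => (norm_exp_mul_contour_le z γ s).trans
    (mul_le_mul_of_nonneg_left (h s) (Real.exp_pos _).le)⟩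

lemma continuous_exp_smul_contour (z : ℂ) {γ : ℝ} {G : ℂ → E}
    (hc : Continuous fun s => G (contour γ s)) :
    Continuous fun s => exp (z * contour γ s) • G (contour γ s) :=
  (continuous_const.mul (continuous_contour γ)).cexp.smul hc

lemma integrable_exp_smul_contour {z : ℂ} (hz : z ∈ cone) {γ M : ℝ} {G : ℂ → E}
    (hc : Continuous fun s => G (contour γ s)) (hb : ∀ s, ‖G (contour γ s)‖ ≤ M) :
    Integrable fun s => contourWeight s • exp (z * contour γ s) • G (contour γ s) := by
  obtain ⟨C, hC, h⟩ := exists_norm_exp_mul_contour_le hz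
  refine integrable_contour (G := fun l => exp (z * l) • G l) (C := Real.exp (γ * z.re) * C * M)
    (continuous_exp_smul_contour z hc) fun s => ?_
  rw [norm_smul]
  refine (mul_le_mul (h γ s) (hb s) (norm_nonneg _) (by positivity)).trans_eq (by ring)

lemma contourIntegral_exp_eq_zero {z : ℂ} (hz : z ∈ cone) (γ : ℝ) :
    contourIntegral γ (fun l => exp (z * l)) = 0 := by
  have hz0 := ne_zero_of_mem_cone hz
  obtain ⟨C, hC, h⟩ := exists_norm_exp_mul_contour_le hz
  refine contourIntegral_deriv_eq_zero (G := fun l => z⁻¹ * exp (z * l))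
    (C := ‖z⁻¹‖ * (Real.exp (γ * z.re) * C)) (fun s => ?_) (fun s => ?_) ?_
  · have h1 := (((hasDerivAt_id (contour γ s)).const_mul z).cexp).const_mul z⁻¹
    rw [mul_one, mul_comm _ z, inv_mul_cancel_left₀ hz0] at h1
    exact h1
  · rw [norm_mul, mul_assoc]
    refine mul_le_mul_of_nonneg_left ((h γ s).trans_eq (by ring)) (norm_nonneg _)
  · have := integrable_exp_smul_contour (E := ℂ) hz (γ := γ) (G := fun _ => 1) (M := 1)
      continuous_const (by simp)
    simpa using this

lemma tendsto_contourIntegral_exp {γ C : ℝ} {G : ℂ → E}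
    (hc : Continuous fun s => G (contour γ s))
    (hb : ∀ s, ‖G (contour γ s)‖ ≤ C * (1 + s ^ 2)⁻¹) :
    Tendsto (fun z => contourIntegral γ fun l => exp (z * l) • G l) (𝓝[cone] 0)
      (𝓝 (contourIntegral γ G)) := by
  refine tendsto_integral_filter_of_dominated_convergence
    (fun s => 2 * (Real.exp |γ| * C) * (1 + s ^ 2)⁻¹) ?_ ?_ (integrable_bound _) ?_
  · exact Eventually.of_forall fun z =>
      aestronglyMeasurable_contour (G := fun l => exp (z * l) • G l)
        (continuous_exp_smul_contour z hc)
  · have h1 : ∀ᶠ z : ℂ in 𝓝[cone] 0, ‖z‖ < 1 := by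
      refine nhdsWithin_le_nhds ?_
      filter_upwards [Metric.ball_mem_nhds (0 : ℂ) one_pos] with z hz
      simpa using hz
    filter_upwards [h1, self_mem_nhdsWithin] with z hz1 hz
    refine Eventually.of_forall fun s => ?_
    rw [mul_assoc, mul_assoc]
    refine norm_contourWeight_smul_le ?_
    rw [norm_smul]
    refine mul_le_mul ((norm_exp_mul_contour_le_exp hz γ s).trans ?_) (hb s) (norm_nonneg _)
      (Real.exp_pos _).le
    rw [Real.exp_le_exp]
    have h2 : |z.re| ≤ 1 := (abs_re_le_norm z).trans hz1.le
    calc γ * z.re ≤ |γ| * |z.re| := by rw [← abs_mul]; exact le_abs_self _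
      _ ≤ |γ| := mul_le_of_le_one_right (abs_nonneg _) h2
  · refine Eventually.of_forall fun s => ?_
    refine Tendsto.const_smul ?_ _
    have h2 : Continuous fun z : ℂ => exp (z * contour γ s) • G (contour γ s) := by fun_prop
    exact (h2.tendsto' 0 _ (by simp)).mono_left nhdsWithin_le_nhds

/-- Differentiation of `z ↦ ∫ exp (z l) G(l) dl`. -/
lemma hasDerivAt_contourIntegral_exp {γ M : ℝ} {G : ℂ → E}
    (hc : Continuous fun s => G (contour γ s)) (hb : ∀ s, ‖G (contour γ s)‖ ≤ M)
    (hb' : ∀ s, ‖contour γ s • G (contour γ s)‖ ≤ M) {z : ℂ} (hz : z ∈ cone) :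
    HasDerivAt (fun z => contourIntegral γ fun l => exp (z * l) • G l)
      (contourIntegral γ fun l => exp (z * l) • l • G l) z := by
  have hκ : 0 < (z.re - |z.im|) / 2 := half_pos (sub_pos.2 hz)
  have hM : 0 ≤ M := (norm_nonneg _).trans (hb 0)
  have hcl : Continuous fun s => contour γ s • G (contour γ s) := (continuous_contour γ).smul hc
  obtain ⟨C, hC, hexp⟩ := exp_neg_mul_abs_le hκ
  have hcont : Continuous fun w : ℂ => w.re - |w.im| := by fun_prop
  have hcre : Continuous fun w : ℂ => γ * w.re := by fun_prop
  -- A neighbourhood of `z` on which the decay rate stays above half its value at `z` and the factor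
  -- `exp (γ re w)` grows by at most `e`, so that one majorant serves all `w`.
  have hs : {w : ℂ | (z.re - |z.im|) / 2 < w.re - |w.im| ∧ γ * w.re < γ * z.re + 1} ∈ 𝓝 z := by
    refine inter_mem (hcont.continuousAt.eventually (lt_mem_nhds ?_))
      (hcre.continuousAt.eventually (gt_mem_nhds ?_))
    · linarith
    · linarith
  exact (hasDerivAt_integral_of_dominated_loc_of_deriv_le (μ := volume)
    (F := fun w s => contourWeight s • exp (w * contour γ s) • G (contour γ s))
    (F' := fun w s => contourWeight s • exp (w * contour γ s) • contour γ s • G (contour γ s))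
    (bound := fun s => 2 * (Real.exp (γ * z.re + 1) * C * M) * (1 + s ^ 2)⁻¹) hs
    (Eventually.of_forall fun w =>
      aestronglyMeasurable_contour (G := fun l => exp (w * l) • G l)
        (continuous_exp_smul_contour w hc))
    (integrable_exp_smul_contour hz hc hb)
    (aestronglyMeasurable_contour (G := fun l => exp (z * l) • l • G l)
      (continuous_exp_smul_contour z (G := fun l => l • G l) hcl))
    (Eventually.of_forall fun s w hw => by
      rw [mul_assoc]
      refine norm_contourWeight_smul_le ?_
      rw [norm_smul]
      have h1 : ‖exp (w * contour γ s)‖ ≤ Real.exp (γ * z.re + 1) * (C * (1 + s ^ 2)⁻¹) := by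
        refine (norm_exp_mul_contour_le w γ s).trans
          (mul_le_mul (Real.exp_le_exp.2 hw.2.le) ((Real.exp_le_exp.2 ?_).trans (hexp s))
            (Real.exp_pos _).le (Real.exp_pos _).le)
        exact neg_le_neg (mul_le_mul_of_nonneg_right hw.1.le (abs_nonneg _))
      exact (mul_le_mul h1 (hb' s) (norm_nonneg _) (by positivity)).trans_eq (by ring))
    (integrable_bound _)
    (Eventually.of_forall fun s w hw => by
      have h1 := ((((hasDerivAt_id w).mul_const (contour γ s)).cexp).smul_const
        (G (contour γ s))).const_smul (contourWeight s)
      simp only [id, one_mul, mul_smul] at h1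
      exact h1)).2

variable [CompleteSpace E]

lemma contourIntegral_exp_smul_eq {a b M : ℝ} {G : ℂ → E}
    (hG : DifferentiableOn ℂ G (wedgeStrip a b)) (hb : ∀ l ∈ wedgeStrip a b, ‖G l‖ ≤ M)
    {z : ℂ} (hz : z ∈ cone) {x y : ℝ} (hx : x ∈ Set.Ioo a b) (hy : y ∈ Set.Ioo a b) :
    contourIntegral x (fun l => exp (z * l) • G l) =
      contourIntegral y fun l => exp (z * l) • G l := by
  obtain ⟨C, hC, h⟩ := exists_norm_exp_mul_contour_le hz
  have hd : DifferentiableOn ℂ (fun l : ℂ => exp (z * l)) (wedgeStrip a b) := by fun_prop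
  refine contourIntegral_eq_of_differentiableOn (C := Real.exp (b * z.re) * C * M)
    (hd.smul hG) (fun l hl => ?_) hx hy
  have hl' : l = contour (l.re + |l.im|) l.im := by
    apply Complex.ext <;> simp
  have h1 := h (l.re + |l.im|) l.im
  rw [← hl'] at h1
  have h2 : Real.exp ((l.re + |l.im|) * z.re) ≤ Real.exp (b * z.re) :=
    Real.exp_le_exp.2 (mul_le_mul_of_nonneg_right hl.2.le (re_pos_of_mem_cone hz).le)
  rw [Pi.smul_apply', norm_smul]
  calc ‖exp (z * l)‖ * ‖G l‖ ≤ (Real.exp (b * z.re) * (C * (1 + l.im ^ 2)⁻¹)) * M :=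
        mul_le_mul (h1.trans (mul_le_mul_of_nonneg_right h2 (by positivity))) (hb l hl)
          (norm_nonneg _) (by positivity)
    _ = _ := by ring

end ExpContour

/-! ### Normalization of the contour integral. -/

section Hankel

lemma contour_ne_zero {γ : ℝ} (hγ : 0 < γ) (s : ℝ) : contour γ s ≠ 0 := by
  have := le_norm_contour γ s
  rw [abs_of_pos hγ] at this
  exact norm_pos_iff.1 (by linarith)

/-- The pole `2` lies to the right of the contour, so the vertex can be moved to `-∞`, where `exp (x
re z)` tends to `0`. -/
lemma contourIntegral_exp_inv_sub_two {z : ℂ} (hz : z ∈ cone) :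
    contourIntegral 1 (fun l => exp (z * l) • (l - 2)⁻¹) = 0 := by
  have hlow : ∀ l : ℂ, l.re + |l.im| < 3 / 2 → 1 / 2 ≤ ‖l - 2‖ := by
    intro l hl
    have h1 := abs_re_le_norm (l - 2)
    simp only [sub_re, re_ofNat] at h1
    have h2 := neg_le_abs (l.re - 2)
    linarith [abs_nonneg l.im]
  have hinv : ∀ l : ℂ, l.re + |l.im| < 3 / 2 → ‖(l - 2)⁻¹‖ ≤ 2 := by
    intro l hl
    rw [norm_inv]
    have := inv_anti₀ (by norm_num) (hlow l hl)
    linarith [this]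
  obtain ⟨C, hC, h⟩ := exists_norm_exp_mul_contour_le hz
  have hbound : ∀ x < (1 : ℝ), ‖contourIntegral 1 (fun l => exp (z * l) • (l - 2)⁻¹)‖ ≤
      2 * (Real.exp (x * z.re) * C * 2) * (1⁻¹ * Real.pi) := by
    intro x hx
    rw [contourIntegral_exp_smul_eq (a := x - 1) (b := 3 / 2) (M := 2) (y := x) ?_
      (fun l hl => hinv l hl.2) hz ⟨by linarith, by norm_num⟩ ⟨by linarith, by linarith⟩]
    · refine norm_contourIntegral_le one_pos fun s => ?_
      rw [norm_smul]
      have h1 := hinv (contour x s) (by simp; linarith)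
      refine (mul_le_mul (h x s) h1 (norm_nonneg _) (by positivity)).trans_eq ?_
      ring
    · intro l hl
      have hne : l - 2 ≠ 0 := norm_pos_iff.1 (by linarith [hlow l hl.2])
      exact ((differentiableAt_id.sub_const (2 : ℂ)).inv hne).differentiableWithinAt
  have hlim : Tendsto (fun x : ℝ => 2 * (Real.exp (x * z.re) * C * 2) * (1⁻¹ * Real.pi)) atBot
      (𝓝 0) := by
    have h1 : Tendsto (fun x : ℝ => Real.exp (x * z.re)) atBot (𝓝 0) :=
      Real.tendsto_exp_atBot.comp (tendsto_id.atBot_mul_const (re_pos_of_mem_cone hz))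
    have h2 := (((h1.mul_const C).mul_const 2).const_mul 2).mul_const (1⁻¹ * Real.pi)
    simpa using h2
  refine norm_le_zero_iff.1 (ge_of_tendsto hlim ?_)
  filter_upwards [eventually_lt_atBot 1] with x hx using hbound x hx

/-- The normalization constant of the contour integral (its value is `2πi`). -/
def hankelConst : ℂ := contourIntegral 1 fun l => l⁻¹ - (l - 2)⁻¹

/-- On this contour `l - 1 = -|s| + i s`, hence `l (2 - l) = 1 - (l - 1)² = 1 + 2 i s |s|`;
subtracting `(l - 2)⁻¹` has produced quadratic decay. -/
lemma hankel_integrand (s : ℝ) :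
    (1 + s ^ 2)⁻¹ ≤
      (contourWeight s • ((contour 1 s)⁻¹ - (contour 1 s - 2)⁻¹)).im ∧
    ‖(contour 1 s)⁻¹ - (contour 1 s - 2)⁻¹‖ ≤ 4 * (1 + s ^ 2)⁻¹ := by
  have h0 : contour 1 s ≠ 0 := contour_ne_zero one_pos s
  have h2 : contour 1 s - 2 ≠ 0 := by
    intro h
    have h1 := congrArg re h
    have : |s| = -1 := by
      simp only [sub_re, contour_re, re_ofNat, zero_re] at h1
      linarith
    linarith [abs_nonneg s]
  have hprod : contour 1 s * (2 - contour 1 s) = 1 + 2 * (s * |s| : ℝ) * I := by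
    apply Complex.ext
    · simp
      nlinarith [sq_abs s]
    · simp
      ring
  have hkey : (contour 1 s)⁻¹ - (contour 1 s - 2)⁻¹ =
      2 * (1 + 2 * (s * |s| : ℝ) * I)⁻¹ := by
    have h2' : 2 - contour 1 s ≠ 0 := by
      rw [← neg_sub]; exact neg_ne_zero.2 h2
    rw [← hprod, ← neg_sub 2 (contour 1 s)]
    field_simp
    ring
  have hnsq : normSq (1 + 2 * (s * |s| : ℝ) * I) = 1 + 4 * s ^ 4 := by
    rw [normSq_apply]
    simp
    nlinarith [sq_abs s]
  have hinv : (1 + 2 * (s * |s| : ℝ) * I)⁻¹ =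
      (1 - 2 * (s * |s| : ℝ) * I) * ((1 + 4 * s ^ 4 : ℝ) : ℂ)⁻¹ := by
    have hconj : (starRingEnd ℂ) (1 + 2 * (s * |s| : ℝ) * I) = 1 - 2 * (s * |s| : ℝ) * I := by
      apply Complex.ext <;> simp
    rw [inv_def, hnsq, hconj, ofReal_inv]
  constructor
  · have hw : ∀ (x y r : ℝ), ((I + x) * (2 * ((1 - 2 * (y : ℂ) * I) * (r : ℂ)))).im =
        2 * (1 - 2 * x * y) * r := by
      intro x y r
      simp [mul_im]
      ring
    have him : (contourWeight s • ((contour 1 s)⁻¹ - (contour 1 s - 2)⁻¹)).im =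
        2 * (1 + 2 * s ^ 2) * (1 + 4 * s ^ 4)⁻¹ := by
      rw [hkey, hinv, smul_eq_mul, ← ofReal_inv, contourWeight]
      split_ifs with h
      · have := hw (-1) (s * |s|) (1 + 4 * s ^ 4)⁻¹
        rw [ofReal_neg, ofReal_one, ← sub_eq_add_neg] at this
        rw [this, abs_of_pos h]
        ring
      · have := hw 1 (s * |s|) (1 + 4 * s ^ 4)⁻¹
        rw [ofReal_one] at this
        rw [this, abs_of_nonpos (not_lt.1 h)]
        ring
    rw [him, inv_eq_one_div, ← div_eq_mul_inv, div_le_div_iff₀ (by positivity) (by positivity)]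
    nlinarith [sq_nonneg s, sq_nonneg (s ^ 2)]
  · rw [hkey, norm_mul, norm_inv]
    have h1 : (1 + s ^ 2) / 2 ≤ ‖(1 + 2 * (s * |s| : ℝ) * I : ℂ)‖ := by
      refine abs_le_of_sq_le_sq' ?_ (norm_nonneg _) |>.2
      rw [← normSq_eq_norm_sq, hnsq]
      nlinarith [sq_nonneg (s ^ 2 - 1), sq_nonneg (s ^ 2)]
    have h3 := inv_anti₀ (by positivity) h1
    rw [inv_div] at h3
    simp only [norm_ofNat]
    rw [div_eq_mul_inv] at h3
    linarith

lemma continuous_hankel_integrand :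
    Continuous fun s => (contour 1 s)⁻¹ - (contour 1 s - 2)⁻¹ := by
  have hc := continuous_contour 1
  have hc2 : Continuous fun s => contour 1 s - 2 := hc.sub continuous_const
  refine (hc.inv₀ (contour_ne_zero one_pos)).sub (hc2.inv₀ fun s h => ?_)
  have h1 := congrArg re h
  simp only [sub_re, contour_re, re_ofNat, zero_re] at h1
  linarith [abs_nonneg s]

/-- Only nonvanishing is needed to normalize, so a positive lower bound on the imaginary part
replaces a residue computation. -/
lemma hankelConst_ne_zero : hankelConst ≠ 0 := by
  have hGint := integrable_contour (G := fun l => l⁻¹ - (l - 2)⁻¹)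
    continuous_hankel_integrand fun s => (hankel_integrand s).2
  have h1 : hankelConst.im = ∫ s, (contourWeight s •
      ((contour 1 s)⁻¹ - (contour 1 s - 2)⁻¹)).im :=
    (imCLM.integral_comp_comm hGint).symm
  have h2 : Real.pi ≤ hankelConst.im := by
    rw [h1, ← integral_univ_inv_one_add_sq]
    exact integral_mono integrable_inv_one_add_sq (imCLM.integrable_comp hGint)
      fun s => (hankel_integrand s).1
  intro h
  rw [h] at h2
  exact absurd h2 (not_le.2 (by simpa using Real.pi_pos))

/-- The `z`-derivative is the integral of `exp (z l)`, which is zero, so the value does not depend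
on `z`. To find it, subtract the vanishing integral with `(l - 2)⁻¹`, which makes the integrand
absolutely convergent at `z = 0`, and let `z → 0`. -/
lemma contourIntegral_exp_inv {z : ℂ} (hz : z ∈ cone) {γ : ℝ} (hγ : 0 < γ) :
    contourIntegral γ (fun l => exp (z * l) • l⁻¹) = hankelConst := by
  have hcinv : ∀ x : ℝ, 0 < x → Continuous fun s => (contour x s)⁻¹ := fun x hx =>
    (continuous_contour x).inv₀ (contour_ne_zero hx)
  have hbinv : ∀ x : ℝ, 0 < x → ∀ s, ‖(contour x s)⁻¹‖ ≤ 2 / x := fun x hx s => by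
    have := le_norm_contour x s
    rw [abs_of_pos hx] at this
    rw [norm_inv, ← inv_div]
    exact inv_anti₀ (by positivity) this
  have hvertex : contourIntegral γ (fun l => exp (z * l) • l⁻¹) =
      contourIntegral 1 fun l => exp (z * l) • l⁻¹ := by
    have hm : 0 < min γ 1 := lt_min hγ one_pos
    have hmem : ∀ l ∈ wedgeStrip (min γ 1 / 2) (max γ 1 + 1), min γ 1 / 2 / 2 ≤ ‖l‖ := by
      intro l hl
      have h1 := le_norm_contour (l.re + |l.im|) l.im
      have hl' : l = contour (l.re + |l.im|) l.im := by
        apply Complex.ext <;> simp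
      rw [← hl', abs_of_pos ((half_pos hm).trans hl.1)] at h1
      linarith [hl.1]
    refine contourIntegral_exp_smul_eq (a := min γ 1 / 2) (b := max γ 1 + 1)
      (M := (min γ 1 / 2 / 2)⁻¹) (fun l hl => ?_) (fun l hl => ?_) hz ⟨?_, ?_⟩ ⟨?_, ?_⟩
    · exact (differentiableAt_inv (norm_pos_iff.1
        ((by positivity : 0 < min γ 1 / 2 / 2).trans_le (hmem l hl)))).differentiableWithinAt
    · rw [norm_inv]
      exact inv_anti₀ (by positivity) (hmem l hl)
    · linarith [min_le_left γ 1]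
    · linarith [le_max_left γ 1]
    · linarith [min_le_right γ 1]
    · linarith [le_max_right γ 1]
  rw [hvertex]
  have hderiv : ∀ w ∈ cone, HasDerivAt
      (fun z => contourIntegral 1 fun l => exp (z * l) • l⁻¹) 0 w := by
    intro w hw
    have h1 := hasDerivAt_contourIntegral_exp (M := 2) (G := fun l : ℂ => l⁻¹)
      (hcinv 1 one_pos) (by simpa using hbinv 1 one_pos)
      (fun s => by simp [contour_ne_zero one_pos s]) hw
    have h2 : contourIntegral 1 (fun l => exp (w * l) • l • l⁻¹) = 0 := by
      rw [← contourIntegral_exp_eq_zero hw 1]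
      refine integral_congr_ae (Eventually.of_forall fun s => ?_)
      simp [contour_ne_zero one_pos s]
    rwa [h2] at h1
  have hconst : ∀ w ∈ cone, contourIntegral 1 (fun l => exp (w * l) • l⁻¹) =
      contourIntegral 1 fun l => exp (z * l) • l⁻¹ := fun w hw =>
    isOpen_cone.is_const_of_deriv_eq_zero
      (f := fun z => contourIntegral 1 fun l => exp (z * l) • l⁻¹) convex_cone.isPreconnected
      (fun w hw => (hderiv w hw).differentiableAt.differentiableWithinAt)
      (fun w hw => (hderiv w hw).deriv) hw hz
  have hlim := tendsto_contourIntegral_exp (G := fun l => l⁻¹ - (l - 2)⁻¹)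
    continuous_hankel_integrand fun s => (hankel_integrand s).2
  refine tendsto_nhds_unique ((tendsto_const_nhds).congr' ?_) hlim
  filter_upwards [self_mem_nhdsWithin] with w hw
  rw [← hconst w hw, ← sub_zero (contourIntegral 1 _), ← contourIntegral_exp_inv_sub_two hw]
  have hc2 : Continuous fun s => (contour 1 s - 2)⁻¹ := by
    refine ((hcinv 1 one_pos).sub continuous_hankel_integrand).congr fun s => ?_
    simp
  have hb2 : ∀ s, ‖(contour 1 s - 2)⁻¹‖ ≤ 1 := by
    intro s
    have h1 := abs_re_le_norm (contour 1 s - 2)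
    simp only [sub_re, contour_re, re_ofNat] at h1
    have h2 := neg_le_abs (1 - |s| - 2)
    rw [norm_inv]
    exact inv_le_one_of_one_le₀ (by linarith [abs_nonneg s])
  rw [contourIntegral, contourIntegral, ← integral_sub
    (integrable_exp_smul_contour hw (hcinv 1 one_pos) (hbinv 1 one_pos))
    (integrable_exp_smul_contour hw (G := fun l => (l - 2)⁻¹) hc2 hb2)]
  refine integral_congr_ae (Eventually.of_forall fun s => ?_)
  simp only [smul_sub]

end Hankel

end AbstractDecay

end

open Filter Topology

noncomputable section

namespace AbstractDecay

open MeasureTheory Complex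

/-! ### Holomorphic semigroups from sectorial resolvents -/

/-- The open region to the right of the wedge contour with vertex `γ`. -/
def wedge (γ : ℝ) : Set ℂ := {z | γ < z.re + |z.im|}

lemma isOpen_wedge (γ : ℝ) : IsOpen (wedge γ) :=
  isOpen_lt continuous_const (by fun_prop)

lemma contour_mem_wedge {γ₀ γ : ℝ} (h : γ₀ < γ) (s : ℝ) : contour γ s ∈ wedge γ₀ := by
  simpa [wedge] using h

lemma exists_eq_contour {γ : ℝ} {l : ℂ} (hl : l ∈ wedge γ) :
    ∃ x : ℝ, γ < x ∧ l = contour x l.im :=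
  ⟨l.re + |l.im|, hl, by apply Complex.ext <;> simp⟩

lemma le_norm_of_mem_wedge {γ : ℝ} (hγ : 0 < γ) {l : ℂ} (hl : l ∈ wedge γ) : γ / 2 ≤ ‖l‖ := by
  obtain ⟨x, hx, h⟩ := exists_eq_contour hl
  have := le_norm_contour x l.im
  rw [← h, abs_of_pos (hγ.trans hx)] at this
  linarith

lemma ne_zero_of_mem_wedge {γ : ℝ} (hγ : 0 < γ) {l : ℂ} (hl : l ∈ wedge γ) : l ≠ 0 :=
  norm_pos_iff.1 ((half_pos hγ).trans_le (le_norm_of_mem_wedge hγ hl))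

lemma ofReal_mem_wedge {γ m : ℝ} (h : γ < m) : (m : ℂ) ∈ wedge γ := by
  simpa [wedge] using h

section Sectorial

variable {X : Type*} [NormedAddCommGroup X] [NormedSpace ℂ X]

/-- A family of operators on a wedge that satisfies the resolvent identity and the sectorial
resolvent bound. -/
structure IsSectorialResolvent (R : ℂ → X →L[ℂ] X) (γ₀ M : ℝ) : Prop where
  pos : 0 < γ₀
  identity : ∀ l ∈ wedge γ₀, ∀ m ∈ wedge γ₀, R l - R m = (m - l) • (R l * R m)
  bound : ∀ l ∈ wedge γ₀, ‖l‖ * ‖R l‖ ≤ M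

/-- The holomorphic semigroup with resolvent `R`. -/
def sectorialSemigroup (R : ℂ → X →L[ℂ] X) (γ : ℝ) (z : ℂ) : X →L[ℂ] X :=
  hankelConst⁻¹ • contourIntegral γ fun l => exp (z * l) • R l

/-- The derivative of `sectorialSemigroup`. -/
def sectorialSemigroupDeriv (R : ℂ → X →L[ℂ] X) (γ : ℝ) (z : ℂ) : X →L[ℂ] X :=
  hankelConst⁻¹ • contourIntegral γ fun l => exp (z * l) • l • R l

namespace IsSectorialResolvent

variable {R : ℂ → X →L[ℂ] X} {γ₀ M : ℝ}

lemma bound_nonneg (hR : IsSectorialResolvent R γ₀ M) : 0 ≤ M :=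
  le_trans (by positivity) (hR.bound _ (contour_mem_wedge (lt_add_one γ₀) 0))

lemma norm_le (hR : IsSectorialResolvent R γ₀ M) {l : ℂ} (hl : l ∈ wedge γ₀) :
    ‖R l‖ ≤ M / ‖l‖ := by
  rw [le_div_iff₀ (norm_pos_iff.2 (ne_zero_of_mem_wedge hR.pos hl)), mul_comm]
  exact hR.bound l hl

lemma norm_le_const (hR : IsSectorialResolvent R γ₀ M) {l : ℂ} (hl : l ∈ wedge γ₀) :
    ‖R l‖ ≤ M / (γ₀ / 2) :=
  (hR.norm_le hl).trans (div_le_div_of_nonneg_left hR.bound_nonneg (half_pos hR.pos)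
    (le_norm_of_mem_wedge hR.pos hl))

lemma commute (hR : IsSectorialResolvent R γ₀ M) {l m : ℂ} (hl : l ∈ wedge γ₀)
    (hm : m ∈ wedge γ₀) : R l * R m = R m * R l := by
  rcases eq_or_ne l m with rfl | h
  · rfl
  · have h1 := hR.identity l hl m hm
    have h2 := hR.identity m hm l hl
    rw [← neg_sub, h1, ← neg_smul, neg_sub] at h2
    exact smul_right_injective _ (sub_ne_zero.2 h) h2

lemma continuousOn (hR : IsSectorialResolvent R γ₀ M) : ContinuousOn R (wedge γ₀) := by
  have h : LipschitzOnWith (Real.toNNReal (M / (γ₀ / 2) * (M / (γ₀ / 2)))) R (wedge γ₀) := by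
    refine LipschitzOnWith.of_dist_le_mul fun l hl m hm => ?_
    have h0 : 0 ≤ M / (γ₀ / 2) := (norm_nonneg _).trans (hR.norm_le_const hl)
    rw [Real.coe_toNNReal _ (by positivity), dist_eq_norm, dist_eq_norm, hR.identity l hl m hm,
      norm_smul, mul_comm, norm_sub_rev]
    refine mul_le_mul_of_nonneg_right ((norm_mul_le _ _).trans ?_) (norm_nonneg _)
    exact mul_le_mul (hR.norm_le_const hl) (hR.norm_le_const hm) (norm_nonneg _) h0
  exact h.continuousOn

/-- By the resolvent identity the difference quotient at `l` equals `-R m * R l`, so continuity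
suffices. -/
lemma differentiableOn (hR : IsSectorialResolvent R γ₀ M) :
    DifferentiableOn ℂ R (wedge γ₀) := by
  intro l hl
  have hn : wedge γ₀ ∈ 𝓝 l := (isOpen_wedge γ₀).mem_nhds hl
  have hc : Tendsto R (𝓝[≠] l) (𝓝 (R l)) :=
    (hR.continuousOn.continuousAt hn).mono_left nhdsWithin_le_nhds
  have h : HasDerivAt R (-(R l * R l)) l := by
    rw [hasDerivAt_iff_tendsto_slope]
    refine ((hc.mul_const (R l)).neg).congr' ?_
    filter_upwards [self_mem_nhdsWithin, nhdsWithin_le_nhds hn] with m hm hm'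
    rw [slope_def_module, hR.identity m hm' l hl, smul_smul, ← neg_sub m l, mul_neg,
      inv_mul_cancel₀ (sub_ne_zero.2 hm), neg_smul, one_smul]
  exact h.differentiableAt.differentiableWithinAt

lemma continuous_comp_contour (hR : IsSectorialResolvent R γ₀ M) {γ : ℝ} (hγ : γ₀ < γ) :
    Continuous fun s => R (contour γ s) :=
  hR.continuousOn.comp_continuous (continuous_contour γ) (contour_mem_wedge hγ)

lemma integrable (hR : IsSectorialResolvent R γ₀ M) {γ : ℝ} (hγ : γ₀ < γ) {z : ℂ}
    (hz : z ∈ cone) : Integrable fun s =>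
      contourWeight s • exp (z * contour γ s) • R (contour γ s) :=
  integrable_exp_smul_contour hz (hR.continuous_comp_contour hγ)
    fun s => hR.norm_le_const (contour_mem_wedge hγ s)

lemma integrable_smul (hR : IsSectorialResolvent R γ₀ M) {γ : ℝ} (hγ : γ₀ < γ) {z : ℂ}
    (hz : z ∈ cone) : Integrable fun s =>
      contourWeight s • exp (z * contour γ s) • contour γ s • R (contour γ s) :=
  integrable_exp_smul_contour hz (G := fun l => l • R l) (M := M)
    ((continuous_contour γ).smul (hR.continuous_comp_contour hγ))
    fun s => by
      rw [norm_smul]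
      exact hR.bound _ (contour_mem_wedge hγ s)

/-- The factor `l⁻¹` gives absolute convergence without the exponential. The scaling in `γ⁻¹ s`
makes the integral of the bound of order `γ⁻¹`, which vanishes as the vertex moves to `+∞`. -/
lemma norm_inv_smul_le (hR : IsSectorialResolvent R γ₀ M) {γ : ℝ} (hγ : γ₀ < γ) (s : ℝ) :
    ‖(contour γ s)⁻¹ • R (contour γ s)‖ ≤ 3 * M / γ ^ 2 * (1 + (γ⁻¹ * s) ^ 2)⁻¹ := by
  have hγ0 := hR.pos.trans hγ
  have h1 := sq_add_sq_le_contour γ s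
  have h2 : ‖(contour γ s)⁻¹ • R (contour γ s)‖ ≤ M / ‖contour γ s‖ ^ 2 := by
    rw [norm_smul, norm_inv, sq, ← div_div, inv_mul_eq_div]
    exact div_le_div_of_nonneg_right (hR.norm_le (contour_mem_wedge hγ s)) (norm_nonneg _)
  refine h2.trans ((div_le_div_of_nonneg_left hR.bound_nonneg (by positivity)
    ((div_le_iff₀' three_pos).2 h1)).trans_eq ?_)
  field_simp

lemma hasDerivAt_sectorialSemigroup (hR : IsSectorialResolvent R γ₀ M) {γ : ℝ} (hγ : γ₀ < γ)
    {z : ℂ} (hz : z ∈ cone) :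
    HasDerivAt (sectorialSemigroup R γ) (sectorialSemigroupDeriv R γ z) z := by
  have h := hasDerivAt_contourIntegral_exp (M := max (M / (γ₀ / 2)) M)
    (hR.continuous_comp_contour hγ) (fun s => ?_) (fun s => ?_) hz
  · exact h.const_smul hankelConst⁻¹
  · exact (hR.norm_le_const (contour_mem_wedge hγ s)).trans (le_max_left _ _)
  · rw [norm_smul]
    exact (hR.bound _ (contour_mem_wedge hγ s)).trans (le_max_right _ _)

variable [CompleteSpace X]

lemma sectorialSemigroup_eq (hR : IsSectorialResolvent R γ₀ M) {x y : ℝ} (hx : γ₀ < x)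
    (hy : γ₀ < y) {z : ℂ} (hz : z ∈ cone) :
    sectorialSemigroup R x z = sectorialSemigroup R y z := by
  have hsub : wedgeStrip γ₀ (max x y + 1) ⊆ wedge γ₀ := fun l hl => hl.1
  rw [sectorialSemigroup, sectorialSemigroup, contourIntegral_exp_smul_eq
    (hR.differentiableOn.mono hsub) (fun l hl => hR.norm_le_const (hsub hl)) hz
    ⟨hx, (le_max_left x y).trans_lt (lt_add_one _)⟩
    ⟨hy, (le_max_right x y).trans_lt (lt_add_one _)⟩]

lemma contourIntegral_mul_left (B : X →L[ℂ] X) {γ : ℝ} {G : ℂ → X →L[ℂ] X}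
    (hG : Integrable fun s => contourWeight s • G (contour γ s)) :
    B * contourIntegral γ G = contourIntegral γ fun l => B * G l := by
  have h := (ContinuousLinearMap.mul ℂ (X →L[ℂ] X) B).integral_comp_comm hG
  simp only [ContinuousLinearMap.mul_apply', mul_smul_comm] at h
  exact h.symm

lemma contourIntegral_mul_right (B : X →L[ℂ] X) {γ : ℝ} {G : ℂ → X →L[ℂ] X}
    (hG : Integrable fun s => contourWeight s • G (contour γ s)) :
    contourIntegral γ G * B = contourIntegral γ fun l => G l * B := by
  have h := ((ContinuousLinearMap.mul ℂ (X →L[ℂ] X)).flip B).integral_comp_comm hG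
  simp only [ContinuousLinearMap.flip_apply, ContinuousLinearMap.mul_apply', smul_mul_assoc] at h
  exact h.symm

lemma commute_sectorialSemigroup (hR : IsSectorialResolvent R γ₀ M) {γ : ℝ} (hγ : γ₀ < γ)
    {z : ℂ} (hz : z ∈ cone) {m : ℂ} (hm : m ∈ wedge γ₀) :
    R m * sectorialSemigroup R γ z = sectorialSemigroup R γ z * R m := by
  rw [sectorialSemigroup, mul_smul_comm, smul_mul_assoc,
    contourIntegral_mul_left _ (G := fun l => exp (z * l) • R l) (hR.integrable hγ hz),
    contourIntegral_mul_right _ (G := fun l => exp (z * l) • R l) (hR.integrable hγ hz)]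
  congr 1
  refine integral_congr_ae (Eventually.of_forall fun s => ?_)
  simp only [mul_smul_comm, smul_mul_assoc, hR.commute hm (contour_mem_wedge hγ s)]

lemma contourIntegral_exp_smul_const {z : ℂ} (hz : z ∈ cone) (γ : ℝ) (B : X →L[ℂ] X) :
    contourIntegral γ (fun l => exp (z * l) • B) = 0 := by
  have h := integral_smul_const (μ := volume) (fun s => contourWeight s • exp (z * contour γ s)) B
  have h0 := contourIntegral_exp_eq_zero hz γ
  rw [contourIntegral] at h0
  rw [h0, zero_smul] at h
  rw [← h]
  simp only [contourIntegral, smul_assoc]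

/-- The semigroup maps into the domain of the generator, and its derivative is the generator
applied to it. -/
lemma resolvent_mul_sub (hR : IsSectorialResolvent R γ₀ M) {γ : ℝ} (hγ : γ₀ < γ)
    {z : ℂ} (hz : z ∈ cone) {m : ℂ} (hm : m ∈ wedge γ₀) :
    R m * (m • sectorialSemigroup R γ z - sectorialSemigroupDeriv R γ z) =
      sectorialSemigroup R γ z := by
  have hB : Integrable fun s => contourWeight s • exp (z * contour γ s) • R m :=
    integrable_exp_smul_contour hz (G := fun _ => R m) continuous_const fun _ => le_rfl
  rw [sectorialSemigroup, sectorialSemigroupDeriv, smul_comm m, ← smul_sub, mul_smul_comm]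
  congr 1
  -- The integral of `exp (z l) • R m` is zero, so it may be subtracted on the right; then `(m - l)
  -- R m R l = R l - R m` matches the integrands.
  rw [mul_sub, mul_smul_comm,
    contourIntegral_mul_left _ (G := fun l => exp (z * l) • R l) (hR.integrable hγ hz),
    contourIntegral_mul_left _ (G := fun l => exp (z * l) • l • R l) (hR.integrable_smul hγ hz),
    ← sub_zero (contourIntegral γ fun l => exp (z * l) • R l),
    ← contourIntegral_exp_smul_const hz γ (R m)]
  have hi1 := ((ContinuousLinearMap.mul ℂ (X →L[ℂ] X) (R m)).integrable_comp
    (hR.integrable hγ hz)).smul m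
  have hi2 := (ContinuousLinearMap.mul ℂ (X →L[ℂ] X) (R m)).integrable_comp
    (hR.integrable_smul hγ hz)
  simp only [ContinuousLinearMap.mul_apply', mul_smul_comm] at hi1 hi2
  replace hi1 : Integrable fun s =>
    m • contourWeight s • exp (z * contour γ s) • (R m * R (contour γ s)) := hi1
  simp only [contourIntegral, mul_smul_comm]
  rw [← integral_sub (hR.integrable hγ hz) hB, ← integral_smul, ← integral_sub hi1 hi2]
  refine integral_congr_ae (Eventually.of_forall fun s => ?_)
  have h1 := hR.identity _ (contour_mem_wedge hγ s) m hm
  rw [hR.commute (contour_mem_wedge hγ s) hm] at h1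
  simp only
  rw [← smul_sub, ← smul_sub, h1, sub_smul, smul_comm m (contourWeight s),
    smul_comm m (exp _), ← smul_sub, ← smul_sub]

/-- The semigroup is bounded near the origin in every smaller sector. -/
lemma exists_norm_le (hR : IsSectorialResolvent R γ₀ M) {γ : ℝ} (hγ : γ₀ < γ) {κ : ℝ}
    (hκ : 0 < κ) : ∃ C : ℝ, ∀ z : ℂ, z ≠ 0 → κ * ‖z‖ ≤ z.re - |z.im| → ‖z‖ < γ₀⁻¹ →
      ‖sectorialSemigroup R γ z‖ ≤ C := by
  obtain ⟨C, hC, hexp⟩ := exp_neg_mul_abs_le hκ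
  refine ⟨‖hankelConst⁻¹‖ * (2 * (Real.exp 1 * C * (2 * M)) * Real.pi), fun z hz0 hz hzγ => ?_⟩
  have hpos : 0 < ‖z‖ := norm_pos_iff.2 hz0
  have hzc : z ∈ cone := sub_pos.1 ((mul_pos hκ hpos).trans_le hz)
  have hγz : γ₀ < ‖z‖⁻¹ := by
    rw [lt_inv_comm₀ hR.pos hpos]
    exact hzγ
  -- The vertex is moved to `‖z‖⁻¹`, admissible since `‖z‖ < γ₀⁻¹`. There the resolvent is of size
  -- `‖z‖`, the exponential is at most `e · exp (-κ ‖z‖ |s|)`, and integrating over `s` restores a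
  -- factor `‖z‖⁻¹`.
  rw [hR.sectorialSemigroup_eq hγ hγz hzc, sectorialSemigroup, norm_smul]
  refine mul_le_mul_of_nonneg_left ?_ (norm_nonneg _)
  refine (norm_contourIntegral_le (C := Real.exp 1 * C * (2 * M) * ‖z‖) hpos fun s => ?_).trans_eq
    (by field_simp)
  have h1 : ‖exp (z * contour ‖z‖⁻¹ s)‖ ≤ Real.exp 1 * (C * (1 + (‖z‖ * s) ^ 2)⁻¹) := by
    refine (norm_exp_mul_contour_le z _ s).trans (mul_le_mul (Real.exp_le_exp.2 ?_)
      (le_trans (Real.exp_le_exp.2 ?_) (hexp (‖z‖ * s))) (Real.exp_pos _).le (Real.exp_pos _).le)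
    · rw [inv_mul_le_iff₀ hpos, mul_one]
      exact re_le_norm z
    · rw [abs_mul, abs_of_pos hpos, ← mul_assoc]
      exact neg_le_neg (mul_le_mul_of_nonneg_right hz (abs_nonneg s))
  have h2 : ‖R (contour ‖z‖⁻¹ s)‖ ≤ 2 * M * ‖z‖ := by
    refine (hR.norm_le (contour_mem_wedge hγz s)).trans ?_
    have h3 := le_norm_contour ‖z‖⁻¹ s
    rw [abs_of_pos (inv_pos.2 hpos)] at h3
    refine (div_le_div_of_nonneg_left hR.bound_nonneg (by positivity) h3).trans_eq ?_
    field_simp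
  rw [norm_smul]
  exact (mul_le_mul h1 h2 (norm_nonneg _) (by positivity)).trans_eq (by ring)

/-- The integrand is holomorphic to the right of the contour, so the vertex may be sent to `+∞`,
where the integral is of order `x⁻¹`. -/
lemma contourIntegral_inv_smul_eq_zero (hR : IsSectorialResolvent R γ₀ M) {γ : ℝ} (hγ : γ₀ < γ) :
    contourIntegral γ (fun l => l⁻¹ • R l) = 0 := by
  have hM := hR.bound_nonneg
  have hbound : ∀ x : ℝ, γ < x →
      ‖contourIntegral γ (fun l => l⁻¹ • R l)‖ ≤ 6 * M * Real.pi * x⁻¹ := by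
    intro x hx
    have hx0 := hR.pos.trans (hγ.trans hx)
    have heq : contourIntegral γ (fun l => l⁻¹ • R l) = contourIntegral x fun l => l⁻¹ • R l := by
      have hd : DifferentiableOn ℂ (fun l : ℂ => l⁻¹) (wedge γ₀) := fun l hl =>
        (differentiableAt_inv (ne_zero_of_mem_wedge hR.pos hl)).differentiableWithinAt
      have hsub : wedgeStrip γ₀ (x + 1) ⊆ wedge γ₀ := fun l hl => hl.1
      refine contourIntegral_eq_of_differentiableOn (a := γ₀) (b := x + 1)
        (C := 3 * M * (1 + (γ₀ ^ 2)⁻¹)) ((hd.smul hR.differentiableOn).mono hsub)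
        (fun l hl => ?_) ⟨hγ, by linarith⟩ ⟨hγ.trans hx, by linarith⟩
      obtain ⟨y, hy, hl'⟩ := exists_eq_contour (hsub hl)
      have h1 := hR.norm_inv_smul_le hy l.im
      have hy0 := hR.pos.trans hy
      rw [← hl'] at h1
      refine h1.trans ?_
      have h2 : 3 * M / y ^ 2 * (1 + (y⁻¹ * l.im) ^ 2)⁻¹ = 3 * M * (y ^ 2 + l.im ^ 2)⁻¹ := by
        field_simp
      rw [h2, mul_assoc (3 * M)]
      refine mul_le_mul_of_nonneg_left ?_ (by positivity : 0 ≤ 3 * M)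
      rw [← div_eq_mul_inv, inv_eq_one_div, div_le_div_iff₀ (by positivity) (by positivity)]
      have hγ0 := hR.pos
      have h3 : 1 ≤ (γ₀ ^ 2)⁻¹ * y ^ 2 := by
        rw [inv_mul_eq_div, one_le_div (by positivity)]
        exact pow_le_pow_left₀ hγ0.le hy.le 2
      have h4 : 0 ≤ (γ₀ ^ 2)⁻¹ * l.im ^ 2 := by positivity
      nlinarith [sq_nonneg y]
    rw [heq]
    refine (norm_contourIntegral_le (inv_pos.2 hx0)
      (hR.norm_inv_smul_le (hγ.trans hx))).trans_eq ?_
    field_simp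
    ring
  have hlim : Tendsto (fun x : ℝ => 6 * M * Real.pi * x⁻¹) atTop (𝓝 0) := by
    simpa using (tendsto_inv_atTop_zero (𝕜 := ℝ)).const_mul (6 * M * Real.pi)
  refine norm_le_zero_iff.1 (ge_of_tendsto hlim ?_)
  filter_upwards [eventually_gt_atTop γ] with x hx using hbound x hx

/-- Split `R l R m = l⁻¹ R m + l⁻¹ R l (m R m - 1)`. The first term integrates exactly to `R m` by
the normalization; the second tends, as `z → 0`, to a multiple of the vanishing integral of `l⁻¹ R
l`. -/
lemma tendsto_sectorialSemigroup_mul (hR : IsSectorialResolvent R γ₀ M) {γ : ℝ} (hγ : γ₀ < γ)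
    {m : ℂ} (hm : m ∈ wedge γ₀) :
    Tendsto (fun z => sectorialSemigroup R γ z * R m) (𝓝[cone] 0) (𝓝 (R m)) := by
  have hγ0 := hR.pos.trans hγ
  have hcinv : Continuous fun s => (contour γ s)⁻¹ :=
    (continuous_contour γ).inv₀ (contour_ne_zero hγ0)
  have hcR : Continuous fun s => (contour γ s)⁻¹ • R (contour γ s) :=
    hcinv.smul (hR.continuous_comp_contour hγ)
  have hM := hR.bound_nonneg
  have hbR : ∀ s, ‖(contour γ s)⁻¹ • R (contour γ s)‖ ≤
      3 * M * (1 + (γ ^ 2)⁻¹) * (1 + s ^ 2)⁻¹ := by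
    intro s
    refine (hR.norm_inv_smul_le hγ s).trans ?_
    have h2 : 3 * M / γ ^ 2 * (1 + (γ⁻¹ * s) ^ 2)⁻¹ = 3 * M * (γ ^ 2 + s ^ 2)⁻¹ := by
      field_simp
    rw [h2, mul_assoc (3 * M)]
    refine mul_le_mul_of_nonneg_left ?_ (by positivity : 0 ≤ 3 * M)
    rw [← div_eq_mul_inv, inv_eq_one_div, div_le_div_iff₀ (by positivity) (by positivity)]
    have h3 : (γ ^ 2)⁻¹ * γ ^ 2 = 1 := inv_mul_cancel₀ (pow_ne_zero 2 hγ0.ne')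
    have h4 : 0 ≤ (γ ^ 2)⁻¹ * s ^ 2 := by positivity
    nlinarith [sq_nonneg γ]
  have hlim := tendsto_contourIntegral_exp (G := fun l => l⁻¹ • R l) hcR hbR
  rw [hR.contourIntegral_inv_smul_eq_zero hγ] at hlim
  have hlim2 : Tendsto (fun z => R m + hankelConst⁻¹ •
      ((contourIntegral γ fun l => exp (z * l) • l⁻¹ • R l) * (m • R m - 1))) (𝓝[cone] 0)
      (𝓝 (R m)) := by
    have := ((hlim.mul_const (m • R m - 1)).const_smul hankelConst⁻¹).const_add (R m)
    simpa using this
  refine hlim2.congr' ?_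
  filter_upwards [self_mem_nhdsWithin] with z hz
  have hbR' : ∀ s, ‖(contour γ s)⁻¹ • R (contour γ s)‖ ≤ 3 * M * (1 + (γ ^ 2)⁻¹) := fun s => by
    refine (hbR s).trans (mul_le_of_le_one_right (by positivity) (inv_le_one_of_one_le₀ ?_))
    nlinarith [sq_nonneg s]
  have hi1 := integrable_exp_smul_contour (G := fun l => l⁻¹ • R l) hz hcR hbR'
  have hi2 : Integrable fun s => contourWeight s • exp (z * contour γ s) • (contour γ s)⁻¹ :=
    integrable_exp_smul_contour (G := fun l => l⁻¹) (M := (γ / 2)⁻¹) hz hcinv fun s => by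
      rw [norm_inv]
      have := le_norm_contour γ s
      rw [abs_of_pos hγ0] at this
      exact inv_anti₀ (by positivity) this
  have h1 : R m = hankelConst⁻¹ • (contourIntegral γ (fun l => exp (z * l) • l⁻¹) • R m) := by
    rw [contourIntegral_exp_inv hz hγ0, smul_smul, inv_mul_cancel₀ hankelConst_ne_zero, one_smul]
  rw [sectorialSemigroup, smul_mul_assoc]
  nth_rewrite 1 [h1]
  rw [← smul_add]
  congr 1
  rw [contourIntegral_mul_right _ (G := fun l => exp (z * l) • R l) (hR.integrable hγ hz),
    contourIntegral_mul_right _ (G := fun l => exp (z * l) • l⁻¹ • R l) hi1]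
  have hi3 := ((ContinuousLinearMap.mul ℂ (X →L[ℂ] X)).flip (m • R m - 1)).integrable_comp hi1
  have hi4 := hi2.smul_const (R m)
  simp only [ContinuousLinearMap.flip_apply, ContinuousLinearMap.mul_apply', smul_mul_assoc] at hi3
  have h5 : contourIntegral γ (fun l => exp (z * l) • l⁻¹) • R m =
      ∫ s, (contourWeight s • exp (z * contour γ s) • (contour γ s)⁻¹) • R m :=
    (integral_smul_const (μ := volume)
      (fun s => contourWeight s • exp (z * contour γ s) • (contour γ s)⁻¹) (R m)).symm
  rw [h5]
  simp only [contourIntegral, smul_mul_assoc]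
  rw [← integral_add hi4 hi3]
  refine integral_congr_ae (Eventually.of_forall fun s => ?_)
  have h2 := hR.identity _ (contour_mem_wedge hγ s) m hm
  have h3 : R (contour γ s) * R m =
      (contour γ s)⁻¹ • R m + (contour γ s)⁻¹ • (R (contour γ s) * (m • R m - 1)) := by
    rw [mul_sub, mul_one, mul_smul_comm, ← smul_add, eq_inv_smul_iff₀ (contour_ne_zero hγ0 s)]
    rw [sub_smul, sub_eq_sub_iff_add_eq_add] at h2
    rw [eq_comm, add_sub, sub_eq_iff_eq_add, add_comm (R m), ← h2, add_comm]
  simp only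
  rw [h3, smul_add, smul_add, smul_assoc, smul_assoc]

end IsSectorialResolvent

end Sectorial

end AbstractDecay

end

open Filter Topology

noncomputable section

namespace AbstractDecay

open MeasureTheory Complex

/-! ### From a sectorial resolvent to an analytic semigroup and its generator. -/

section Generation

variable {X : Type*} [NormedAddCommGroup X] [NormedSpace ℂ X]

/-- `R` is the resolvent of `L` on the wedge with vertex `γ₀`. -/
structure IsResolventOf (R : ℂ → X →L[ℂ] X) (L : X →ₗ.[ℂ] X) (γ₀ : ℝ) : Prop where
  mem_graph : ∀ m ∈ wedge γ₀, ∀ f, (R m f, m • R m f - f) ∈ L.graph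
  apply_sub : ∀ m ∈ wedge γ₀, ∀ u v, (u, v) ∈ L.graph → R m (m • u - v) = u

lemma mem_cone_of_le {κ : ℝ} (hκ : 0 < κ) {z : ℂ} (hz0 : z ≠ 0)
    (hz : κ * ‖z‖ ≤ z.re - |z.im|) : z ∈ cone :=
  sub_pos.1 ((mul_pos hκ (norm_pos_iff.2 hz0)).trans_le hz)

/-- Gives a uniform decay rate relative to `‖z‖` on each smaller sector, which is the form in which
`exists_norm_le` and `tendsto_apply` are stated. -/
lemma sector_le {δ : ℝ} (hδ : δ ≤ Real.pi / 4) {z : ℂ} (hz : z ∈ sector δ) :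
    (Real.cos δ - Real.sin δ) * ‖z‖ ≤ z.re - |z.im| := by
  have hθ : |z.arg| ≤ δ := hz.2.le
  have h0 := abs_nonneg z.arg
  have hpi := Real.pi_pos
  have hcos : Real.cos δ ≤ Real.cos z.arg := by
    rw [← Real.cos_abs z.arg]
    exact Real.cos_le_cos_of_nonneg_of_le_pi h0 (by linarith) hθ
  have hsin : |Real.sin z.arg| ≤ Real.sin δ := by
    have h1 : Real.sin |z.arg| ≤ Real.sin δ :=
      Real.sin_le_sin_of_le_of_le_pi_div_two (by linarith) (by linarith) hθ
    rwa [Real.abs_sin_eq_sin_abs_of_abs_le_pi (by linarith)]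
  have hre := norm_mul_cos_arg z
  have him : |z.im| = ‖z‖ * |Real.sin z.arg| := by
    rw [← norm_mul_sin_arg z, abs_mul, abs_of_nonneg (norm_nonneg z)]
  rw [him, ← hre]
  nlinarith [norm_nonneg z]

lemma cos_sub_sin_pos {δ : ℝ} (h0 : 0 ≤ δ) (hδ : δ < Real.pi / 4) :
    0 < Real.cos δ - Real.sin δ := by
  have hpi := Real.pi_pos
  have h1 : Real.sin δ < Real.sin (Real.pi / 4) :=
    Real.sin_lt_sin_of_lt_of_le_pi_div_two (by linarith) (by linarith) hδ
  have h2 : Real.cos (Real.pi / 4) < Real.cos δ :=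
    Real.cos_lt_cos_of_nonneg_of_le_pi h0 (by linarith) hδ
  rw [Real.sin_pi_div_four] at h1
  rw [Real.cos_pi_div_four] at h2
  linarith

lemma sector_subset_cone : sector (Real.pi / 4) ⊆ cone := by
  intro z hz
  have h : z ∈ sector ((|z.arg| + Real.pi / 4) / 2) := ⟨hz.1, by linarith [hz.2]⟩
  exact mem_cone_of_le (cos_sub_sin_pos (by linarith [abs_nonneg z.arg, Real.pi_pos])
    (by linarith [hz.2])) hz.1 (sector_le (by linarith [hz.2]) h)

namespace IsSectorialResolvent

variable {R : ℂ → X →L[ℂ] X} {γ₀ M : ℝ} {L : X →ₗ.[ℂ] X}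

lemma hasDerivAt_ofReal (hR : IsSectorialResolvent R γ₀ M) {γ : ℝ} (hγ : γ₀ < γ) {t : ℝ}
    (ht : 0 < t) (f : X) :
    HasDerivAt (fun t : ℝ => sectorialSemigroup R γ t f) (sectorialSemigroupDeriv R γ t f) t := by
  have h := (hR.hasDerivAt_sectorialSemigroup hγ (ofReal_mem_cone ht)).scomp t
    (hasDerivAt_id t).ofReal_comp
  rw [ofReal_one, one_smul] at h
  exact ((ContinuousLinearMap.apply ℂ X f).restrictScalars ℝ).hasFDerivAt.comp_hasDerivAt t h

variable [CompleteSpace X]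

/-- Convergence holds on the range of the resolvent, which contains the dense domain of `L`; local
boundedness in the sector extends it to every vector. -/
lemma tendsto_apply (hR : IsSectorialResolvent R γ₀ M) (hL : IsResolventOf R L γ₀)
    (hd : Dense (L.domain : Set X)) {γ : ℝ} (hγ : γ₀ < γ) {κ : ℝ} (hκ : 0 < κ) (f : X) :
    Tendsto (fun z => sectorialSemigroup R γ z f)
      (𝓝[{z | z ≠ 0 ∧ κ * ‖z‖ ≤ z.re - |z.im|}] 0) (𝓝 f) := by
  set S : Set ℂ := {z | z ≠ 0 ∧ κ * ‖z‖ ≤ z.re - |z.im|} with hS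
  have hm := ofReal_mem_wedge hγ
  have hsub : S ⊆ cone := fun z hz => mem_cone_of_le hκ hz.1 hz.2
  obtain ⟨C, hC⟩ := hR.exists_norm_le hγ hκ
  have hC' : ∀ᶠ z in 𝓝[S] 0, ‖sectorialSemigroup R γ z‖ ≤ C := by
    have h1 : ∀ᶠ z : ℂ in 𝓝[S] 0, ‖z‖ < γ₀⁻¹ := by
      refine nhdsWithin_le_nhds ?_
      filter_upwards [Metric.ball_mem_nhds (0 : ℂ) (inv_pos.2 hR.pos)] with z hz
      simpa using hz
    filter_upwards [h1, self_mem_nhdsWithin] with z hz1 hz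
    exact hC z hz.1 hz.2 hz1
  have hlim : ∀ g, Tendsto (fun z => sectorialSemigroup R γ z (R (γ : ℂ) g)) (𝓝[S] 0)
      (𝓝 (R (γ : ℂ) g)) := fun g =>
    (((ContinuousLinearMap.apply ℂ X g).continuous.tendsto _).comp
      (hR.tendsto_sectorialSemigroup_mul hγ hm)).mono_left (nhdsWithin_mono 0 hsub)
  rw [Metric.tendsto_nhds]
  intro ε hε
  have hC0 : 0 < |C| + 2 := by positivity
  obtain ⟨u, hu, huf⟩ := Metric.dense_iff.1 hd f (ε / (2 * (|C| + 2))) (by positivity)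
  obtain ⟨g, rfl⟩ : ∃ g, R (γ : ℂ) g = u :=
    ⟨_, hL.apply_sub _ hm u _ (L.mem_graph ⟨u, huf⟩)⟩
  rw [Metric.mem_ball, dist_eq_norm] at hu
  filter_upwards [hC', Metric.tendsto_nhds.1 (hlim g) (ε / 2) (half_pos hε)] with z hz1 hz2
  rw [dist_eq_norm] at hz2 ⊢
  have h1 : sectorialSemigroup R γ z f - f =
      -(sectorialSemigroup R γ z (R (γ : ℂ) g - f)) + (R (γ : ℂ) g - f) +
        (sectorialSemigroup R γ z (R (γ : ℂ) g) - R (γ : ℂ) g) := by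
    rw [map_sub]; abel
  rw [lt_div_iff₀ (by positivity)] at hu
  have h2 : ‖sectorialSemigroup R γ z (R (γ : ℂ) g - f)‖ ≤ |C| * ‖R (γ : ℂ) g - f‖ :=
    (ContinuousLinearMap.le_opNorm _ _).trans
      (mul_le_mul_of_nonneg_right (hz1.trans (le_abs_self C)) (norm_nonneg _))
  rw [h1]
  refine (norm_add₃_le).trans_lt ?_
  rw [norm_neg]
  nlinarith [norm_nonneg (R (γ : ℂ) g - f)]

lemma commute_sectorialSemigroupDeriv (hR : IsSectorialResolvent R γ₀ M) {γ : ℝ} (hγ : γ₀ < γ)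
    {z : ℂ} (hz : z ∈ cone) {m : ℂ} (hm : m ∈ wedge γ₀) :
    R m * sectorialSemigroupDeriv R γ z = sectorialSemigroupDeriv R γ z * R m := by
  have h := hR.hasDerivAt_sectorialSemigroup hγ hz
  refine (h.const_mul (R m)).unique ((h.mul_const (R m)).congr_of_eventuallyEq ?_)
  filter_upwards [isOpen_cone.mem_nhds hz] with w hw
  exact hR.commute_sectorialSemigroup hγ hw hm

lemma sectorialSemigroupDeriv_mul (hR : IsSectorialResolvent R γ₀ M) {γ : ℝ} (hγ : γ₀ < γ)
    {z : ℂ} (hz : z ∈ cone) {m : ℂ} (hm : m ∈ wedge γ₀) :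
    sectorialSemigroupDeriv R γ z * R m =
      m • (sectorialSemigroup R γ z * R m) - sectorialSemigroup R γ z := by
  have h := hR.resolvent_mul_sub hγ hz hm
  rw [mul_sub, mul_smul_comm, hR.commute_sectorialSemigroup hγ hz hm,
    hR.commute_sectorialSemigroupDeriv hγ hz hm] at h
  rw [eq_sub_iff_add_eq, ← sub_eq_iff_eq_add'.1 h]

/-- Formally both sides are `S(z) L S(w)`; the resolvent `R γ` is used so that only bounded
operators occur. -/
lemma deriv_mul_eq_mul_deriv (hR : IsSectorialResolvent R γ₀ M) {γ : ℝ} (hγ : γ₀ < γ)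
    {z w : ℂ} (hz : z ∈ cone) (hw : w ∈ cone) :
    sectorialSemigroupDeriv R γ z * sectorialSemigroup R γ w =
      sectorialSemigroup R γ z * sectorialSemigroupDeriv R γ w := by
  have hm := ofReal_mem_wedge hγ
  have h1 := hR.resolvent_mul_sub hγ hw hm
  have h2 := hR.sectorialSemigroupDeriv_mul hγ hz hm
  nth_rewrite 1 [← h1]
  rw [← mul_assoc, h2, sub_mul, smul_mul_assoc, mul_assoc, h1, mul_sub, mul_smul_comm]
  abel

/-- The semigroup law on the cone. -/
lemma sectorialSemigroup_add (hR : IsSectorialResolvent R γ₀ M) (hL : IsResolventOf R L γ₀)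
    (hd : Dense (L.domain : Set X)) {γ : ℝ} (hγ : γ₀ < γ) {z w : ℂ} (hz : z ∈ cone)
    (hw : w ∈ cone) :
    sectorialSemigroup R γ (z + w) = sectorialSemigroup R γ z * sectorialSemigroup R γ w := by
  have hmem : ∀ s : ℝ, s ≤ 1 → z + ((1 - s : ℝ) : ℂ) * w ∈ cone := by
    intro s hs
    rcases hs.eq_or_lt with rfl | hs
    · simpa using hz
    · exact add_mem_cone hz (smul_mem_cone hw (by linarith))
  have hA : ∀ s : ℝ, s ≤ 1 →
      HasDerivAt (fun s : ℝ => sectorialSemigroup R γ (z + ((1 - s : ℝ) : ℂ) * w))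
        (-(w • sectorialSemigroupDeriv R γ (z + ((1 - s : ℝ) : ℂ) * w))) s := by
    intro s hs
    have h1 : HasDerivAt (fun s : ℝ => z + ((1 - s : ℝ) : ℂ) * w) (((-1 : ℝ) : ℂ) * w) s :=
      (((hasDerivAt_id s).const_sub 1).ofReal_comp.mul_const w).const_add z
    have h2 := (hR.hasDerivAt_sectorialSemigroup hγ (hmem s hs)).scomp s h1
    rw [ofReal_neg, ofReal_one, neg_one_mul, neg_smul] at h2
    exact h2
  have hB : ∀ s : ℝ, 0 < s →
      HasDerivAt (fun s : ℝ => sectorialSemigroup R γ ((s : ℂ) * w))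
        (w • sectorialSemigroupDeriv R γ ((s : ℂ) * w)) s := by
    intro s hs
    have h1 : HasDerivAt (fun s : ℝ => (s : ℂ) * w) (((1 : ℝ) : ℂ) * w) s :=
      (hasDerivAt_id s).ofReal_comp.mul_const w
    have h2 := (hR.hasDerivAt_sectorialSemigroup hγ (smul_mem_cone hw hs)).scomp s h1
    rw [ofReal_one, one_mul] at h2
    exact h2
  -- The path `s ↦ S(z + (1 - s) w) S(s w)` has zero derivative. At `s = 1` it is `S(z) S(w)`, and
  -- as `s → 0` it tends strongly to `S(z + w)`.
  have hAB : ∀ s : ℝ, 0 < s → s ≤ 1 →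
      HasDerivAt (fun s : ℝ => sectorialSemigroup R γ (z + ((1 - s : ℝ) : ℂ) * w) *
        sectorialSemigroup R γ ((s : ℂ) * w)) 0 s := by
    intro s h0 h1
    have h := (hA s h1).mul (hB s h0)
    rw [neg_mul, smul_mul_assoc, mul_smul_comm,
      hR.deriv_mul_eq_mul_deriv hγ (hmem s h1) (smul_mem_cone hw h0), neg_add_cancel] at h
    exact h
  have hconst : ∀ e : ℝ, 0 < e → e ≤ 1 →
      sectorialSemigroup R γ (z + ((1 - e : ℝ) : ℂ) * w) * sectorialSemigroup R γ ((e : ℂ) * w) =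
        sectorialSemigroup R γ z * sectorialSemigroup R γ w := by
    intro e he he1
    have h := constant_of_has_deriv_right_zero (a := e) (b := 1)
      (fun s hs => (hAB s (he.trans_le hs.1) hs.2).continuousAt.continuousWithinAt)
      (fun s hs => (hAB s (he.trans_le hs.1) hs.2.le).hasDerivWithinAt) 1 ⟨he1, le_rfl⟩
    simpa using h.symm
  ext f
  -- The points `s w` with `s > 0` run along the ray through `w`, so this ratio is their exact decay
  -- rate.
  have hκ : 0 < (w.re - |w.im|) / ‖w‖ :=
    div_pos (sub_pos.2 hw) (norm_pos_iff.2 (ne_zero_of_mem_cone hw))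
  have ht0 : Tendsto (fun s : ℝ => (s : ℂ) * w) (𝓝[>] 0)
      (𝓝[{z | z ≠ 0 ∧ (w.re - |w.im|) / ‖w‖ * ‖z‖ ≤ z.re - |z.im|}] 0) := by
    refine tendsto_nhdsWithin_iff.2 ⟨?_, ?_⟩
    · have : Continuous fun s : ℝ => (s : ℂ) * w := by fun_prop
      exact (this.tendsto' 0 0 (by simp)).mono_left nhdsWithin_le_nhds
    · filter_upwards [self_mem_nhdsWithin] with s hs
      have hs : 0 < s := hs
      refine ⟨mul_ne_zero (ofReal_ne_zero.2 hs.ne') (ne_zero_of_mem_cone hw), ?_⟩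
      have hw0 : ‖w‖ ≠ 0 := norm_ne_zero_iff.2 (ne_zero_of_mem_cone hw)
      rw [norm_mul, norm_real, Real.norm_of_nonneg hs.le, re_ofReal_mul, im_ofReal_mul, abs_mul,
        abs_of_pos hs]
      apply le_of_eq
      field_simp
  have ht1 := (hR.tendsto_apply hL hd hγ hκ f).comp ht0
  have ht2 : Tendsto (fun s : ℝ => sectorialSemigroup R γ (z + ((1 - s : ℝ) : ℂ) * w)) (𝓝[>] 0)
      (𝓝 (sectorialSemigroup R γ (z + w))) := by
    have := (hA 0 zero_le_one).continuousAt.tendsto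
    simp only [sub_zero, ofReal_one, one_mul] at this
    exact this.mono_left nhdsWithin_le_nhds
  have ht3 := (isBoundedBilinearMap_apply (𝕜 := ℂ) (E := X) (F := X)).continuous.tendsto _ |>.comp
    (ht2.prodMk_nhds ht1)
  refine tendsto_nhds_unique ht3 (tendsto_const_nhds.congr' ?_)
  filter_upwards [Ioc_mem_nhdsGT one_pos] with e he
  rw [← hconst e he.1 he.2]
  rfl

lemma tendsto_nhdsGT (hR : IsSectorialResolvent R γ₀ M) (hL : IsResolventOf R L γ₀)
    (hd : Dense (L.domain : Set X)) {γ : ℝ} (hγ : γ₀ < γ) (f : X) :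
    Tendsto (fun t : ℝ => sectorialSemigroup R γ t f) (𝓝[>] 0) (𝓝 f) := by
  refine (hR.tendsto_apply hL hd hγ one_pos f).comp (tendsto_nhdsWithin_iff.2 ⟨?_, ?_⟩)
  · exact (continuous_ofReal.tendsto' 0 0 ofReal_zero).mono_left nhdsWithin_le_nhds
  · filter_upwards [self_mem_nhdsWithin] with t ht
    have ht : 0 < t := ht
    exact ⟨ofReal_ne_zero.2 ht.ne', by simp [abs_of_pos ht]⟩

/-- A densely defined operator with a sectorial resolvent generates an analytic semigroup. -/
theorem exists_semigroup (hR : IsSectorialResolvent R γ₀ M) (hL : IsResolventOf R L γ₀)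
    (hd : Dense (L.domain : Set X)) :
    ∃ T : ℝ → X →L[ℂ] X, IsAnalyticSemigroup T ∧ IsGenerator L T ∧
      (∀ f, ContDiffOn ℝ (⊤ : ℕ∞) (fun t => T t f) (Set.Ioi 0)) ∧
      ∀ f, ∀ t > 0, ∃ v, (T t f, v) ∈ L.graph ∧ HasDerivAt (fun t => T t f) v t := by
  set γ := γ₀ + 1
  have hγ : γ₀ < γ := lt_add_one γ₀
  have hm := ofReal_mem_wedge hγ
  set Z := sectorialSemigroup R γ with hZ
  -- The contour integral represents the semigroup only for `t > 0`; the identity has to be supplied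
  -- at `t = 0`.
  set T : ℝ → X →L[ℂ] X := fun t => if 0 < t then Z t else 1 with hT
  have hTpos : ∀ t : ℝ, 0 < t → T t = Z t := fun t ht => if_pos ht
  have hT0 : T 0 = 1 := if_neg (lt_irrefl 0)
  have hTev : ∀ t : ℝ, 0 < t → ∀ f, (fun t => T t f) =ᶠ[𝓝 t] fun t : ℝ => Z t f := by
    intro t ht f
    filter_upwards [Ioi_mem_nhds ht] with s hs
    rw [hTpos s hs]
  have hTd : ∀ t : ℝ, 0 < t → ∀ f,
      HasDerivAt (fun t => T t f) (sectorialSemigroupDeriv R γ t f) t := fun t ht f =>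
    (hR.hasDerivAt_ofReal hγ ht f).congr_of_eventuallyEq (hTev t ht f)
  have hTlim : ∀ f, Tendsto (fun t => T t f) (𝓝[>] 0) (𝓝 f) := by
    intro f
    refine (hR.tendsto_nhdsGT hL hd hγ f).congr' ?_
    filter_upwards [self_mem_nhdsWithin] with t ht
    rw [hTpos t ht]
  have hcont : ∀ f, ContinuousOn (fun t => T t f) (Set.Ici 0) := by
    intro f t ht
    rcases (Set.mem_Ici.1 ht).eq_or_lt with rfl | ht
    · rw [← continuousWithinAt_Ioi_iff_Ici, ContinuousWithinAt, hT0]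
      exact hTlim f
    · exact (hTd t ht f).continuousAt.continuousWithinAt
  have hc0 : IsC0Semigroup T := by
    refine ⟨hT0, fun s t hs ht => ?_, hcont⟩
    rcases hs.eq_or_lt with rfl | hs
    · rw [zero_add, hT0]; rfl
    rcases ht.eq_or_lt with rfl | ht
    · rw [add_zero, hT0]; rfl
    rw [hTpos s hs, hTpos t ht, hTpos _ (add_pos hs ht), ofReal_add]
    exact hR.sectorialSemigroup_add hL hd hγ (ofReal_mem_cone hs) (ofReal_mem_cone ht)
  have hdiff : DifferentiableOn ℂ Z cone := fun z hz =>
    (hR.hasDerivAt_sectorialSemigroup hγ hz).differentiableAt.differentiableWithinAt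
  have hgen : ∀ u v, (u, v) ∈ L.graph →
      Tendsto (fun t : ℝ => t⁻¹ • (T t u - u)) (𝓝[>] 0) (𝓝 v) := by
    intro u v huv
    have hu := hL.apply_sub _ hm u v huv
    have hderiv : ∀ t : ℝ, 0 < t → sectorialSemigroupDeriv R γ t u = T t v := by
      intro t ht
      have h1 := congrArg (fun B : X →L[ℂ] X => B ((γ : ℂ) • u - v))
        (hR.sectorialSemigroupDeriv_mul hγ (ofReal_mem_cone ht) hm)
      change sectorialSemigroupDeriv R γ t (R γ ((γ : ℂ) • u - v)) =
        (γ : ℂ) • sectorialSemigroup R γ t (R γ ((γ : ℂ) • u - v)) -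
          sectorialSemigroup R γ t ((γ : ℂ) • u - v) at h1
      rw [hu, map_sub, map_smul, sub_sub_cancel] at h1
      rw [h1, hTpos t ht]
    -- For `t > 0` the derivative of `T t u` is `T t v`, which tends to `v`; a limit of derivatives
    -- at the endpoint is the one-sided derivative there.
    have h := hasDerivWithinAt_Ici_of_tendsto_deriv (s := Set.Ioi 0) (a := 0) (e := v)
      (f := fun t => T t u)
      (fun t ht => (hTd t ht u).differentiableAt.differentiableWithinAt)
      ((hcont u 0 Set.self_mem_Ici).mono Set.Ioi_subset_Ici_self) self_mem_nhdsWithin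
      ((hTlim v).congr' (by
        filter_upwards [self_mem_nhdsWithin] with t ht
        rw [(hTd t ht u).deriv, hderiv t ht]))
    have h2 := (hasDerivWithinAt_iff_tendsto_slope' (by simp)).1
      (h.mono Set.Ioi_subset_Ici_self)
    refine h2.congr fun t => ?_
    rw [slope_def_module, sub_zero, hT0]
    rfl
  refine ⟨T, ⟨hc0, Real.pi / 4, by positivity, by linarith [Real.pi_pos], Z,
    fun t ht => (hTpos t ht).symm, hdiff.mono sector_subset_cone,
    fun z hz w hw => hR.sectorialSemigroup_add hL hd hγ (sector_subset_cone hz)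
      (sector_subset_cone hw), fun δ' h0 hδ' f => ?_⟩, fun u v => ⟨hgen u v, fun h => ?_⟩,
    fun f => ?_, fun f t ht => ?_⟩
  · exact (hR.tendsto_apply hL hd hγ (cos_sub_sin_pos h0.le hδ') f).mono_left
      (nhdsWithin_mono 0 fun z hz => ⟨hz.1, sector_le hδ'.le hz⟩)
  -- For the converse, apply `R γ` to the difference quotient. As `R γ u` lies in the domain, this
  -- gives `R γ v = γ R γ u - u`, so `u = R γ (γ u - v)` is in the domain as well.
  · have h1 := hgen _ _ (hL.mem_graph _ hm u)
    have h2 := ((R (γ : ℂ)).continuous.tendsto v).comp h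
    have h3 : R (γ : ℂ) v = (γ : ℂ) • R (γ : ℂ) u - u := by
      refine tendsto_nhds_unique h2 (h1.congr' ?_)
      filter_upwards [self_mem_nhdsWithin] with t ht
      have h4 := congrArg (fun B : X →L[ℂ] X => B u)
        (hR.commute_sectorialSemigroup hγ (ofReal_mem_cone ht) hm)
      change R γ (Z t u) = Z t (R γ u) at h4
      rw [Function.comp_apply, ContinuousLinearMap.map_smul_of_tower, map_sub, hTpos t ht, h4]
    have h5 : R (γ : ℂ) ((γ : ℂ) • u - v) = u := by
      rw [map_sub, map_smul, h3]
      abel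
    have h6 := hL.mem_graph _ hm ((γ : ℂ) • u - v)
    rw [h5] at h6
    simpa using h6
  · have h1 : ContDiffOn ℂ (⊤ : ℕ∞) Z cone := hdiff.contDiffOn isOpen_cone
    have h2 : ContDiffOn ℝ (⊤ : ℕ∞) Z cone := h1.restrict_scalars ℝ
    have h3 : ContDiffOn ℝ (⊤ : ℕ∞) (fun t : ℝ => Z t) (Set.Ioi 0) :=
      h2.comp ofRealCLM.contDiff.contDiffOn fun t ht => ofReal_mem_cone ht
    have h4 : ContDiffOn ℝ (⊤ : ℕ∞) (fun t : ℝ => Z t f) (Set.Ioi 0) :=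
      (((ContinuousLinearMap.apply ℂ X f).restrictScalars ℝ).contDiff).comp_contDiffOn h3
    exact h4.congr fun t ht => by simp only [hTpos t ht]
  · refine ⟨_, ?_, hTd t ht f⟩
    have h1 := congrArg (fun B : X →L[ℂ] X => B f)
      (hR.resolvent_mul_sub hγ (ofReal_mem_cone ht) hm)
    change R γ ((γ : ℂ) • Z t f - sectorialSemigroupDeriv R γ t f) = Z t f at h1
    have h2 := hL.mem_graph _ hm
      ((γ : ℂ) • Z t f - sectorialSemigroupDeriv R γ t f)
    rw [h1, sub_sub_cancel] at h2
    rw [hTpos t ht]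
    exact h2

end IsSectorialResolvent

end Generation

end AbstractDecay

end

open Filter Topology

noncomputable section

namespace AbstractDecay

open Complex

/-! ### Resolvents of unbounded operators -/

section Ev

variable {E F : Type*} [AddCommGroup E] [Module ℂ E] [AddCommGroup F] [Module ℂ F]
  {T : E →ₗ.[ℂ] F}

lemma ev_of_mem {u : E} (h : u ∈ T.domain) : ev T u = T ⟨u, h⟩ := dif_pos h

lemma mem_graph_iff_ev {u : E} {v : F} : (u, v) ∈ T.graph ↔ u ∈ T.domain ∧ ev T u = v := by
  constructor
  · intro h
    obtain ⟨y, hy1, hy2⟩ := (LinearPMap.mem_graph_iff T).1 h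
    obtain rfl : (y : E) = u := hy1
    exact ⟨y.2, (ev_of_mem y.2).trans hy2⟩
  · rintro ⟨h, rfl⟩
    rw [ev_of_mem h]
    exact T.mem_graph ⟨u, h⟩

lemma ev_mem_graph {u : E} (h : u ∈ T.domain) : (u, ev T u) ∈ T.graph :=
  mem_graph_iff_ev.2 ⟨h, rfl⟩

lemma ev_add {u v : E} (hu : u ∈ T.domain) (hv : v ∈ T.domain) :
    ev T (u + v) = ev T u + ev T v :=
  (mem_graph_iff_ev.1 (T.graph.add_mem (ev_mem_graph hu) (ev_mem_graph hv))).2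

lemma ev_sub {u v : E} (hu : u ∈ T.domain) (hv : v ∈ T.domain) :
    ev T (u - v) = ev T u - ev T v :=
  (mem_graph_iff_ev.1 (T.graph.sub_mem (ev_mem_graph hu) (ev_mem_graph hv))).2

lemma ev_smul {u : E} (a : ℂ) (hu : u ∈ T.domain) : ev T (a • u) = a • ev T u :=
  (mem_graph_iff_ev.1 (T.graph.smul_mem a (ev_mem_graph hu))).2

end Ev

section Resolvent

variable {X : Type*} [NormedAddCommGroup X] [NormedSpace ℂ X]

/-- An operator `l - T` that is bounded below and surjective has a bounded inverse. -/
lemma exists_resolvent {T : X →ₗ.[ℂ] X} {l : ℂ} {k : ℝ} (hk : 0 < k)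
    (hlow : ∀ u ∈ T.domain, k * ‖u‖ ≤ ‖l • u - ev T u‖)
    (hsurj : ∀ f, ∃ u ∈ T.domain, l • u - ev T u = f) :
    ∃ R : X →L[ℂ] X, (∀ f, (R f, l • R f - f) ∈ T.graph) ∧
      (∀ u v, (u, v) ∈ T.graph → R (l • u - v) = u) ∧ k * ‖R‖ ≤ 1 := by
  choose g hgd hg using hsurj
  have hinj : ∀ u ∈ T.domain, ∀ f, l • u - ev T u = f → g f = u := by
    intro u hu f hf
    have h := hlow _ (T.domain.sub_mem (hgd f) hu)
    rw [ev_sub (hgd f) hu, smul_sub, sub_sub_sub_comm, hg f, hf, sub_self, norm_zero] at h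
    exact sub_eq_zero.1 (norm_le_zero_iff.1 (nonpos_of_mul_nonpos_right h hk))
  let G : X →ₗ[ℂ] X :=
    { toFun := g
      map_add' := fun x y => hinj _ (T.domain.add_mem (hgd x) (hgd y)) _ (by
        rw [ev_add (hgd x) (hgd y), smul_add, add_sub_add_comm, hg, hg])
      map_smul' := fun a x => hinj _ (T.domain.smul_mem a (hgd x)) _ (by
        rw [ev_smul a (hgd x), smul_comm l a, ← smul_sub, hg]) }
  have hb : ∀ f, ‖G f‖ ≤ k⁻¹ * ‖f‖ := fun f => by
    rw [inv_mul_eq_div, le_div_iff₀' hk]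
    have := hlow (g f) (hgd f)
    rwa [hg f] at this
  refine ⟨G.mkContinuous k⁻¹ hb, fun f => ?_, fun u v huv => ?_, ?_⟩
  · refine mem_graph_iff_ev.2 ⟨hgd f, ?_⟩
    rw [eq_sub_iff_add_eq, ← eq_sub_iff_add_eq']
    exact (hg f).symm
  · obtain ⟨hu, rfl⟩ := mem_graph_iff_ev.1 huv
    exact hinj u hu _ rfl
  · have := G.mkContinuous_norm_le (inv_pos.2 hk).le hb
    rwa [← le_div_iff₀' hk, one_div]

/-- Apply `R l` to `(l - T) R m f = f + (l - m) R m f`. -/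
lemma IsResolventOf.identity {R : ℂ → X →L[ℂ] X} {T : X →ₗ.[ℂ] X} {γ₀ : ℝ}
    (h : IsResolventOf R T γ₀) : ∀ l ∈ wedge γ₀, ∀ m ∈ wedge γ₀,
      R l - R m = (m - l) • (R l * R m) := by
  intro l hl m hm
  ext f
  have h1 := h.apply_sub l hl _ _ (h.mem_graph m hm f)
  rw [← sub_add, ← sub_smul, map_add, map_smul] at h1
  change R l f - R m f = (m - l) • R l (R m f)
  nth_rewrite 1 [← h1]
  rw [← neg_sub l m, neg_smul]
  abel

end Resolvent

/-! ### Surjectivity of `l - A` for a self-adjoint operator. -/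

section SelfAdjoint

variable {X : Type*} [NormedAddCommGroup X] [InnerProductSpace ℂ X] [CompleteSpace X]

lemma inner_ev_symm {A : X →ₗ.[ℂ] X} (hA : IsSelfAdjoint A) {u v : X} (hu : u ∈ A.domain)
    (hv : v ∈ A.domain) : inner ℂ (ev A u) v = inner ℂ u (ev A v) := by
  have h := LinearPMap.adjoint_isFormalAdjoint hA.dense_domain
  rw [LinearPMap.isSelfAdjoint_def.1 hA] at h
  rw [ev_of_mem hu, ev_of_mem hv]
  exact h ⟨u, hu⟩ ⟨v, hv⟩

/-- Maximality: the hypothesis says that `(y, z)` belongs to the graph of the adjoint, which is `A`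
itself. -/
lemma mem_graph_of_forall_inner {A : X →ₗ.[ℂ] X} (hA : IsSelfAdjoint A) {y z : X}
    (h : ∀ u ∈ A.domain, inner ℂ z u = inner ℂ y (ev A u)) : (y, z) ∈ A.graph := by
  have hy' : ∀ x : A.domain, inner ℂ z (x : X) = inner ℂ y (A x) := fun x => by
    rw [h x x.2, ev_of_mem x.2]
  have hm : y ∈ A.adjoint.domain := LinearPMap.mem_adjoint_domain_of_exists y ⟨z, hy'⟩
  have h0 := LinearPMap.adjoint_apply_eq hA.dense_domain ⟨y, hm⟩ hy'
  have h1 : (y, z) ∈ A.adjoint.graph := by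
    rw [← h0]
    exact A.adjoint.mem_graph ⟨y, hm⟩
  rwa [LinearPMap.isSelfAdjoint_def.1 hA] at h1

/-- If `A` is self-adjoint and `l - A`, `conj l - A` are bounded below, then `l - A` is onto. -/
lemma surjective_sub {A : X →ₗ.[ℂ] X} (hA : IsSelfAdjoint A) {l : ℂ} {k : ℝ} (hk : 0 < k)
    (hlow : ∀ u ∈ A.domain, k * ‖u‖ ≤ ‖l • u - ev A u‖)
    (hlow' : ∀ u ∈ A.domain, k * ‖u‖ ≤ ‖(starRingEnd ℂ) l • u - ev A u‖) (f : X) :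
    ∃ u ∈ A.domain, l • u - ev A u = f := by
  -- On the graph, a complete space because `A` is closed, `l - A` becomes a bounded map; the lower
  -- bound makes it antilipschitz, so its range is closed.
  let N : A.graph →L[ℂ] X :=
    (l • ContinuousLinearMap.fst ℂ X X - ContinuousLinearMap.snd ℂ X X).comp A.graph.subtypeL
  have hN : ∀ p : A.graph, N p = l • (p : X × X).1 - (p : X × X).2 := fun p => rfl
  have hcomplete : CompleteSpace A.graph :=
    (show IsClosed (A.graph : Set (X × X)) from hA.isClosed).completeSpace_coe
  have hanti : AntilipschitzWith (Real.toNNReal (k⁻¹ + (1 + ‖l‖ * k⁻¹))) N := by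
    refine AddMonoidHomClass.antilipschitz_of_bound N fun p => ?_
    obtain ⟨⟨u, v⟩, hp⟩ := p
    obtain ⟨hu, rfl⟩ := mem_graph_iff_ev.1 hp
    rw [Real.coe_toNNReal _ (by positivity), hN]
    change max ‖u‖ ‖ev A u‖ ≤ _ * ‖l • u - ev A u‖
    have h1 : ‖u‖ ≤ k⁻¹ * ‖l • u - ev A u‖ := by
      rw [inv_mul_eq_div, le_div_iff₀' hk]
      exact hlow u hu
    have h2 : ‖ev A u‖ ≤ ‖l • u - ev A u‖ + ‖l‖ * ‖u‖ := by
      rw [← norm_smul]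
      have := norm_sub_le (l • u) (l • u - ev A u)
      rw [sub_sub_cancel] at this
      linarith
    have h3 := mul_le_mul_of_nonneg_left h1 (norm_nonneg l)
    have h4 := norm_nonneg (l • u - ev A u)
    have h5 : 0 ≤ k⁻¹ * ‖l • u - ev A u‖ := by positivity
    have h6 : 0 ≤ ‖l‖ * (k⁻¹ * ‖l • u - ev A u‖) := by positivity
    refine max_le ?_ ?_ <;> linarith
  have hcl : IsClosed (Set.range N) := hanti.isClosed_range N.uniformContinuous
  have hclosed : IsClosed ((LinearMap.range (N : A.graph →ₗ[ℂ] X) : Submodule ℂ X) : Set X) := hcl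
  have : CompleteSpace (LinearMap.range (N : A.graph →ₗ[ℂ] X)) := hclosed.completeSpace_coe
  have htop : LinearMap.range (N : A.graph →ₗ[ℂ] X) = ⊤ := by
    rw [← Submodule.orthogonal_eq_bot_iff, Submodule.eq_bot_iff]
    intro y hy
    -- A vector orthogonal to the range is an eigenvector of `A` for `conj l`, which the second
    -- lower bound excludes unless it is zero.
    have hy' : ∀ u ∈ A.domain, inner ℂ ((starRingEnd ℂ) l • y) u = inner ℂ y (ev A u) := by
      intro u hu
      have h1 := (Submodule.mem_orthogonal' _ _).1 hy (l • u - ev A u)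
        ⟨⟨(u, ev A u), ev_mem_graph hu⟩, rfl⟩
      rw [inner_sub_right, inner_smul_right, sub_eq_zero] at h1
      rw [inner_smul_left, conj_conj, h1]
    obtain ⟨h1, h2⟩ := mem_graph_iff_ev.1 (mem_graph_of_forall_inner hA hy')
    have h3 := hlow' y h1
    rw [h2, sub_self, norm_zero] at h3
    exact norm_le_zero_iff.1 (nonpos_of_mul_nonpos_right h3 hk)
  have hf : f ∈ LinearMap.range (N : A.graph →ₗ[ℂ] X) := by rw [htop]; trivial
  obtain ⟨⟨⟨u, v⟩, hp⟩, rfl⟩ := hf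
  obtain ⟨hu, rfl⟩ := mem_graph_iff_ev.1 hp
  exact ⟨u, hu, rfl⟩

end SelfAdjoint

/-! ### Relative compactness and the sectorial resolvent of `L_α`. -/

section Perturbation

variable {X : Type*} [NormedAddCommGroup X] [InnerProductSpace ℂ X] [CompleteSpace X]
  {A Λ : X →ₗ.[ℂ] X}

lemma AssumptionA.re_inner_nonpos (hA : AssumptionA A) {u : X} (hu : u ∈ A.domain) :
    (inner ℂ (ev A u) u).re ≤ 0 ∧ (inner ℂ (ev A u) u).im = 0 := by
  obtain ⟨C, hC, h⟩ := hA.coercive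
  have h1 := h u hu
  rw [inner_neg_left, neg_re] at h1
  refine ⟨by nlinarith [sq_nonneg ‖u‖], ?_⟩
  rw [← conj_eq_iff_im, inner_conj_symm]
  exact (inner_ev_symm hA.selfAdjoint hu hu).symm

/-- The numerical range of `A` lies in `(-∞, 0]`, and a point with `|arg l| < 3π/4` has distance at
least `‖l‖ / √2` from that half-line. -/
lemma AssumptionA.norm_le (hA : AssumptionA A) {l : ℂ} (hl : l ∈ wedge 0) {u : X}
    (hu : u ∈ A.domain) : ‖l‖ / 2 * ‖u‖ ≤ ‖l • u - ev A u‖ := by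
  obtain ⟨hre, him⟩ := hA.re_inner_nonpos hu
  rcases eq_or_ne u 0 with rfl | hu0
  · simp
  have hpos : 0 < ‖u‖ := norm_pos_iff.2 hu0
  have h1 := norm_inner_le_norm (𝕜 := ℂ) (l • u - ev A u) u
  rw [inner_sub_left, inner_smul_left, inner_self_eq_norm_sq_to_K] at h1
  set w : ℂ := (starRingEnd ℂ) l * ((‖u‖ : ℝ) : ℂ) ^ 2 - inner ℂ (ev A u) u with hw
  have hwre : w.re = l.re * ‖u‖ ^ 2 - (inner ℂ (ev A u) u).re := by
    rw [hw, ← ofReal_pow, sub_re, re_mul_ofReal, conj_re]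
  have hwim : w.im = -(l.im * ‖u‖ ^ 2) := by
    rw [hw, ← ofReal_pow, sub_im, im_mul_ofReal, conj_im, him]
    ring
  have h2 : ‖l‖ / 2 * ‖u‖ ^ 2 ≤ ‖w‖ := by
    refine abs_le_of_sq_le_sq' ?_ (norm_nonneg _) |>.2
    rw [← normSq_eq_norm_sq, normSq_apply, hwre, hwim, mul_pow, div_pow, ← normSq_eq_norm_sq,
      normSq_apply]
    set n := ‖u‖ ^ 2
    have hn : 0 ≤ n := sq_nonneg _
    set q := (inner ℂ (ev A u) u).re
    rcases le_or_gt 0 l.re with h0 | h0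
    · nlinarith [mul_nonneg (mul_nonneg h0 hn) (neg_nonneg.2 hre), sq_nonneg q,
        sq_nonneg (l.re * n), sq_nonneg (l.im * n)]
    · have h3 : l.re ^ 2 ≤ l.im ^ 2 := by
        rw [sq_le_sq, abs_of_neg h0]
        have : (0 : ℝ) < l.re + |l.im| := hl
        linarith
      nlinarith [sq_nonneg (l.re * n - q), mul_le_mul_of_nonneg_right h3 (sq_nonneg n)]
  have h3 : ‖l‖ / 2 * ‖u‖ * ‖u‖ ≤ ‖l • u - ev A u‖ * ‖u‖ := by
    refine le_trans (le_of_eq (by ring)) (h2.trans h1)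
  exact le_of_mul_le_mul_right h3 hpos

lemma AssumptionA.norm_ev_le (hA : AssumptionA A) {l : ℂ} (hl : l ∈ wedge 0) {u : X}
    (hu : u ∈ A.domain) : ‖ev A u‖ ≤ 3 * ‖l • u - ev A u‖ := by
  have h1 := hA.norm_le hl hu
  have h2 := norm_sub_le (l • u) (l • u - ev A u)
  rw [sub_sub_cancel, norm_smul] at h2
  linarith

/-- A relatively compact closed operator has relative bound zero. -/
lemma AssumptionLambda.relative_bound (hΛ : AssumptionLambda A Λ) {ε : ℝ} (hε : 0 < ε) :
    ∃ C : ℝ, 0 ≤ C ∧ ∀ u ∈ A.domain, ‖ev Λ u‖ ≤ ε * ‖ev A u‖ + C * ‖u‖ := by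
  by_contra hcon
  push Not at hcon
  have hcon' : ∀ n : ℕ, ∃ u ∈ A.domain, ε * ‖ev A u‖ + (n + 1) * ‖u‖ < ‖ev Λ u‖ :=
    fun n => hcon (n + 1) (by positivity)
  choose u hu hlt using hcon'
  have hΛpos : ∀ n, 0 < ‖ev Λ (u n)‖ := fun n => lt_of_le_of_lt (by positivity) (hlt n)
  -- Normalize so that `‖Λ v n‖ = 1`. Then `v n → 0` while `A v n` stays bounded; by compactness `Λ
  -- v n` converges along a subsequence, and closedness forces the limit to be `0`, a contradiction.
  set v : ℕ → X := fun n => ((‖ev Λ (u n)‖⁻¹ : ℝ) : ℂ) • u n with hv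
  have hvA : ∀ n, v n ∈ A.domain := fun n => A.domain.smul_mem _ (hu n)
  have hcoef : ∀ n, ‖((‖ev Λ (u n)‖⁻¹ : ℝ) : ℂ)‖ = ‖ev Λ (u n)‖⁻¹ := fun n => by
    rw [norm_real, Real.norm_of_nonneg (inv_pos.2 (hΛpos n)).le]
  have hΛv : ∀ n, ‖ev Λ (v n)‖ = 1 := fun n => by
    rw [hv, ev_smul _ (hΛ.compact.1 (hu n)), norm_smul, hcoef, inv_mul_cancel₀ (hΛpos n).ne']
  have hsum : ∀ n, ε * ‖ev A (v n)‖ + (n + 1) * ‖v n‖ ≤ 1 := fun n => by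
    have h1 : ‖ev A (v n)‖ = ‖ev Λ (u n)‖⁻¹ * ‖ev A (u n)‖ := by
      rw [hv, ev_smul _ (hu n), norm_smul, hcoef]
    have h2 : ‖v n‖ = ‖ev Λ (u n)‖⁻¹ * ‖u n‖ := by
      rw [hv, norm_smul, hcoef]
    have h3 : ε * ‖ev A (v n)‖ + (n + 1) * ‖v n‖ =
        (ε * ‖ev A (u n)‖ + (n + 1) * ‖u n‖) / ‖ev Λ (u n)‖ := by
      rw [h1, h2]; ring
    rw [h3, div_le_one (hΛpos n)]
    exact (hlt n).le
  have hvn : ∀ n : ℕ, ‖v n‖ ≤ 1 / ((n : ℝ) + 1) := fun n => by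
    rw [le_div_iff₀' (by positivity)]
    have : 0 ≤ ε * ‖ev A (v n)‖ := by positivity
    linarith [hsum n]
  have hv0 : Tendsto v atTop (𝓝 0) :=
    squeeze_zero_norm hvn tendsto_one_div_add_atTop_nhds_zero_nat
  have hbdd : ∃ M : ℝ, ∀ n, ‖v n‖ ≤ M ∧ ‖ev A (v n)‖ ≤ M := by
    refine ⟨max 1 (1 / ε), fun n => ⟨(hvn n).trans (le_max_of_le_left ?_),
      le_max_of_le_right ?_⟩⟩
    · rw [div_le_one (by positivity)]
      have : (0 : ℝ) ≤ n := Nat.cast_nonneg n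
      linarith
    · rw [le_div_iff₀' hε]
      have : 0 ≤ ((n : ℝ) + 1) * ‖v n‖ := by positivity
      linarith [hsum n]
  obtain ⟨w, k, hk, hw⟩ := hΛ.compact.2 v hvA hbdd
  have hmem : ((0 : X), w) ∈ Λ.graph :=
    (show IsClosed (Λ.graph : Set (X × X)) from hΛ.closed).mem_of_tendsto
      ((hv0.comp hk.tendsto_atTop).prodMk_nhds hw)
      (Eventually.of_forall fun n => ev_mem_graph (hΛ.compact.1 (hvA (k n))))
  have hw0 : w = 0 := Λ.graph_fst_eq_zero_snd hmem rfl
  have h1 : Tendsto (fun n => ‖ev Λ (v (k n))‖) atTop (𝓝 ‖w‖) := hw.norm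
  simp only [hΛv] at h1
  have h2 := tendsto_nhds_unique h1 tendsto_const_nhds
  rw [hw0, norm_zero] at h2
  exact zero_ne_one h2

lemma mem_L_domain (hΛ : AssumptionLambda A Λ) {α : ℝ} {u : X} :
    u ∈ (L A Λ α).domain ↔ u ∈ A.domain :=
  ⟨fun h => h.1, fun h => ⟨h, hΛ.compact.1 h⟩⟩

lemma ev_L (hΛ : AssumptionLambda A Λ) {α : ℝ} {u : X} (hu : u ∈ A.domain) :
    ev (L A Λ α) u = ev A u - (I * (α : ℂ)) • ev Λ u := by
  rw [ev_of_mem ((mem_L_domain hΛ).2 hu), ev_of_mem hu, ev_of_mem (hΛ.compact.1 hu)]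
  rfl

/-- The perturbed operator has a sectorial resolvent. -/
lemma exists_sectorial_resolvent (hA : AssumptionA A) (hΛ : AssumptionLambda A Λ) (α : ℝ) :
    ∃ (R : ℂ → X →L[ℂ] X) (γ₀ M : ℝ), IsSectorialResolvent R γ₀ M ∧
      IsResolventOf R (L A Λ α) γ₀ := by
  obtain ⟨C, hC, hbound⟩ := hΛ.relative_bound (ε := 1 / (12 * (|α| + 1))) (by positivity)
  -- Write `N = ‖(l - A) u‖`. With this `ε`, `‖A u‖ ≤ 3 N` contributes `N / 4` to `|α| ‖Λ u‖`; `8 C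
  -- (|α| + 1) ≤ ‖l‖` and `‖l‖ ‖u‖ ≤ 2 N` contribute another `N / 4`. The outer factor `2` is there
  -- because points of the wedge only satisfy `‖l‖ ≥ γ₀ / 2`.
  set γ₀ : ℝ := 2 * (8 * (C * (|α| + 1)) + 1) with hγ₀
  have hγpos : 0 < γ₀ := by positivity
  have hw0 : ∀ l ∈ wedge γ₀, l ∈ wedge 0 := fun l hl => hγpos.trans hl
  have hnl : ∀ l ∈ wedge γ₀, 8 * (C * (|α| + 1)) + 1 ≤ ‖l‖ := fun l hl => by
    have := le_norm_of_mem_wedge hγpos hl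
    rw [hγ₀] at this
    linarith
  have hpert : ∀ l ∈ wedge γ₀, ∀ u ∈ A.domain,
      ‖(I * (α : ℂ)) • ev Λ u‖ ≤ 1 / 2 * ‖l • u - ev A u‖ := by
    intro l hl u hu
    have h1 := hA.norm_le (hw0 l hl) hu
    have h2 := hA.norm_ev_le (hw0 l hl) hu
    have h3 := hbound u hu
    have h4 := hnl l hl
    rw [norm_smul, norm_mul, norm_I, one_mul, norm_real, Real.norm_eq_abs]
    set N := ‖l • u - ev A u‖
    have hα := abs_nonneg α
    have h5 : (|α| + 1) * ‖ev Λ u‖ ≤ 1 / 12 * ‖ev A u‖ + C * (|α| + 1) * ‖u‖ := by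
      refine (mul_le_mul_of_nonneg_left h3 (by positivity)).trans_eq ?_
      field_simp
    have h6 : 8 * (C * (|α| + 1)) * ‖u‖ ≤ 2 * N := by
      have : 8 * (C * (|α| + 1)) * ‖u‖ ≤ ‖l‖ * ‖u‖ :=
        mul_le_mul_of_nonneg_right (by linarith) (norm_nonneg u)
      linarith
    linarith [norm_nonneg (ev Λ u)]
  have hlow : ∀ l ∈ wedge γ₀, ∀ u ∈ (L A Λ α).domain,
      ‖l‖ / 4 * ‖u‖ ≤ ‖l • u - ev (L A Λ α) u‖ := by
    intro l hl u hu
    have huA := (mem_L_domain hΛ).1 hu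
    have h1 := hA.norm_le (hw0 l hl) huA
    have h2 := hpert l hl u huA
    rw [ev_L hΛ huA, sub_sub_eq_add_sub, add_sub_right_comm]
    have h3 := norm_sub_le (l • u - ev A u + (I * (α : ℂ)) • ev Λ u) ((I * (α : ℂ)) • ev Λ u)
    rw [add_sub_cancel_right] at h3
    linarith
  have hsurj : ∀ l ∈ wedge γ₀, ∀ f, ∃ u ∈ (L A Λ α).domain, l • u - ev (L A Λ α) u = f := by
    intro l hl f
    have hlpos : 0 < ‖l‖ / 2 := half_pos (norm_pos_iff.2 (ne_zero_of_mem_wedge hγpos hl))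
    have hconj : (starRingEnd ℂ) l ∈ wedge 0 := by
      have := hw0 l hl
      simpa [wedge] using this
    obtain ⟨RA, hRA1, hRA2, -⟩ := exists_resolvent (T := A) hlpos
      (fun u hu => hA.norm_le (hw0 l hl) hu)
      (surjective_sub hA.selfAdjoint hlpos (fun u hu => hA.norm_le (hw0 l hl) hu)
        (fun u hu => by
          have := hA.norm_le hconj hu
          rwa [norm_conj] at this))
    have hRAd : ∀ g, RA g ∈ A.domain := fun g => (mem_graph_iff_ev.1 (hRA1 g)).1
    have hRAe : ∀ g, l • RA g - ev A (RA g) = g := fun g => by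
      rw [(mem_graph_iff_ev.1 (hRA1 g)).2, sub_sub_cancel]
    -- Factor `l - L_α = (1 - K) (l - A)` with `K = -iα Λ (l - A)⁻¹` of norm at most `1 / 2`, and
    -- invert `1 - K` by a Neumann series.
    let K₀ : X →ₗ[ℂ] X :=
      { toFun := fun g => -((I * (α : ℂ)) • ev Λ (RA g))
        map_add' := fun x y => by
          rw [map_add, ev_add (hΛ.compact.1 (hRAd x)) (hΛ.compact.1 (hRAd y)), smul_add, neg_add]
        map_smul' := fun a x => by
          rw [map_smul, ev_smul a (hΛ.compact.1 (hRAd x)), smul_comm, ← smul_neg,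
            RingHom.id_apply] }
    have hK₀ : ∀ g, ‖K₀ g‖ ≤ 1 / 2 * ‖g‖ := fun g => by
      change ‖-((I * (α : ℂ)) • ev Λ (RA g))‖ ≤ _
      have := hpert l hl _ (hRAd g)
      rwa [hRAe, ← norm_neg] at this
    let K : X →L[ℂ] X := K₀.mkContinuous (1 / 2) hK₀
    have hK : ‖K‖ < 1 :=
      (K₀.mkContinuous_norm_le (by norm_num) hK₀).trans_lt (by norm_num)
    obtain ⟨W, hW⟩ := (isUnit_one_sub_of_norm_lt_one hK).exists_right_inv
    refine ⟨RA (W f), (mem_L_domain hΛ).2 (hRAd _), ?_⟩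
    have h1 := congrArg (fun B : X →L[ℂ] X => B f) hW
    change W f - -((I * (α : ℂ)) • ev Λ (RA (W f))) = f at h1
    rw [ev_L hΛ (hRAd _), sub_sub_eq_add_sub, add_sub_right_comm, hRAe]
    rwa [sub_neg_eq_add] at h1
  have hres : ∀ l : ℂ, ∃ R : X →L[ℂ] X, l ∈ wedge γ₀ →
      (∀ f, (R f, l • R f - f) ∈ (L A Λ α).graph) ∧
      (∀ u v, (u, v) ∈ (L A Λ α).graph → R (l • u - v) = u) ∧ ‖l‖ / 4 * ‖R‖ ≤ 1 := by
    intro l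
    by_cases hl : l ∈ wedge γ₀
    · have hlpos : 0 < ‖l‖ / 4 :=
        div_pos (norm_pos_iff.2 (ne_zero_of_mem_wedge hγpos hl)) four_pos
      obtain ⟨R, hR⟩ := exists_resolvent hlpos (hlow l hl) (hsurj l hl)
      exact ⟨R, fun _ => hR⟩
    · exact ⟨0, fun h => absurd h hl⟩
  choose R hR using hres
  have hRL : IsResolventOf R (L A Λ α) γ₀ :=
    ⟨fun m hm => (hR m hm).1, fun m hm => (hR m hm).2.1⟩
  exact ⟨R, γ₀, 4, ⟨hγpos, hRL.identity, fun l hl => by linarith [(hR l hl).2.2]⟩, hRL⟩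

/-- `L_α` generates an analytic semigroup, which is smooth in `t > 0`. -/
theorem exists_semigroup_L (hA : AssumptionA A) (hΛ : AssumptionLambda A Λ) (α : ℝ) :
    ∃ T : ℝ → X →L[ℂ] X, IsAnalyticSemigroup T ∧ IsGenerator (L A Λ α) T ∧
      (∀ f, ContDiffOn ℝ (⊤ : ℕ∞) (fun t => T t f) (Set.Ioi 0)) ∧
      (∀ f, ∀ t > 0, ∃ v, (T t f, v) ∈ (L A Λ α).graph ∧ HasDerivAt (fun t => T t f) v t) ∧
      ∃ (m : ℂ) (R : X →L[ℂ] X), (∀ f, (R f, m • R f - f) ∈ (L A Λ α).graph) ∧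
        ∀ u v, (u, v) ∈ (L A Λ α).graph → R (m • u - v) = u := by
  obtain ⟨R, γ₀, M, hR, hRL⟩ := exists_sectorial_resolvent hA hΛ α
  have hd : Dense ((L A Λ α).domain : Set X) := by
    refine hA.selfAdjoint.dense_domain.mono fun u hu => ?_
    exact (mem_L_domain hΛ).2 hu
  obtain ⟨T, h1, h2, h3, h4⟩ := hR.exists_semigroup hRL hd
  have hm := ofReal_mem_wedge (lt_add_one γ₀)
  exact ⟨T, h1, h2, h3, h4, _, _, hRL.mem_graph _ hm, hRL.apply_sub _ hm⟩

end Perturbation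

end AbstractDecay

end

open Filter Topology

noncomputable section

namespace AbstractDecay

open Complex

/-! ### The pseudospectral bound -/

lemma le_of_sq_le_mul_add {D k p n : ℝ} (hD : 1 ≤ D) (hk : 0 ≤ k) (hp : 0 ≤ p)
    (h : n ^ 2 ≤ D * (p ^ 2 + k * p * n)) : n ≤ D * (2 + k) * p := by
  refine abs_le_of_sq_le_sq' ?_ (by positivity) |>.2
  have h3 : D * (k * p * n) ≤ n ^ 2 / 2 + (D * k * p) ^ 2 / 2 := by
    linarith [sq_nonneg (n - D * k * p)]
  have h4 : D * p ^ 2 ≤ D ^ 2 * p ^ 2 :=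
    mul_le_mul_of_nonneg_right (le_self_pow₀ hD two_ne_zero) (sq_nonneg p)
  have h5 : 0 ≤ D ^ 2 * p ^ 2 * k := by positivity
  have h6 : 0 ≤ D ^ 2 * p ^ 2 := by positivity
  linarith

/-- Both terms linear in `G` are absorbed by Young's inequality, at the cost of `G² / 4` each. -/
lemma sq_le_of_sq_le_mul_add {e G s x y z : ℝ} (he : 1 ≤ e) (hz : 0 ≤ z)
    (h : G ^ 2 ≤ x * G + e ^ 2 * s * (y * G + z * s)) :
    G ^ 2 ≤ 2 * e ^ 4 * (x ^ 2 + (y ^ 2 + z) * s ^ 2) := by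
  have h4 : x * G ≤ x ^ 2 + G ^ 2 / 4 := by linarith [sq_nonneg (x - G / 2)]
  have h5 : e ^ 2 * s * (y * G) ≤ e ^ 4 * (y ^ 2 * s ^ 2) + G ^ 2 / 4 := by
    linarith [sq_nonneg (e ^ 2 * s * y - G / 2)]
  have h6 : e ^ 2 * (z * s ^ 2) ≤ e ^ 4 * (z * s ^ 2) :=
    mul_le_mul_of_nonneg_right (pow_le_pow_right₀ he (by norm_num)) (by positivity)
  have h7 : x ^ 2 ≤ e ^ 4 * x ^ 2 := le_mul_of_one_le_left (sq_nonneg _) (one_le_pow₀ he)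
  linarith

/-- The numerical core, with `n = ‖w‖`, `f = ‖g‖`, `G = ‖ℚ(μ - Λ) w‖`, `s = ‖(-A)^(1/2) w‖`, `β =
‖B₃ w‖`, `a = |α|`. Eliminate `β` by `H4`, solve `H2` for `G²`, insert it into `H3`, and replace
`s²` by `H1`. What is left is `n² ≲ Φ² f² + Φ f n`, a quadratic inequality for `n`, where `Φ` is the
expression minimized in `F(α, μ)`. -/
lemma pseudospectral_real {c c' b a n f G s β ξ₁ ξ₂ h₁ h₂ : ℝ} (hc : 0 < c) (hc' : 0 < c')
    (hb : 0 ≤ b) (ha : 0 < a) (hf : 0 ≤ f) (hG : 0 ≤ G) (hs : 0 ≤ s) (hβ : 0 ≤ β)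
    (hξ₁ : 0 < ξ₁) (hξ₂ : 0 < ξ₂) (hh₂ : 0 ≤ h₂)
    (H1 : c * s ^ 2 ≤ b * f * n) (H2 : a * G ^ 2 ≤ f * G + c' * s * β)
    (H3 : n ^ 2 ≤ c' * (ξ₁ ^ 2 * G ^ 2 + h₁ ^ 2 * s ^ 2))
    (H4 : β ^ 2 ≤ c' * (ξ₂ ^ 2 * G ^ 2 + h₂ ^ 2 * s ^ 2)) :
    n ≤ 2 * (1 + c') ^ 5 * (2 + b / c) *
      (ξ₁ / a + ξ₁ ^ 2 * ξ₂ ^ 2 / a ^ 2 + ξ₁ ^ 2 * h₂ / a + h₁ ^ 2) * f := by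
  obtain ⟨e, he⟩ : ∃ e, e = 1 + c' := ⟨_, rfl⟩
  have he1 : 1 ≤ e := by linarith
  have hce : c' ≤ e := by linarith
  have hβ' : β ≤ e * (ξ₂ * G + h₂ * s) := by
    refine abs_le_of_sq_le_sq' ?_ (by positivity) |>.2
    have h1 : 0 ≤ ξ₂ * G * (h₂ * s) := by positivity
    have h2 : ξ₂ ^ 2 * G ^ 2 + h₂ ^ 2 * s ^ 2 ≤ (ξ₂ * G + h₂ * s) ^ 2 := by linarith
    have h3 : c' ≤ e ^ 2 := hce.trans (le_self_pow₀ he1 two_ne_zero)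
    rw [mul_pow]
    exact H4.trans (mul_le_mul h3 h2 (by positivity) (by positivity))
  have hG2 : G ^ 2 ≤ 2 * e ^ 4 * ((f / a) ^ 2 + (ξ₂ ^ 2 / a ^ 2 + h₂ / a) * s ^ 2) := by
    obtain ⟨x, hx⟩ : ∃ x, x = f / a := ⟨_, rfl⟩
    obtain ⟨y, hy⟩ : ∃ y, y = ξ₂ / a := ⟨_, rfl⟩
    obtain ⟨z, hz⟩ : ∃ z, z = h₂ / a := ⟨_, rfl⟩
    have hx0 : 0 ≤ x := by rw [hx]; positivity
    have hy0 : 0 ≤ y := by rw [hy]; positivity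
    have hz0 : 0 ≤ z := by rw [hz]; positivity
    rw [← div_pow, ← hx, ← hy, ← hz]
    have h1 : c' * s * β ≤ e * s * (e * (ξ₂ * G + h₂ * s)) :=
      mul_le_mul (mul_le_mul_of_nonneg_right hce hs) hβ' hβ (by positivity)
    have h2 : G ^ 2 ≤ x * G + e ^ 2 * s * (y * G + z * s) := by
      have h3 : a * (x * G + e ^ 2 * s * (y * G + z * s)) =
          f * G + e * s * (e * (ξ₂ * G + h₂ * s)) := by
        rw [hx, hy, hz]; field_simp
      refine le_of_mul_le_mul_left ?_ ha
      rw [h3]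
      linarith
    exact sq_le_of_sq_le_mul_add he1 hz0 h2
  obtain ⟨Φ, hΦ⟩ : ∃ Φ, Φ = ξ₁ / a + ξ₁ ^ 2 * ξ₂ ^ 2 / a ^ 2 + ξ₁ ^ 2 * h₂ / a + h₁ ^ 2 :=
    ⟨_, rfl⟩
  obtain ⟨k, hk⟩ : ∃ k, k = b / c := ⟨_, rfl⟩
  have hk0 : 0 ≤ k := by rw [hk]; positivity
  rw [← hΦ, ← he, ← hk]
  have hΦ1 : ξ₁ / a ≤ Φ := by
    have : 0 ≤ ξ₁ ^ 2 * ξ₂ ^ 2 / a ^ 2 + ξ₁ ^ 2 * h₂ / a + h₁ ^ 2 := by positivity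
    linarith
  have hΦ2 : ξ₁ ^ 2 * ξ₂ ^ 2 / a ^ 2 + ξ₁ ^ 2 * h₂ / a + h₁ ^ 2 ≤ Φ := by
    have : 0 ≤ ξ₁ / a := by positivity
    linarith
  have hΦ0 : 0 ≤ Φ := le_trans (by positivity) hΦ1
  have hs2 : s ^ 2 ≤ k * f * n := by
    rw [hk, div_mul_eq_mul_div, div_mul_eq_mul_div, le_div_iff₀' hc]
    exact H1
  have hn2 : n ^ 2 ≤ 2 * e ^ 5 * (Φ ^ 2 * f ^ 2 + Φ * (k * f * n)) := by
    have h1 : ξ₁ ^ 2 * G ^ 2 + h₁ ^ 2 * s ^ 2 ≤ 2 * e ^ 4 * ((ξ₁ / a) ^ 2 * f ^ 2 +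
        (ξ₁ ^ 2 * ξ₂ ^ 2 / a ^ 2 + ξ₁ ^ 2 * h₂ / a + h₁ ^ 2) * s ^ 2) := by
      have h2 := mul_le_mul_of_nonneg_left hG2 (sq_nonneg ξ₁)
      have h3 : h₁ ^ 2 * s ^ 2 ≤ 2 * e ^ 4 * (h₁ ^ 2 * s ^ 2) :=
        le_mul_of_one_le_left (by positivity) (by linarith [one_le_pow₀ he1 (n := 4)])
      refine (add_le_add h2 h3).trans_eq ?_
      ring
    have h4 : (ξ₁ / a) ^ 2 * f ^ 2 ≤ Φ ^ 2 * f ^ 2 :=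
      mul_le_mul_of_nonneg_right (pow_le_pow_left₀ (by positivity) hΦ1 2) (sq_nonneg f)
    have h5 : (ξ₁ ^ 2 * ξ₂ ^ 2 / a ^ 2 + ξ₁ ^ 2 * h₂ / a + h₁ ^ 2) * s ^ 2 ≤ Φ * (k * f * n) :=
      mul_le_mul hΦ2 hs2 (sq_nonneg s) hΦ0
    calc n ^ 2 ≤ c' * (ξ₁ ^ 2 * G ^ 2 + h₁ ^ 2 * s ^ 2) := H3
      _ ≤ e * (2 * e ^ 4 * (Φ ^ 2 * f ^ 2 + Φ * (k * f * n))) := by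
        refine mul_le_mul hce (h1.trans ?_) (by positivity) (by positivity)
        exact mul_le_mul_of_nonneg_left (add_le_add h4 h5) (by positivity)
      _ = _ := by ring
  obtain ⟨D, hD⟩ : ∃ D, D = 2 * e ^ 5 := ⟨_, rfl⟩
  have hD1 : 1 ≤ D := by
    have := one_le_pow₀ he1 (n := 5)
    linarith
  rw [← hD] at hn2 ⊢
  rw [mul_assoc]
  refine le_of_sq_le_mul_add hD1 hk0 (mul_nonneg hΦ0 hf) (hn2.trans_eq ?_)
  ring

/-! ### Finiteness and positivity of the rate. -/

section Rate

variable {h₁ h₂ : ℝ → ℝ → ℝ}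

lemma rate_integrand_nonneg (h₂_nonneg : ∀ ξ > 0, ∀ μ, 0 ≤ h₂ ξ μ) (α μ : ℝ)
    (ξ : Set.Ioi (0 : ℝ) × Set.Ioi (0 : ℝ)) :
    0 ≤ (ξ.1 : ℝ) / |α| + (ξ.1 : ℝ) ^ 2 * (ξ.2 : ℝ) ^ 2 / α ^ 2
      + (ξ.1 : ℝ) ^ 2 * h₂ ξ.2 μ / |α| + h₁ ξ.1 μ ^ 2 := by
  have h1 : 0 < (ξ.1 : ℝ) := ξ.1.2
  have h2 := h₂_nonneg ξ.2 ξ.2.2 μ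
  positivity

lemma rateAt_nonneg (hh₂ : AdmissibleFunction h₂) (α μ : ℝ) : 0 ≤ rateAt h₁ h₂ α μ :=
  Real.iInf_nonneg (rate_integrand_nonneg hh₂.nonneg α μ)

/-- A real supremum is meaningful only for a bounded family; the choice `ξ₁ = ξ₂ = 1` and the bounds
on `h₁`, `h₂` give a bound uniform in `μ`. -/
lemma rateAt_le_rate (hh₁ : AdmissibleFunction h₁) (hh₂ : AdmissibleFunction h₂) (α μ : ℝ) :
    rateAt h₁ h₂ α μ ≤ rate h₁ h₂ α := by
  obtain ⟨M₁, hM₁⟩ := hh₁.bounded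
  obtain ⟨M₂, hM₂⟩ := hh₂.bounded
  refine le_ciSup (f := fun μ => rateAt h₁ h₂ α μ)
    ⟨1 / |α| + 1 ^ 2 * 1 ^ 2 / α ^ 2 + 1 ^ 2 * M₂ / |α| + M₁ ^ 2, ?_⟩ μ
  rintro _ ⟨ν, rfl⟩
  have one : (0 : ℝ) < 1 := one_pos
  refine (ciInf_le ⟨0, ?_⟩ ((⟨1, one⟩, ⟨1, one⟩) : Set.Ioi (0 : ℝ) × Set.Ioi (0 : ℝ))).trans ?_
  · rintro _ ⟨ξ, rfl⟩
    exact rate_integrand_nonneg hh₂.nonneg α ν ξ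
  · have h1 := pow_le_pow_left₀ (hh₁.nonneg 1 one ν) (hM₁ 1 one ν) 2
    have h2 := hM₂ 1 one ν
    dsimp only
    gcongr

lemma rate_nonneg (hh₁ : AdmissibleFunction h₁) (hh₂ : AdmissibleFunction h₂) (α : ℝ) :
    0 ≤ rate h₁ h₂ α :=
  (rateAt_nonneg hh₂ α 0).trans (rateAt_le_rate hh₁ hh₂ α 0)

end Rate

/-! ### Algebra of `ℚ`, `Λ` and `B₂`, and the resolvent estimate. -/

section Structure

lemma mem_kernel_iff {X : Type*} [NormedAddCommGroup X] [InnerProductSpace ℂ X]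
    {Λ : X →ₗ.[ℂ] X} {u : X} : u ∈ kernel Λ ↔ u ∈ Λ.domain ∧ ev Λ u = 0 := by
  rw [kernel, Submodule.mem_map]
  constructor
  · rintro ⟨y, hy, rfl⟩
    exact ⟨y.2, (ev_of_mem y.2).trans hy⟩
  · rintro ⟨h, h0⟩
    rw [ev_of_mem h] at h0
    exact ⟨⟨u, h⟩, h0, rfl⟩

variable {X : Type*} [NormedAddCommGroup X] [InnerProductSpace ℂ X] [CompleteSpace X]
  {H : Type*} [NormedAddCommGroup H] [InnerProductSpace ℂ H]
  {A Λ : X →ₗ.[ℂ] X} {J : X →ₗᵢ[ℂ] H} {B₁ : H →ₗ.[ℂ] H} {B₂ : X →L[ℂ] X} {c : ℝ}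

lemma Q_mem (u : X) : Q Λ u ∈ Y Λ := (Y Λ).starProjection_apply_mem u

lemma Q_eq_self {u : X} (hu : u ∈ Y Λ) : Q Λ u = u := (Y Λ).starProjection_eq_self_iff.2 hu

lemma inner_Q_left (u v : X) : inner ℂ (Q Λ u) v = inner ℂ u (Q Λ v) :=
  (Y Λ).inner_starProjection_left_eq_right u v

lemma inner_Q_left_of_mem (u : X) {v : X} (hv : v ∈ Y Λ) :
    inner ℂ (Q Λ u) v = inner ℂ u v := by
  rw [inner_Q_left, Q_eq_self hv]

namespace AssumptionFactor

lemma inner_B₂_symm (hF : AssumptionFactor A Λ J B₁ B₂ c) (u v : X) :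
    inner ℂ (B₂ u) v = inner ℂ u (B₂ v) :=
  hF.selfAdjoint.isSymmetric u v

/-- The range of the self-adjoint `B₂` is orthogonal to its kernel, which is `N(Λ)`. -/
lemma B₂_mem (hF : AssumptionFactor A Λ J B₁ B₂ c) (u : X) : B₂ u ∈ Y Λ := by
  rw [Y, Submodule.mem_orthogonal]
  intro k hk
  rw [hF.ker_eq] at hk
  rw [← hF.inner_B₂_symm, show B₂ k = 0 from hk, inner_zero_left]

/-- As the kernel of the bounded operator `B₂`, `N(Λ)` is closed, so it equals its double orthogonal
complement. -/
lemma sub_Q_mem (hF : AssumptionFactor A Λ J B₁ B₂ c) (u : X) : u - Q Λ u ∈ kernel Λ := by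
  have h : u - Q Λ u ∈ (Y Λ)ᗮ := (Y Λ).sub_starProjection_mem_orthogonal u
  have hcl : IsClosed ((kernel Λ : Submodule ℂ X) : Set X) := by
    rw [hF.ker_eq]
    exact B₂.isClosed_ker
  rwa [Y, Submodule.orthogonal_orthogonal_eq_closure, hcl.submodule_topologicalClosure_eq] at h

lemma B₂_Q (hF : AssumptionFactor A Λ J B₁ B₂ c) (u : X) : B₂ (Q Λ u) = B₂ u := by
  have h := hF.sub_Q_mem u
  rw [hF.ker_eq] at h
  have h0 : B₂ (u - Q Λ u) = 0 := h
  rw [map_sub, sub_eq_zero] at h0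
  exact h0.symm

lemma ev_Q (hF : AssumptionFactor A Λ J B₁ B₂ c) {u : X} (hu : u ∈ Λ.domain) :
    ev Λ (Q Λ u) = ev Λ u := by
  obtain ⟨h1, h2⟩ := mem_kernel_iff.1 (hF.sub_Q_mem u)
  have h3 := ev_sub hu h1
  rwa [sub_sub_cancel, h2, sub_zero] at h3

/-- `ℚ L_α = A ℚ - i α ℚ Λ ℚ`. -/
lemma Q_ev_L (hΛ : AssumptionLambda A Λ) (hF : AssumptionFactor A Λ J B₁ B₂ c) {α : ℝ} {u : X}
    (hu : u ∈ A.domain) :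
    Q Λ (ev (L A Λ α) u) = ev A (Q Λ u) - (I * (α : ℂ)) • Q Λ (ev Λ (Q Λ u)) := by
  rw [ev_L hΛ hu, map_sub, map_smul, (hΛ.comm u hu).2, hF.ev_Q (hΛ.compact.1 hu)]

lemma inner_B₂_im (hF : AssumptionFactor A Λ J B₁ B₂ c) (u : X) : (inner ℂ u (B₂ u)).im = 0 := by
  rw [← conj_eq_iff_im, inner_conj_symm]
  exact hF.inner_B₂_symm u u

/-- Since `Λ u = B₁ B₂ u`, this is the quadratic form of the symmetric `B₁` at `B₂ u`, hence real.
This is why `-iαΛ` is invisible to the energy. -/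
lemma inner_ev_B₂_im (hF : AssumptionFactor A Λ J B₁ B₂ c) {u : X} (hu : u ∈ Λ.domain) :
    (inner ℂ (ev Λ u) (B₂ u)).im = 0 := by
  obtain ⟨h1, h2⟩ := hF.factor u hu
  rw [← J.inner_map_map, ← h2, ev_of_mem h1, ← conj_eq_iff_im, inner_conj_symm]
  exact (hF.symmetric ⟨_, h1⟩ ⟨_, h1⟩).symm

/-- Coercivity of `i l - ℚ L_α` on `𝒴` with respect to the form `(·, B₂ ·)`. -/
lemma coercive_sub (hΛ : AssumptionLambda A Λ) (hF : AssumptionFactor A Λ J B₁ B₂ c) (α l : ℝ)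
    {w : X} (hw : w ∈ A.domain) (hwY : w ∈ Y Λ) :
    c * ‖ev (posSqrt (-A)) w‖ ^ 2 ≤ (inner ℂ ((I * (l : ℂ)) • w -
      (ev A w - (I * (α : ℂ)) • Q Λ (ev Λ w))) (B₂ w)).re := by
  refine (hF.coercive_A w hw hwY).trans_eq ?_
  have hI : ∀ (x : ℝ) (z : ℂ), z.im = 0 → ((starRingEnd ℂ) (I * (x : ℂ)) * z).re = 0 := by
    intro x z hz
    simp [hz]
  rw [inner_sub_left, inner_sub_left, inner_smul_left, inner_smul_left,
    inner_Q_left_of_mem _ (hF.B₂_mem w), sub_re, sub_re, hI l _ (hF.inner_B₂_im w),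
    hI α _ (hF.inner_ev_B₂_im (hΛ.compact.1 hw)), inner_neg_left, neg_re]
  ring

/-- The generator is dissipative with respect to the form `(·, B₂ ·)`. -/
lemma dissipative (hΛ : AssumptionLambda A Λ) (hF : AssumptionFactor A Λ J B₁ B₂ c) (hc : 0 < c)
    {α : ℝ} {u v : X} (huv : (u, v) ∈ (L A Λ α).graph) : (inner ℂ v (B₂ u)).re ≤ 0 := by
  obtain ⟨hu, rfl⟩ := mem_graph_iff_ev.1 huv
  have huA := (mem_L_domain hΛ).1 hu
  have h := hF.coercive_sub hΛ α 0 (hΛ.comm u huA).1 (Q_mem u)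
  rw [← hF.Q_ev_L hΛ huA, hF.B₂_Q, ofReal_zero, mul_zero, zero_smul, zero_sub, inner_neg_left,
    neg_re, inner_Q_left_of_mem _ (hF.B₂_mem u)] at h
  have : 0 ≤ c * ‖ev (posSqrt (-A)) (Q Λ u)‖ ^ 2 := by positivity
  linarith

end AssumptionFactor

variable {B : Type*} [NormedAddCommGroup B] [NormedSpace ℂ B] {h₁ h₂ : ℝ → ℝ → ℝ}
  {ι : X →ₗ[ℂ] B} {B₃ : B →ₗ.[ℂ] B} {c' : ℝ}

/-- The constant in the pseudospectral bound. -/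
def pseudoConst (b c c' : ℝ) : ℝ := 2 * (1 + c') ^ 5 * (2 + b / c)

lemma pseudoConst_pos {b c c' : ℝ} (hb : 0 ≤ b) (hc : 0 < c) (hc' : 0 < c') :
    0 < pseudoConst b c c' := by
  unfold pseudoConst
  positivity

/-- The pseudospectral bound for `ℚ L_α` on `𝒴`. -/
lemma pseudospectral_bound (hA : AssumptionA A) (hΛ : AssumptionLambda A Λ)
    (hF : AssumptionFactor A Λ J B₁ B₂ c) (hE : AssumptionEstimate A Λ h₁ h₂ ι B₃ c')
    (hc : 0 < c) (hc' : 0 < c') {α : ℝ} (hα : α ≠ 0) (l : ℝ) {w : X} (hw : w ∈ A.domain)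
    (hwY : w ∈ Y Λ) :
    ‖w‖ ≤ pseudoConst ‖B₂‖ c c' * rate h₁ h₂ α *
      ‖(I * (l : ℂ)) • w - (ev A w - (I * (α : ℂ)) • Q Λ (ev Λ w))‖ := by
  set g := (I * (l : ℂ)) • w - (ev A w - (I * (α : ℂ)) • Q Λ (ev Λ w)) with hg
  -- Chosen so that `il + iα ℚΛ = -iα ℚ(μ - Λ)` on `𝒴`; the equation becomes `g = -A w - iα G`.
  set μ : ℝ := -(l / α) with hμ
  set G := Q Λ ((μ : ℂ) • w - ev Λ w) with hG
  have hαpos : 0 < |α| := abs_pos.2 hα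
  have hAY : Q Λ (ev A w) = ev A w := by
    have := (hΛ.comm w hw).2
    rw [Q_eq_self hwY] at this
    exact this.symm
  have hgG : g = -ev A w - (I * (α : ℂ)) • G := by
    have h1 : (I * (α : ℂ)) * (μ : ℂ) = -(I * (l : ℂ)) := by
      rw [hμ]
      push_cast
      have : (α : ℂ) ≠ 0 := ofReal_ne_zero.2 hα
      field_simp
    rw [hg, hG, map_sub, map_smul, Q_eq_self hwY, smul_sub, smul_smul, h1, neg_smul]
    abel
  have H1 : c * ‖ev (posSqrt (-A)) w‖ ^ 2 ≤ ‖B₂‖ * ‖g‖ * ‖w‖ := by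
    refine (hF.coercive_sub hΛ α l hw hwY).trans ((re_le_norm _).trans ?_)
    refine (norm_inner_le_norm _ _).trans ?_
    have := B₂.le_opNorm w
    nlinarith [norm_nonneg g]
  have H2 : |α| * ‖G‖ ^ 2 ≤ ‖g‖ * ‖G‖ +
      c' * ‖ev (posSqrt (-A)) w‖ * ‖ev B₃ (ι w)‖ := by
    have h1 : (inner ℂ (ev A w) G).im = -(inner ℂ (ev A w) (ev Λ w)).im := by
      rw [hG, ← inner_Q_left, hAY, inner_sub_right, inner_smul_right, sub_im, im_ofReal_mul,
        (hA.re_inner_nonpos hw).2]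
      ring
    -- Pairing with `G` isolates `α ‖G‖²` in the imaginary part. As `(A w, w)` is real, the `μ w`
    -- part of `G` drops out and only `Im (A w, Λ w)` remains.
    have h2 : (inner ℂ g G).im = (inner ℂ (ev A w) (ev Λ w)).im + α * ‖G‖ ^ 2 := by
      rw [hgG, inner_sub_left, inner_neg_left, inner_smul_left, inner_self_eq_norm_sq_to_K,
        sub_im, neg_im, h1]
      simp [← ofReal_pow]
    have h3 : |(inner ℂ g G).im| ≤ ‖g‖ * ‖G‖ :=
      (abs_im_le_norm _).trans (norm_inner_le_norm _ _)
    have h4 := hE.est_im w hw hwY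
    have h5 : α * ‖G‖ ^ 2 = (inner ℂ g G).im - (inner ℂ (ev A w) (ev Λ w)).im := by linarith
    calc |α| * ‖G‖ ^ 2 = |α * ‖G‖ ^ 2| := by rw [abs_mul, abs_of_nonneg (sq_nonneg ‖G‖)]
      _ ≤ |(inner ℂ g G).im| + |(inner ℂ (ev A w) (ev Λ w)).im| := by
        rw [h5]
        exact abs_sub _ _
      _ ≤ _ := add_le_add h3 h4
  have hK := pseudoConst_pos (norm_nonneg B₂) hc hc'
  have hall : ∀ ξ : Set.Ioi (0 : ℝ) × Set.Ioi (0 : ℝ), ‖w‖ ≤ pseudoConst ‖B₂‖ c c' *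
      ((ξ.1 : ℝ) / |α| + (ξ.1 : ℝ) ^ 2 * (ξ.2 : ℝ) ^ 2 / α ^ 2
        + (ξ.1 : ℝ) ^ 2 * h₂ ξ.2 μ / |α| + h₁ ξ.1 μ ^ 2) * ‖g‖ := by
    intro ξ
    have h := pseudospectral_real hc hc' (norm_nonneg B₂) hαpos (norm_nonneg g)
      (norm_nonneg G) (norm_nonneg (ev (posSqrt (-A)) w)) (norm_nonneg (ev B₃ (ι w))) ξ.1.2 ξ.2.2
      (hE.h₂_adm.nonneg ξ.2 ξ.2.2 μ) H1 H2 (hE.est_u ξ.1 ξ.1.2 μ w hw hwY)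
      (hE.est_B₃ ξ.2 ξ.2.2 μ w hw hwY)
    rwa [sq_abs] at h
  have hAt : ‖w‖ ≤ pseudoConst ‖B₂‖ c c' * rateAt h₁ h₂ α μ * ‖g‖ := by
    -- Passing to the infimum over `ξ` requires division by `‖g‖`; if `g = 0`, any single `ξ`
    -- already gives `w = 0`.
    rcases (norm_nonneg g).eq_or_lt with h0 | h0
    · have one : (0 : ℝ) < 1 := one_pos
      have := hall (⟨1, one⟩, ⟨1, one⟩)
      rw [← h0, mul_zero] at this ⊢
      exact this
    · have : Nonempty (Set.Ioi (0 : ℝ) × Set.Ioi (0 : ℝ)) :=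
        ⟨(⟨1, one_pos (α := ℝ)⟩, ⟨1, one_pos (α := ℝ)⟩)⟩
      have h1 : ‖w‖ / (pseudoConst ‖B₂‖ c c' * ‖g‖) ≤ rateAt h₁ h₂ α μ := by
        refine le_ciInf fun ξ => ?_
        rw [div_le_iff₀ (by positivity)]
        exact (hall ξ).trans_eq (by ring)
      rw [div_le_iff₀ (by positivity)] at h1
      exact h1.trans_eq (by ring)
  refine hAt.trans ?_
  have := rateAt_le_rate hE.h₁_adm hE.h₂_adm α μ
  gcongr

end Structure

end AbstractDecay

end

open Filter Topology

noncomputable section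

namespace AbstractDecay

open Complex MeasureTheory FourierTransform

/-! ### Weighted `L²` estimates via Plancherel's theorem -/

section Fourier

variable {X : Type*} [NormedAddCommGroup X] [InnerProductSpace ℂ X]

lemma fourier_sub_apply {f g : ℝ → X} (hf : Integrable f) (hg : Integrable g) (x : ℝ) :
    𝓕 (fun t => f t - g t) x = 𝓕 f x - 𝓕 g x := by
  simp only [Real.fourier_eq, smul_sub]
  exact integral_sub ((Real.fourierIntegral_convergent_iff x).2 hf)
    ((Real.fourierIntegral_convergent_iff x).2 hg)

/-- The solution is known to be smooth only for `t > 0`; a cutoff supported there makes the product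
smooth on the whole line. -/
lemma contDiff_smul_of_tsupport_subset {χ : ℝ → ℝ} {u : ℝ → X} (hχ : ContDiff ℝ (⊤ : ℕ∞) χ)
    (hs : tsupport χ ⊆ Set.Ioi 0) (hu : ContDiffOn ℝ (⊤ : ℕ∞) u (Set.Ioi 0)) :
    ContDiff ℝ (⊤ : ℕ∞) fun t => χ t • u t := by
  rw [contDiff_iff_contDiffAt]
  intro t
  by_cases ht : t ∈ Set.Ioi (0 : ℝ)
  · exact hχ.contDiffAt.smul (hu.contDiffAt (isOpen_Ioi.mem_nhds ht))
  · have h0 : χ =ᶠ[𝓝 t] 0 := notMem_tsupport_iff_eventuallyEq.1 fun h => ht (hs h)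
    refine (contDiffAt_const (c := (0 : X))).congr_of_eventuallyEq ?_
    filter_upwards [h0] with x hx
    simp [hx]

lemma integrable_norm_sq_of_schwartz (f : SchwartzMap ℝ X) :
    Integrable fun x => ‖f x‖ ^ 2 :=
  (memLp_two_iff_integrable_sq_norm f.continuous.aestronglyMeasurable).1 (f.memLp 2)

variable [CompleteSpace X]

lemma fourier_clm_comp (B : X →L[ℂ] X) {f : ℝ → X} (hf : Integrable f) (x : ℝ) :
    𝓕 (fun t => B (f t)) x = B (𝓕 f x) := by
  rw [Real.fourier_eq, Real.fourier_eq, ← B.integral_comp_comm]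
  · simp only [Circle.smul_def, map_smul]
  · exact (Real.fourierIntegral_convergent_iff x).2 hf

/-- Plancherel comparison: a pointwise bound of Fourier transforms gives an `L²` bound. -/
lemma integral_norm_sq_le_of_fourier {v g : ℝ → X} (hv : HasCompactSupport v)
    (hv' : ContDiff ℝ (⊤ : ℕ∞) v) (hg : HasCompactSupport g) (hg' : ContDiff ℝ (⊤ : ℕ∞) g) {M : ℝ}
    (h : ∀ x, ‖𝓕 v x‖ ≤ M * ‖𝓕 g x‖) : ∫ t, ‖v t‖ ^ 2 ≤ M ^ 2 * ∫ t, ‖g t‖ ^ 2 := by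
  change ∫ x, ‖(hv.toSchwartzMap hv') x‖ ^ 2 ≤ M ^ 2 * ∫ x, ‖(hg.toSchwartzMap hg') x‖ ^ 2
  rw [← (hv.toSchwartzMap hv').integral_norm_sq_fourier,
    ← (hg.toSchwartzMap hg').integral_norm_sq_fourier, ← integral_const_mul]
  refine integral_mono (integrable_norm_sq_of_schwartz _)
    ((integrable_norm_sq_of_schwartz _).const_mul _) fun x => ?_
  change ‖𝓕 v x‖ ^ 2 ≤ M ^ 2 * ‖𝓕 g x‖ ^ 2
  rw [← mul_pow]
  exact pow_le_pow_left₀ (norm_nonneg _) (h x) 2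

end Fourier

/-! ### From the resolvent bound to a time-cutoff estimate. -/

section Gearhart

variable {X : Type*} [NormedAddCommGroup X] [InnerProductSpace ℂ X] [CompleteSpace X]

/-- A resolvent bound along the imaginary axis, seen through the projection `P`, gives a weighted
`L²` bound for solutions of `u' = L u`. -/
lemma integral_cutoff_le {L : X →ₗ.[ℂ] X} {m : ℂ} {R : X →L[ℂ] X}
    (hR1 : ∀ f, (R f, m • R f - f) ∈ L.graph)
    (hR2 : ∀ u v, (u, v) ∈ L.graph → R (m • u - v) = u) (P : X →L[ℂ] X) {M : ℝ}
    (hM : ∀ (l : ℝ) (u v : X), (u, v) ∈ L.graph → ‖P u‖ ≤ M * ‖P ((I * (l : ℂ)) • u - v)‖)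
    {u : ℝ → X} (hu : ContDiffOn ℝ (⊤ : ℕ∞) u (Set.Ioi 0))
    (hu' : ∀ t > 0, ∃ v, (u t, v) ∈ L.graph ∧ HasDerivAt u v t) {χ : ℝ → ℝ}
    (hχ : ContDiff ℝ (⊤ : ℕ∞) χ) (hχc : HasCompactSupport χ) (hs : tsupport χ ⊆ Set.Ioi 0) :
    ∫ t, ‖P (χ t • u t)‖ ^ 2 ≤ M ^ 2 * ∫ t, ‖P (deriv χ t • u t)‖ ^ 2 := by
  set v : ℝ → X := fun t => χ t • u t with hvdef
  set g : ℝ → X := fun t => deriv χ t • u t with hgdef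
  have hχ' : ContDiff ℝ (⊤ : ℕ∞) (deriv χ) := (contDiff_infty_iff_deriv.1 hχ).2
  have hs' : tsupport (deriv χ) ⊆ Set.Ioi 0 := (tsupport_deriv_subset).trans hs
  have hv : ContDiff ℝ (⊤ : ℕ∞) v := contDiff_smul_of_tsupport_subset hχ hs hu
  have hg : ContDiff ℝ (⊤ : ℕ∞) g := contDiff_smul_of_tsupport_subset hχ' hs' hu
  have hvc : HasCompactSupport v := hχc.smul_right
  have hgc : HasCompactSupport g := hχc.deriv.smul_right
  have hvi : Integrable v := hv.continuous.integrable_of_hasCompactSupport hvc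
  have hgi : Integrable g := hg.continuous.integrable_of_hasCompactSupport hgc
  have hvd : Continuous (deriv v) := hv.continuous_deriv (by simp)
  have hvdi : Integrable (deriv v) := hvd.integrable_of_hasCompactSupport hvc.deriv
  -- The product rule: `v' = L v + g`. Where the cutoff vanishes identically, every term is zero.
  have hgraph : ∀ t, (v t, deriv v t - g t) ∈ L.graph := by
    intro t
    by_cases ht : t ∈ Set.Ioi (0 : ℝ)
    · obtain ⟨w, hw, hd⟩ := hu' t ht
      have h1 : HasDerivAt v (χ t • w + deriv χ t • u t) t :=
        ((contDiff_infty_iff_deriv.1 hχ).1 t).hasDerivAt.smul hd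
      rw [h1.deriv, hgdef, add_sub_cancel_right]
      have h2 := L.graph.smul_mem ((χ t : ℝ) : ℂ) hw
      exact h2
    · have h0 : χ =ᶠ[𝓝 t] 0 := notMem_tsupport_iff_eventuallyEq.1 fun h => ht (hs h)
      have h1 : v =ᶠ[𝓝 t] fun _ => 0 := by
        filter_upwards [h0] with x hx
        simp [hvdef, hx]
      have h2 : deriv v t = 0 := by rw [h1.deriv_eq, deriv_const]
      have h3 : g t = 0 := by
        have : deriv χ t = 0 := by rw [h0.deriv_eq]; simp
        simp [hgdef, this]
      have h4 : v t = 0 := h1.eq_of_nhds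
      rw [h2, h3, h4, sub_zero]
      exact L.graph.zero_mem
  have hmi : Integrable fun t => m • v t - (deriv v t - g t) := (hvi.smul m).sub (hvdi.sub hgi)
  -- The unbounded `L` is carried through the Fourier transform by writing `v = R (m v - L v)`: the
  -- bounded `R` commutes with the integral. The outcome is `(2πix - L) 𝓕 v = 𝓕 g`.
  have hfour : ∀ x : ℝ, (𝓕 v x, (I * ((2 * Real.pi * x : ℝ) : ℂ)) • 𝓕 v x - 𝓕 g x) ∈ L.graph := by
    intro x
    have h1 : v = fun t => R (m • v t - (deriv v t - g t)) :=
      funext fun t => (hR2 _ _ (hgraph t)).symm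
    have h2 : 𝓕 v x = R (𝓕 (fun t => m • v t - (deriv v t - g t)) x) := by
      rw [← fourier_clm_comp R hmi x, ← h1]
    have h3 : 𝓕 (fun t => m • v t - (deriv v t - g t)) x =
        m • 𝓕 v x - (𝓕 (deriv v) x - 𝓕 g x) := by
      rw [fourier_sub_apply (f := fun t => m • v t) (g := fun t => deriv v t - g t) (hvi.smul m)
        (hvdi.sub hgi), fourier_sub_apply hvdi hgi]
      congr 1
      exact fourier_clm_comp (m • ContinuousLinearMap.id ℂ X) hvi x
    have h4 : 𝓕 (deriv v) x = (I * ((2 * Real.pi * x : ℝ) : ℂ)) • 𝓕 v x := by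
      rw [Real.fourier_deriv hvi (hv.differentiable (by simp)) hvdi]
      push_cast
      congr 1
      ring
    rw [h3, h4] at h2
    have h5 := hR1 (m • 𝓕 v x - ((I * ((2 * Real.pi * x : ℝ) : ℂ)) • 𝓕 v x - 𝓕 g x))
    rw [← h2, sub_sub_cancel] at h5
    exact h5
  refine integral_norm_sq_le_of_fourier (v := fun t => P (v t)) (g := fun t => P (g t))
    (hvc.comp_left (map_zero P)) ((P.restrictScalars ℝ).contDiff.comp hv)
    (hgc.comp_left (map_zero P)) ((P.restrictScalars ℝ).contDiff.comp hg) fun x => ?_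
  rw [fourier_clm_comp P hvi, fourier_clm_comp P hgi]
  have := hM (2 * Real.pi * x) _ _ (hfour x)
  rwa [sub_sub_cancel] at this

end Gearhart

end AbstractDecay

end

open Filter Topology

noncomputable section

namespace AbstractDecay

open Complex MeasureTheory

/-! ### Exponential decay -/

/-- A fixed profile, rescaled later; its derivative bound `K` is an absolute constant, so it adds no
dependence to the final ones. -/
lemma exists_cutoff : ∃ (ψ : ℝ → ℝ) (K : ℝ), 0 < K ∧ ContDiff ℝ (⊤ : ℕ∞) ψ ∧
    (∀ t ∈ Set.Icc (2 : ℝ) 4, ψ t = 1) ∧ (∀ t ∉ Set.Icc (1 : ℝ) 5, ψ t = 0) ∧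
    (∀ t ∉ Set.Icc (1 : ℝ) 5, deriv ψ t = 0) ∧ ∀ t, |deriv ψ t| ≤ K := by
  let f : ContDiffBump (3 : ℝ) := ⟨1, 2, one_pos, one_lt_two⟩
  have hsmooth : ContDiff ℝ (⊤ : ℕ∞) f := f.contDiff
  have hsupp : tsupport f = Set.Icc (1 : ℝ) 5 := by
    rw [f.tsupport_eq, Real.closedBall_eq_Icc]
    norm_num [f]
  have hd : Continuous (deriv f) := hsmooth.continuous_deriv (by simp)
  obtain ⟨K, hK⟩ := hd.bounded_above_of_compact_support f.hasCompactSupport.deriv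
  refine ⟨f, |K| + 1, by positivity, hsmooth, fun t ht => ?_, fun t ht => ?_, fun t ht => ?_,
    fun t => ?_⟩
  · refine f.one_of_mem_closedBall ?_
    rw [Real.closedBall_eq_Icc]
    constructor
    · have := ht.1
      norm_num [f]
      linarith
    · have := ht.2
      norm_num [f]
      linarith
  · exact image_eq_zero_of_notMem_tsupport (hsupp ▸ ht)
  · exact image_eq_zero_of_notMem_tsupport fun h => ht (hsupp ▸ tsupport_deriv_subset h)
  · exact (hK t).trans ((le_abs_self K).trans (by linarith))

/-! ### Loss of energy over one time step. -/

section Step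

variable {X : Type*} [NormedAddCommGroup X] [InnerProductSpace ℂ X] [CompleteSpace X]

/-- With `ψ (t / s)` as cutoff, monotonicity of `e` bounds the left side of the cutoff estimate
below by `2 s e(4s) / b` and the right side above by `M² · 4 s (K / s)² e(0) / c`. Hence `e(4s) ≤ 2
(b / c) (M K / s)² e(0)`. -/
lemma energy_le_quarter {ψ : ℝ → ℝ} {K : ℝ} (hK : 0 < K) (hψ : ContDiff ℝ (⊤ : ℕ∞) ψ)
    (hψ1 : ∀ t ∈ Set.Icc (2 : ℝ) 4, ψ t = 1) (hψ0 : ∀ t ∉ Set.Icc (1 : ℝ) 5, ψ t = 0)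
    (hψ0' : ∀ t ∉ Set.Icc (1 : ℝ) 5, deriv ψ t = 0) (hψK : ∀ t, |deriv ψ t| ≤ K)
    {L : X →ₗ.[ℂ] X} {m : ℂ} {R : X →L[ℂ] X}
    (hR1 : ∀ f, (R f, m • R f - f) ∈ L.graph)
    (hR2 : ∀ u v, (u, v) ∈ L.graph → R (m • u - v) = u) (P : X →L[ℂ] X) {M : ℝ} (hM0 : 0 < M)
    (hM : ∀ (l : ℝ) (u v : X), (u, v) ∈ L.graph → ‖P u‖ ≤ M * ‖P ((I * (l : ℂ)) • u - v)‖)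
    {u : ℝ → X} (hu : ContDiffOn ℝ (⊤ : ℕ∞) u (Set.Ioi 0))
    (hu' : ∀ t > 0, ∃ v, (u t, v) ∈ L.graph ∧ HasDerivAt u v t)
    {e : ℝ → ℝ} {b c : ℝ} (hb : 0 < b) (hc : 0 < c) (he : AntitoneOn e (Set.Ici 0))
    (hce : ∀ t ≥ 0, c * ‖P (u t)‖ ^ 2 ≤ e t) (heb : ∀ t ≥ 0, e t ≤ b * ‖P (u t)‖ ^ 2) :
    e (4 * (M * K * (1 + 8 * (b / c)))) ≤ e 0 / 4 := by
  -- With `x = b / c`, this scale turns the factor into `2 x / (1 + 8 x)²`, which is at most `1 /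
  -- 4`.
  set s := M * K * (1 + 8 * (b / c)) with hs
  have hs0 : 0 < s := by positivity
  set χ : ℝ → ℝ := fun t => ψ (s⁻¹ * t) with hχdef
  have hχ : ContDiff ℝ (⊤ : ℕ∞) χ := hψ.comp (contDiff_const.mul contDiff_id)
  have hscale : ∀ {a b t : ℝ}, s⁻¹ * t ∈ Set.Icc a b ↔ t ∈ Set.Icc (s * a) (s * b) := by
    intro a b t
    rw [Set.mem_Icc, Set.mem_Icc, inv_mul_eq_div, le_div_iff₀' hs0, div_le_iff₀' hs0]
  have hsupp : Function.support χ ⊆ Set.Icc (s * 1) (s * 5) := by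
    intro t ht
    by_contra h
    exact ht (hψ0 _ fun h' => h (hscale.1 h'))
  have hχc : HasCompactSupport χ := HasCompactSupport.of_support_subset_isCompact isCompact_Icc hsupp
  have hts : tsupport χ ⊆ Set.Ioi 0 := by
    refine (closure_minimal hsupp isClosed_Icc).trans fun t ht => ?_
    exact lt_of_lt_of_le (by linarith) ht.1
  have hderiv : ∀ t, deriv χ t = s⁻¹ * deriv ψ (s⁻¹ * t) := fun t => by
    rw [hχdef, deriv_comp_mul_left, smul_eq_mul]
  have hmain := integral_cutoff_le hR1 hR2 P hM hu hu' hχ hχc hts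
  have he0 : 0 ≤ e 0 := le_trans (by positivity) (hce 0 le_rfl)
  have hlow : 2 * s * (e (4 * s) / b) ≤ ∫ t, ‖P (χ t • u t)‖ ^ 2 := by
    have hcont : Continuous fun t => ‖P (χ t • u t)‖ ^ 2 :=
      ((P.continuous.comp (contDiff_smul_of_tsupport_subset hχ hts hu).continuous).norm).pow 2
    have hcs : HasCompactSupport fun t => ‖P (χ t • u t)‖ ^ 2 := by
      have h1 : HasCompactSupport fun t => χ t • u t := hχc.smul_right
      exact h1.comp_left (g := fun x : X => ‖P x‖ ^ 2) (by simp)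
    have h1 : ∫ t, (Set.Icc (s * 2) (s * 4)).indicator (fun _ => e (4 * s) / b) t =
        2 * s * (e (4 * s) / b) := by
      rw [integral_indicator measurableSet_Icc, setIntegral_const, Real.volume_real_Icc_of_le
        (by linarith), smul_eq_mul]
      ring
    rw [← h1]
    refine integral_mono ((integrable_indicator_iff measurableSet_Icc).2
      (integrableOn_const (by simp))) (hcont.integrable_of_hasCompactSupport hcs) fun t => ?_
    by_cases ht : t ∈ Set.Icc (s * 2) (s * 4)
    · have ht0 : 0 ≤ t := le_trans (by positivity) ht.1
      rw [Set.indicator_of_mem ht]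
      have h2 : χ t = 1 := hψ1 _ (hscale.2 ht)
      simp only [h2, one_smul]
      rw [div_le_iff₀' hb]
      refine (he ht0 (by simp only [Set.mem_Ici]; positivity) ?_).trans (heb t ht0)
      linarith [ht.2]
    · rw [Set.indicator_of_notMem ht]
      positivity
  have hup : ∫ t, ‖P (deriv χ t • u t)‖ ^ 2 ≤ 4 * s * ((s⁻¹ * K) ^ 2 * (e 0 / c)) := by
    have h1 : ∫ t, (Set.Icc (s * 1) (s * 5)).indicator (fun _ => (s⁻¹ * K) ^ 2 * (e 0 / c)) t =
        4 * s * ((s⁻¹ * K) ^ 2 * (e 0 / c)) := by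
      rw [integral_indicator measurableSet_Icc, setIntegral_const, Real.volume_real_Icc_of_le
        (by linarith), smul_eq_mul]
      ring
    rw [← h1]
    refine integral_mono_of_nonneg (Eventually.of_forall fun t => by positivity)
      ((integrable_indicator_iff measurableSet_Icc).2 (integrableOn_const (by simp)))
      (Eventually.of_forall fun t => ?_)
    by_cases ht : t ∈ Set.Icc (s * 1) (s * 5)
    · have ht0 : 0 ≤ t := le_trans (by positivity) ht.1
      simp only [Set.indicator_of_mem ht]
      rw [ContinuousLinearMap.map_smul_of_tower, norm_smul, mul_pow, hderiv, norm_mul,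
        Real.norm_of_nonneg (inv_pos.2 hs0).le, Real.norm_eq_abs]
      refine mul_le_mul (pow_le_pow_left₀ (by positivity)
        (mul_le_mul_of_nonneg_left (hψK _) (inv_pos.2 hs0).le) 2) ?_ (by positivity)
        (by positivity)
      rw [le_div_iff₀' hc]
      exact (hce t ht0).trans (he Set.self_mem_Ici ht0 ht0)
    · simp only [Set.indicator_of_notMem ht]
      rw [hderiv, hψ0' _ fun h => ht (hscale.1 h)]
      simp
  have h1 : 2 * s * (e (4 * s) / b) ≤ M ^ 2 * (4 * s * ((s⁻¹ * K) ^ 2 * (e 0 / c))) :=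
    hlow.trans (hmain.trans (mul_le_mul_of_nonneg_left hup (sq_nonneg M)))
  set x := b / c with hx
  have hx0 : 0 < x := div_pos hb hc
  have h2 : e (4 * s) ≤ 2 * x / (1 + 8 * x) ^ 2 * e 0 := by
    have h3 : M ^ 2 * (4 * s * ((s⁻¹ * K) ^ 2 * (e 0 / c))) =
        2 * s / b * (2 * x / (1 + 8 * x) ^ 2 * e 0) := by
      have h5 : s⁻¹ * K = (M * (1 + 8 * x))⁻¹ := by
        rw [hs]
        field_simp
      rw [h5, hx]
      field_simp
      ring
    rw [h3] at h1
    have h4 : 2 * s * (e (4 * s) / b) = 2 * s / b * e (4 * s) := by ring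
    rw [h4] at h1
    exact le_of_mul_le_mul_left h1 (by positivity)
  refine h2.trans ?_
  have h3 : 2 * x / (1 + 8 * x) ^ 2 ≤ 1 / 4 := by
    rw [div_le_div_iff₀ (by positivity) (by norm_num)]
    nlinarith
  linarith [mul_le_mul_of_nonneg_right h3 he0]

end Step

/-- Decay of an antitone quantity that is divided by four over each time step. -/
lemma exp_decay_of_quarter {X : Type*} [NormedAddCommGroup X] [NormedSpace ℂ X]
    {T : ℝ → X →L[ℂ] X} (hT : IsC0Semigroup T) {e : X → ℝ} {τ : ℝ}
    (hτ : 0 < τ) (he0 : ∀ f, 0 ≤ e f)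
    (hanti : ∀ f, AntitoneOn (fun t => e (T t f)) (Set.Ici 0))
    (hq : ∀ f, e (T τ f) ≤ e f / 4) {t : ℝ} (ht : 0 ≤ t) (f : X) :
    e (T t f) ≤ 4 * Real.exp (-(t / τ)) * e f := by
  have hn : ∀ n : ℕ, e (T (n * τ) f) ≤ Real.exp (-n) * e f := by
    intro n
    induction n with
    | zero => simp [hT.zero]
    | succ n ih =>
      have h1 : T (((n + 1 : ℕ) : ℝ) * τ) f = T τ (T (n * τ) f) := by
        have := hT.add τ (n * τ) hτ.le (by positivity)
        rw [← ContinuousLinearMap.comp_apply, ← this]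
        congr 2
        push_cast
        ring
      rw [h1]
      have h2 := hq (T (n * τ) f)
      have h3 : Real.exp (-((n + 1 : ℕ) : ℝ)) = Real.exp (-n) * Real.exp (-1) := by
        rw [← Real.exp_add]
        congr 1
        push_cast
        ring
      have h4 : 1 / 4 ≤ Real.exp (-1) := by
        rw [Real.exp_neg, ← one_div]
        exact one_div_le_one_div_of_le (Real.exp_pos 1) (by linarith [Real.exp_one_lt_d9])
      rw [h3]
      have h5 : 0 ≤ Real.exp (-n) * e f := mul_nonneg (Real.exp_pos _).le (he0 f)
      nlinarith
  have hfloor := Nat.floor_le (div_nonneg ht hτ.le)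
  have hlt := Nat.lt_floor_add_one (t / τ)
  set n := ⌊t / τ⌋₊
  have h1 : (n : ℝ) * τ ≤ t := (le_div_iff₀ hτ).1 hfloor
  refine (hanti f (by simp only [Set.mem_Ici]; positivity) ht h1).trans ((hn n).trans ?_)
  refine mul_le_mul_of_nonneg_right ?_ (he0 f)
  -- Rounding `t / τ` down to an integer costs at most a factor `e`, absorbed into the constant `4`.
  have h2 : Real.exp (-n) ≤ Real.exp 1 * Real.exp (-(t / τ)) := by
    rw [← Real.exp_add, Real.exp_le_exp]
    linarith
  exact h2.trans (mul_le_mul_of_nonneg_right (by linarith [Real.exp_one_lt_d9])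
    (Real.exp_pos _).le)

/-! ### Energy equivalence and the exponential decay of the semigroup. -/

section Decay

variable {X : Type*} [NormedAddCommGroup X] [InnerProductSpace ℂ X] [CompleteSpace X]
  {H : Type*} [NormedAddCommGroup H] [InnerProductSpace ℂ H]
  {A Λ : X →ₗ.[ℂ] X} {J : X →ₗᵢ[ℂ] H} {B₁ : H →ₗ.[ℂ] H} {B₂ : X →L[ℂ] X} {c : ℝ}

/-- The energy `(u, B₂ u)`. -/
def energy (B₂ : X →L[ℂ] X) (u : X) : ℝ := (inner ℂ u (B₂ u)).re

namespace AssumptionFactor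

lemma energy_eq (hF : AssumptionFactor A Λ J B₁ B₂ c) (u : X) :
    energy B₂ u = energy B₂ (Q Λ u) := by
  rw [energy, energy, hF.B₂_Q, inner_Q_left_of_mem _ (hF.B₂_mem u)]

lemma le_energy (hF : AssumptionFactor A Λ J B₁ B₂ c) (u : X) :
    c * ‖Q Λ u‖ ^ 2 ≤ energy B₂ u := by
  rw [hF.energy_eq]
  exact hF.coercive _ (Q_mem u)

/-- The summand `1` keeps the upper constant positive even when `B₂ = 0`. -/
lemma energy_le (hF : AssumptionFactor A Λ J B₁ B₂ c) (u : X) :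
    energy B₂ u ≤ (‖B₂‖ + 1) * ‖Q Λ u‖ ^ 2 := by
  rw [hF.energy_eq]
  refine (re_le_norm _).trans ((norm_inner_le_norm _ _).trans ?_)
  have h1 := mul_le_mul_of_nonneg_left (B₂.le_opNorm (Q Λ u)) (norm_nonneg (Q Λ u))
  have h2 := sq_nonneg ‖Q Λ u‖
  linarith

/-- By symmetry of `B₂` the derivative is `2 Re (L_α u, B₂ u)`, which is nonpositive by
dissipativity. -/
lemma antitoneOn_energy (hΛ : AssumptionLambda A Λ) (hF : AssumptionFactor A Λ J B₁ B₂ c)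
    (hc : 0 < c) {α : ℝ} {u : ℝ → X} (hcont : ContinuousOn u (Set.Ici 0))
    (hu' : ∀ t > 0, ∃ v, (u t, v) ∈ (L A Λ α).graph ∧ HasDerivAt u v t) :
    AntitoneOn (fun t => energy B₂ (u t)) (Set.Ici 0) := by
  have hd : ∀ t > 0, ∃ d ≤ 0, HasDerivAt (fun t => energy B₂ (u t)) d t := by
    intro t ht
    obtain ⟨v, hv, hdv⟩ := hu' t ht
    have h1 := hdv.inner ℂ ((B₂.restrictScalars ℝ).hasFDerivAt.comp_hasDerivAt t hdv)
    have h2 := reCLM.hasFDerivAt.comp_hasDerivAt t h1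
    refine ⟨_, ?_, h2⟩
    have h3 := hF.dissipative hΛ hc hv
    change (inner ℂ (u t) (B₂ v) + inner ℂ v (B₂ (u t))).re ≤ 0
    rw [← hF.inner_B₂_symm, ← inner_conj_symm, add_re, conj_re]
    linarith
  refine antitoneOn_of_deriv_nonpos (convex_Ici 0) ?_ ?_ ?_
  · have h1 : ContinuousOn (fun t => inner ℂ (u t) (B₂ (u t))) (Set.Ici 0) :=
      hcont.inner (B₂.continuous.comp_continuousOn hcont)
    exact continuous_re.comp_continuousOn h1
  · intro t ht
    rw [interior_Ici] at ht
    obtain ⟨d, -, h⟩ := hd t ht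
    exact h.differentiableAt.differentiableWithinAt
  · intro t ht
    rw [interior_Ici] at ht
    obtain ⟨d, hd0, h⟩ := hd t ht
    rw [h.deriv]
    exact hd0

end AssumptionFactor

variable {B : Type*} [NormedAddCommGroup B] [NormedSpace ℂ B] {h₁ h₂ : ℝ → ℝ → ℝ}
  {ι : X →ₗ[ℂ] B} {B₃ : B →ₗ.[ℂ] B} {c' : ℝ}

lemma norm_Q_le_of_mem_graph (hA : AssumptionA A) (hΛ : AssumptionLambda A Λ)
    (hF : AssumptionFactor A Λ J B₁ B₂ c) (hE : AssumptionEstimate A Λ h₁ h₂ ι B₃ c')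
    (hc : 0 < c) (hc' : 0 < c') {α : ℝ} (hα : α ≠ 0) (l : ℝ) {u v : X}
    (huv : (u, v) ∈ (L A Λ α).graph) :
    ‖Q Λ u‖ ≤ pseudoConst ‖B₂‖ c c' * rate h₁ h₂ α * ‖Q Λ ((I * (l : ℂ)) • u - v)‖ := by
  obtain ⟨hu, rfl⟩ := mem_graph_iff_ev.1 huv
  rw [mem_L_domain hΛ] at hu
  rw [map_sub, map_smul, hF.Q_ev_L hΛ hu]
  exact pseudospectral_bound hA hΛ hF hE hc hc' hα l (hΛ.comm u hu).1 (Q_mem u)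

/-- The semigroup generated by `A - iαΛ` exists and decays on `𝒴` at the rate `F(α)`. -/
theorem exists_semigroup_decay {ψ : ℝ → ℝ} {K : ℝ} (hK : 0 < K) (hψ : ContDiff ℝ (⊤ : ℕ∞) ψ)
    (hψ1 : ∀ t ∈ Set.Icc (2 : ℝ) 4, ψ t = 1) (hψ0 : ∀ t ∉ Set.Icc (1 : ℝ) 5, ψ t = 0)
    (hψ0' : ∀ t ∉ Set.Icc (1 : ℝ) 5, deriv ψ t = 0) (hψK : ∀ t, |deriv ψ t| ≤ K)
    (hA : AssumptionA A) (hΛ : AssumptionLambda A Λ) (hF : AssumptionFactor A Λ J B₁ B₂ c)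
    (hE : AssumptionEstimate A Λ h₁ h₂ ι B₃ c') (hc : 0 < c) (hc' : 0 < c') (α : ℝ) :
    ∃ T : ℝ → X →L[ℂ] X, IsAnalyticSemigroup T ∧ IsGenerator (L A Λ α) T ∧
      (α ≠ 0 → ∀ t : ℝ, 0 ≤ t → ∀ f : X, ‖Q Λ (T t f)‖ ≤
        (1 + 4 * ((‖B₂‖ + 1) / c)) * Real.exp (-((8 * (pseudoConst ‖B₂‖ c c' * K *
          (1 + 8 * ((‖B₂‖ + 1) / c))))⁻¹ * t / rate h₁ h₂ α)) * ‖Q Λ f‖) := by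
  obtain ⟨T, hT, hgen, hsm, hode, m, R, hR1, hR2⟩ := exists_semigroup_L hA hΛ α
  refine ⟨T, hT, hgen, fun hα t ht f => ?_⟩
  set x := (‖B₂‖ + 1) / c with hx
  have hx0 : 0 < x := by positivity
  have hanti : ∀ f, AntitoneOn (fun t => energy B₂ (T t f)) (Set.Ici 0) := fun f =>
    AssumptionFactor.antitoneOn_energy hΛ hF hc (hT.continuous f) (hode f)
  have he0 : ∀ f, 0 ≤ energy B₂ f := fun f => le_trans (by positivity) (hF.le_energy f)
  have hT0 : ∀ f, T 0 f = f := fun f => by rw [hT.zero]; rfl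
  -- The time step is `4 M K (1 + 8 x)` with `M` proportional to `F(α)`, so `t` divided by it equals
  -- `2σ`; the energy is quadratic, and the norm therefore decays like `exp (-σ)`.
  obtain ⟨σ, hσ, hdecay⟩ : ∃ σ : ℝ,
      (8 * (pseudoConst ‖B₂‖ c c' * K * (1 + 8 * x)))⁻¹ * t / rate h₁ h₂ α = σ ∧
      energy B₂ (T t f) ≤ 4 * Real.exp (-(2 * σ)) * energy B₂ f := by
    refine ⟨_, rfl, ?_⟩
    rcases (rate_nonneg hE.h₁_adm hE.h₂_adm α).eq_or_lt with h0 | h0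
    -- If the rate is zero, division by zero gives `σ = 0`, and monotonicity of the energy is
    -- enough.
    · have h1 := hanti f Set.self_mem_Ici ht ht
      simp only [hT0] at h1
      rw [← h0, div_zero, mul_zero, neg_zero, Real.exp_zero]
      linarith [he0 f]
    · have hP := pseudoConst_pos (norm_nonneg B₂) hc hc'
      have hτ : 0 < 4 * (pseudoConst ‖B₂‖ c c' * rate h₁ h₂ α * K * (1 + 8 * x)) := by positivity
      have h1 := exp_decay_of_quarter hT.toIsC0Semigroup hτ he0 hanti (fun f => by
        have h2 := energy_le_quarter hK hψ hψ1 hψ0 hψ0' hψK hR1 hR2 (Q Λ) (mul_pos hP h0)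
          (fun l u v huv => norm_Q_le_of_mem_graph hA hΛ hF hE hc hc' hα l huv) (hsm f) (hode f)
          (by positivity : 0 < ‖B₂‖ + 1) hc (hanti f) (fun t _ => hF.le_energy _)
          (fun t _ => hF.energy_le _)
        simpa only [hT0] using h2) ht f
      convert h1 using 4
      field_simp
      ring
  rw [hσ]
  have h1 : ‖Q Λ (T t f)‖ ^ 2 ≤ 4 * x * Real.exp (-(2 * σ)) * ‖Q Λ f‖ ^ 2 := by
    refine le_of_mul_le_mul_left ?_ hc
    refine (hF.le_energy _).trans (hdecay.trans ?_)
    refine (mul_le_mul_of_nonneg_left (hF.energy_le f) (by positivity)).trans (le_of_eq ?_)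
    rw [hx]
    field_simp
  refine (pow_le_pow_iff_left₀ (norm_nonneg _) (by positivity) two_ne_zero).1 (h1.trans ?_)
  have h2 : Real.exp (-(2 * σ)) = Real.exp (-σ) ^ 2 := by
    rw [← Real.exp_nat_mul]
    congr 1
    push_cast
    ring
  rw [h2, mul_pow, mul_pow]
  refine mul_le_mul_of_nonneg_right (mul_le_mul_of_nonneg_right ?_ (by positivity))
    (by positivity)
  -- Taking square roots needs `4 x ≤ (1 + 4 x)²`.
  nlinarith

end Decay

end AbstractDecay

end

theorem theoremT (b c c' : ℝ) (hc : 0 < c) (hc' : 0 < c') :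
    ∃ C₁ C₂ : ℝ, 0 < C₁ ∧ 0 < C₂ ∧
      ∀ (X : Type*) [NormedAddCommGroup X] [InnerProductSpace ℂ X] [CompleteSpace X]
        (H : Type*) [NormedAddCommGroup H] [InnerProductSpace ℂ H] [CompleteSpace H]
        (B : Type*) [NormedAddCommGroup B] [NormedSpace ℂ B] [CompleteSpace B]
        (A Λ : X →ₗ.[ℂ] X) (J : X →ₗᵢ[ℂ] H) (B₁ : H →ₗ.[ℂ] H) (B₂ : X →L[ℂ] X)
        (h₁ h₂ : ℝ → ℝ → ℝ) (ι : X →ₗ[ℂ] B) (B₃ : B →ₗ.[ℂ] B),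
        AbstractDecay.AssumptionA A →
        AbstractDecay.AssumptionLambda A Λ →
        AbstractDecay.AssumptionFactor A Λ J B₁ B₂ c →
        ‖B₂‖ = b →
        AbstractDecay.AssumptionEstimate A Λ h₁ h₂ ι B₃ c' →
        ∀ α : ℝ, ∃ T : ℝ → X →L[ℂ] X,
          AbstractDecay.IsAnalyticSemigroup T ∧
          AbstractDecay.IsGenerator (AbstractDecay.L A Λ α) T ∧
          (α ≠ 0 → ∀ t : ℝ, 0 ≤ t → ∀ f : X,
            ‖AbstractDecay.Q Λ (T t f)‖ ≤
              C₁ * Real.exp (-(C₂ * t / AbstractDecay.rate h₁ h₂ α)) *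
                ‖AbstractDecay.Q Λ f‖) := by
  obtain ⟨ψ, K, hK, hψ, hψ1, hψ0, hψ0', hψK⟩ := AbstractDecay.exists_cutoff
  -- The constants are fixed before the operators, for an arbitrary real `b`; the absolute value
  -- ensures positivity and disappears once `b = ‖B₂‖`.
  have hP := AbstractDecay.pseudoConst_pos (abs_nonneg b) hc hc'
  refine ⟨1 + 4 * ((|b| + 1) / c),
    (8 * (AbstractDecay.pseudoConst |b| c c' * K * (1 + 8 * ((|b| + 1) / c))))⁻¹,
    by positivity, by positivity, ?_⟩
  intro X _ _ _ H _ _ _ B _ _ _ A Λ J B₁ B₂ h₁ h₂ ι B₃ hA hΛ hF hb hE α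
  subst hb
  rw [abs_norm]
  exact AbstractDecay.exists_semigroup_decay hK hψ hψ1 hψ0 hψ0' hψK hA hΛ hF hE hc hc' α
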